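/- Let $k$ be a field of prime characteristic $p$, let $R=k[[x_1,\dots,x_n]]$, let $I\subsetneq R$ be an ideal generated by square-free monomials, and let $S=R/I$. For an ideal $L$, let $L^{[p]}$ be the ideal generated by the $p$-th powers of the elements of $L$. Let $x^\beta$ be the product of those variables $x_i$ that lie in the sum of the minimal primes of $I$ (the components of its minimal primary decomposition). Let $J_p$ be the ideal of $R$ generated by the minimal monomial generators of the colon ideal $(I^{[p]}:I)$ that are not in $I^{[p]}$ and are different from $(x^\beta)^{p-1}$, so that $(I^{[p]}:I)=I^{[p]}+J_p+((x^\beta)^{p-1})$. Then $M=(I^{[p]}+J_p)/I^{[p]}$ is an $S$-module. For a local ring $A$ of characteristic $p$ let $E_A$ be the injective hull of its residue field, let $\mathcal F^e(E_A)$ be the set of additive maps $\varphi:E_A\to E_A$ with $\varphi(rz)=r^{p^e}\varphi(z)$ for all $r\in A$, $z\in E_A$, and let $\mathcal F(E_A)=\bigoplus_{e\ge 0}\mathcal F^e(E_A)$, a graded ring under composition. If $A$ is Noetherian, then $\mathcal F^0(E_A)=\mathrm{End}_A(E_A)$ is the completion $\widehat A$ of $A$, and finite generation of $\mathcal F(E_A)$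 means finite generation as an algebra over $\mathcal F^0(E_A)=\widehat A$. Let $$U=\{Q\in\mathrm{Spec}\,S:\ \mathcal F(E_{S_Q})\text{ is a finitely generated }\widehat{S_Q}\text{-algebra}\},\qquad U'=\mathrm{Spec}(S)\setminus V(\mathrm{Ann}_S(M)).$$ Then: 1. $U'$ is open and $U'\subseteq U$. 2. $U$ has non-empty interior. 3. For every $Q\in U'$, $\mathcal F(E_{S_Q})$ is the principally generated skew polynomial ring $\widehat{S_Q}[x^{\beta(p-1)}\theta,f]$. That is, let $P\subset R$ be the preimage of $Q$, and let $\widehat{S_Q}[X,f]$ be the free left $\widehat{S_Q}$-module on the powers of $X$, with multiplication determined by $Xb=b^pX$. There are an element $\theta\in\mathcal F^1(E_{R_P})$ generating $\mathcal F(E_{R_P})$ as an algebra over $\mathcal F^0(E_{R_P})$, an identification of $E_{S_Q}$ with $\mathrm{Ann}_{E_{R_P}}(IR_P)$, and an isomorphism of graded rings $\widehat{S_Q}[X,f]\cong\mathcal F(E_{S_Q})$ sending each $b\in S_Q$ to multiplication by $b$ on $E_{S_Q}$, and sending $X$ to the restriction of $(x^\beta)^{p-1}\theta$ to $E_{S_Q}$.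 -/

import Mathlib

universe u

namespace FrobeniusLocus

section InjectiveHull

/-- `ι : N → E` exhibits `E` as an injective hull of the `A`-module `N`: it is injective, `E` is an
injective module, and every nonzero submodule of `E` meets the image of `N` nontrivially. -/
structure IsInjectiveHull {A N E : Type u} [CommRing A] [AddCommGroup N] [Module A N]
    [AddCommGroup E] [Module A E] (ι : N →ₗ[A] E) : Prop where
  injective : Function.Injective ι
  injective_module : Module.Injective A E
  essential : ∀ T : Submodule A E, T ⊓ LinearMap.range ι = ⊥ → T = ⊥

theorem exists_injective_embedding (A N : Type u) [CommRing A] [AddCommGroup N] [Module A N] :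
    ∃ (F : Type u) (_ : AddCommGroup F) (_ : Module A F) (ι : N →ₗ[A] F),
      Module.Injective A F ∧ Function.Injective ι := by
  let P := (CategoryTheory.EnoughInjectives.presentation (ModuleCat.of A N)).some
  have hP : CategoryTheory.Injective P.J := P.injective
  have hm : CategoryTheory.Mono P.f := P.mono
  exact ⟨P.J, inferInstance, inferInstance, P.f.hom,
    Module.injective_module_of_injective_object A P.J,
    (ModuleCat.mono_iff_injective P.f).mp hm⟩

theorem exists_injectiveHull (A N : Type u) [CommRing A] [AddCommGroup N] [Module A N] :
    ∃ (E : Type u) (_ : AddCommGroup E) (_ : Module A E) (ι : N →ₗ[A] E),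
      IsInjectiveHull ι := by
  obtain ⟨F, _, _, ι, hF, hι⟩ := exists_injective_embedding A N
  let N' := LinearMap.range ι
  let s : Set (Submodule A F) := {E | N' ≤ E ∧ ∀ T ≤ E, T ⊓ N' = ⊥ → T = ⊥}
  have cyc : ∀ E : Submodule A F,
      (∀ x ∈ E, Submodule.span A {x} ⊓ N' = ⊥ → x = 0) → ∀ T ≤ E, T ⊓ N' = ⊥ → T = ⊥ := by
    intro E h T hT hTN
    refine (Submodule.eq_bot_iff _).2 fun x hx => h x (hT hx) ?_
    refine le_bot_iff.1 (hTN ▸ inf_le_inf_right _ ?_)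
    simpa using hx
  obtain ⟨E, -, hE⟩ := zorn_le_nonempty₀ s (by
    intro c hc hch y hy
    refine ⟨sSup c, ⟨(hc hy).1.trans (le_sSup hy), cyc _ fun x hx hxN => ?_⟩,
      fun z hz => le_sSup hz⟩
    obtain ⟨z, hz, hxz⟩ := (Submodule.mem_sSup_of_directed ⟨y, hy⟩ hch.directedOn).1 hx
    have := (hc hz).2 (Submodule.span A {x}) (by simpa using hxz) hxN
    simpa using this) N' ⟨le_rfl, fun T hT h => by rwa [inf_eq_left.2 hT] at h⟩
  obtain ⟨C, -, hC⟩ := zorn_le_nonempty₀ {C : Submodule A F | C ⊓ E = ⊥} (by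
    intro c hc hch y hy
    refine ⟨sSup c, ?_, fun z hz => le_sSup hz⟩
    refine (Submodule.eq_bot_iff _).2 fun x hx => ?_
    obtain ⟨z, hz, hxz⟩ := (Submodule.mem_sSup_of_directed ⟨y, hy⟩ hch.directedOn).1 hx.1
    exact (Submodule.eq_bot_iff _).1 (hc hz) x ⟨hxz, hx.2⟩) ⊥ (by simp)
  have hCE : C ⊓ E = ⊥ := hC.prop
  let q : E →ₗ[A] F ⧸ C := C.mkQ ∘ₗ E.subtype
  have hq : Function.Injective q := by
    refine (injective_iff_map_eq_zero q).2 fun x hx => ?_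
    have : (x : F) ∈ C ⊓ E := ⟨by simpa [q] using hx, x.2⟩
    rw [hCE] at this
    simpa using this
  obtain ⟨g, hg⟩ := hF.out q hq E.subtype
  have hgE : ∀ x ∈ E, g (C.mkQ x) = x := fun x hx => hg ⟨x, hx⟩
  -- the kernel of `g` is trivial, by maximality of `C`
  have hker : LinearMap.ker g = ⊥ := by
    have h1 : (LinearMap.ker g).comap C.mkQ ≤ C := by
      refine hC.le_of_ge ?_ ?_
      · refine (Submodule.eq_bot_iff _).2 fun x hx => ?_
        rw [← hgE x hx.2]; exact hx.1
      · intro x hx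
        have : C.mkQ x = 0 := by simpa using hx
        change g (C.mkQ x) = 0
        rw [this, map_zero]
    refine (Submodule.eq_bot_iff _).2 fun y hy => ?_
    obtain ⟨x, rfl⟩ := C.mkQ_surjective y
    simpa using h1 hy
  have hEg : E ≤ LinearMap.range g := fun x hx => ⟨C.mkQ x, hgE x hx⟩
  have hgs : LinearMap.range g ∈ s := by
    refine ⟨hE.prop.1.trans hEg, fun T hT hTN => ?_⟩
    have hTE : T ⊓ E = ⊥ := hE.prop.2 _ inf_le_right (by
      rw [inf_assoc, inf_eq_right.2 hE.prop.1, hTN])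
    -- the preimage of `T` in `F` meets `E` trivially and contains `C`
    have h1 : (T.comap g).comap C.mkQ ≤ C := by
      refine hC.le_of_ge ?_ ?_
      · refine (Submodule.eq_bot_iff _).2 fun x hx => ?_
        have : x ∈ T ⊓ E := ⟨by rw [← hgE x hx.2]; exact hx.1, hx.2⟩
        rw [hTE] at this
        simpa using this
      · intro x hx
        have : C.mkQ x = 0 := by simpa using hx
        change g (C.mkQ x) ∈ T
        rw [this, map_zero]
        exact T.zero_mem
    refine (Submodule.eq_bot_iff _).2 fun t ht => ?_
    obtain ⟨y, rfl⟩ := hT ht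
    obtain ⟨x, rfl⟩ := C.mkQ_surjective y
    have : x ∈ C := h1 ht
    have : C.mkQ x = 0 := by simpa using this
    rw [this, map_zero]
  have hgE' : LinearMap.range g ≤ E := hE.le_of_ge hgs hEg
  let r : F →ₗ[A] E := (g ∘ₗ C.mkQ).codRestrict E fun x => hgE' ⟨_, rfl⟩
  refine ⟨E, inferInstance, inferInstance, ι.codRestrict E fun x => hE.prop.1 ⟨x, rfl⟩,
    ⟨fun x y h => hι (congrArg Subtype.val h), ⟨?_⟩, ?_⟩⟩
  · intro X Y _ _ _ _ f hf h
    obtain ⟨l, hl⟩ := hF.out f hf (E.subtype ∘ₗ h)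
    refine ⟨r ∘ₗ l, fun x => Subtype.ext ?_⟩
    change g (C.mkQ (l (f x))) = h x
    rw [hl]
    exact hgE _ (h x).2
  · intro T hT
    have : T.map E.subtype = ⊥ := by
      refine hE.prop.2 _ (Submodule.map_subtype_le E T) ?_
      refine (Submodule.eq_bot_iff _).2 ?_
      rintro _ ⟨⟨x, hx, rfl⟩, n, hn⟩
      have : x ∈ T ⊓ LinearMap.range (ι.codRestrict E fun x => hE.prop.1 ⟨x, rfl⟩) :=
        ⟨hx, n, Subtype.ext hn⟩
      rw [hT] at this
      simpa using this
    exact Submodule.map_injective_of_injective E.injective_subtype (by simpa using this)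

variable (A N : Type u) [CommRing A] [AddCommGroup N] [Module A N]

/-- The injective hull `E_A(N)` of an `A`-module `N`. -/
def InjectiveHull : Type u := (exists_injectiveHull A N).choose

noncomputable instance : AddCommGroup (InjectiveHull A N) :=
  (exists_injectiveHull A N).choose_spec.choose

noncomputable instance : Module A (InjectiveHull A N) :=
  (exists_injectiveHull A N).choose_spec.choose_spec.choose

/-- The inclusion of `N` into its injective hull. -/
noncomputable def InjectiveHull.incl : N →ₗ[A] InjectiveHull A N :=
  (exists_injectiveHull A N).choose_spec.choose_spec.choose_spec.choose

theorem InjectiveHull.isInjectiveHull : IsInjectiveHull (InjectiveHull.incl A N) :=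
  (exists_injectiveHull A N).choose_spec.choose_spec.choose_spec.choose_spec

/-- `E_A`, the injective hull of the residue field of a local ring `A`. -/
abbrev ResidueHull (A : Type u) [CommRing A] [IsLocalRing A] : Type u :=
  InjectiveHull A (IsLocalRing.ResidueField A)

end InjectiveHull

section FrobeniusAlgebra

open DirectSum

/-- `F^e(M)`: the additive maps `φ : M → M` with `φ (r x) = r ^ (p ^ e) φ x`. -/
def frobeniusMaps (p : ℕ) (A M : Type*) [CommRing A] [AddCommGroup M] [Module A M] (e : ℕ) :
    AddSubgroup (AddMonoid.End M) where
  carrier := {φ | ∀ (r : A) (x : M), φ (r • x) = r ^ p ^ e • φ x}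
  zero_mem' := fun r x => by simp
  add_mem' := fun {φ ψ} hφ hψ r x => by
    change φ (r • x) + ψ (r • x) = r ^ p ^ e • (φ x + ψ x)
    rw [hφ, hψ, smul_add]
  neg_mem' := fun {φ} hφ r x => by
    change -(φ (r • x)) = r ^ p ^ e • -(φ x)
    rw [hφ, smul_neg]

variable (p : ℕ) (A M : Type*) [CommRing A] [AddCommGroup M] [Module A M]

/-- Composition maps `F^e(M) × F^e'(M)` into `F^(e+e')(M)`. -/
instance : SetLike.GradedMonoid (frobeniusMaps p A M) where
  one_mem := fun r x => by simp
  mul_mem := fun {e e'} {φ ψ} hφ hψ r x => by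
    change φ (ψ (r • x)) = r ^ p ^ (e + e') • φ (ψ x)
    rw [hψ, hφ, ← pow_mul, pow_add, mul_comm (p ^ e')]

/-- The Frobenius algebra `F(M) = ⨁ F^e(M)`, an `ℕ`-graded ring under composition. -/
abbrev FrobeniusAlgebra : Type _ := ⨁ e : ℕ, frobeniusMaps p A M e

/-- `T` generates the Frobenius algebra of `M` as an algebra over its degree zero part
`F^0(M) = End_A(M)`. -/
def GeneratesFrobeniusAlgebra (T : Set (FrobeniusAlgebra p A M)) : Prop :=
  Subring.closure (Set.range (DirectSum.of (fun e => frobeniusMaps p A M e) 0) ∪ T) = ⊤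

/-- Finite generation of the Frobenius algebra of `M` as an algebra over its degree zero part. -/
def FrobeniusAlgebraFG : Prop :=
  ∃ T : Finset (FrobeniusAlgebra p A M), GeneratesFrobeniusAlgebra p A M (T : Set _)

variable {A} in
/-- Multiplication by a scalar, as an element of `F^0(M)`. -/
def scalarMap (a : A) : frobeniusMaps p A M 0 :=
  ⟨AddMonoidHom.mk' (fun x => a • x) (smul_add a), fun r x => by
    change a • r • x = r ^ p ^ 0 • a • x
    rw [pow_zero, pow_one, smul_comm]⟩

/-- The finitely generated locus: the primes `Q` such that `F(E_{S_Q})` is finitely generated over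
`F^0(E_{S_Q})`. When `S_Q` is Noetherian, the ring `F^0(E_{S_Q})` is the completion of `S_Q`, by
Matlis duality. -/
def fgLocus (p : ℕ) (S : Type u) [CommRing S] : Set (PrimeSpectrum S) :=
  {Q | FrobeniusAlgebraFG p (Localization.AtPrime Q.asIdeal)
    (ResidueHull (Localization.AtPrime Q.asIdeal))}

end FrobeniusAlgebra

section SkewPolynomial

/-- `i : ℕ` acts on a ring of characteristic `p` by the `i`-th iterate of the Frobenius. -/
@[reducible]
def frobeniusAction (p : ℕ) [Fact p.Prime] (B : Type*) [CommRing B] [CharP B p] :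
    MulSemiringAction (Multiplicative ℕ) B where
  smul i b := b ^ p ^ i.toAdd
  one_smul b := by change b ^ p ^ 0 = b; simp
  mul_smul i j b := by
    change b ^ p ^ (i.toAdd + j.toAdd) = (b ^ p ^ j.toAdd) ^ p ^ i.toAdd
    rw [← pow_mul, pow_add, mul_comm]
  smul_zero i := by
    change (0 : B) ^ p ^ i.toAdd = 0
    exact zero_pow (pow_ne_zero _ (Fact.out : p.Prime).ne_zero)
  smul_add i b c := add_pow_char_pow b c p i.toAdd
  smul_one i := one_pow _
  smul_mul i b c := mul_pow b c _

/-- The Frobenius skew polynomial ring `B[θ, f]`: the free left `B`-module on the powers of `θ`,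
with multiplication determined by `θ b = b ^ p θ`. -/
def FrobeniusSkewPolynomial (_p : ℕ) (B : Type*) [CommRing B] : Type _ := SkewPolynomial B

variable (p : ℕ) [Fact p.Prime] {B : Type*} [CommRing B] [CharP B p]

noncomputable instance : Ring (FrobeniusSkewPolynomial p B) :=
  letI := frobeniusAction p B
  inferInstanceAs (Ring (SkewMonoidAlgebra B (Multiplicative ℕ)))

/-- The constants of `B[θ, f]`. -/
noncomputable def FrobeniusSkewPolynomial.C : B →+* FrobeniusSkewPolynomial p B :=
  letI := frobeniusAction p B
  SkewPolynomial.CRingHom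

variable (B) in
/-- The variable of `B[θ, f]`. -/
noncomputable def FrobeniusSkewPolynomial.var : FrobeniusSkewPolynomial p B :=
  (SkewPolynomial.X : SkewPolynomial B)

theorem FrobeniusSkewPolynomial.var_mul_C (b : B) :
    var p B * C p b = C p (b ^ p) * var p B := by
  let _ := frobeniusAction p B
  have h : (SkewPolynomial.monomial 1 (1 : B)) * SkewPolynomial.C b =
      SkewPolynomial.C (b ^ p) * SkewPolynomial.monomial 1 (1 : B) := by
    rw [SkewPolynomial.monomial_mul_C, SkewPolynomial.C_mul_monomial, one_mul, mul_one,
      SkewPolynomial.φ_iterate_apply]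
    change SkewPolynomial.monomial 1 (b ^ p ^ 1) = _
    rw [pow_one]
  exact h

end SkewPolynomial

section MonomialIdeals

open MvPowerSeries

variable {k : Type u} [Field k] {n : ℕ}

/-- `I` is generated by square-free monomials. -/
def IsSquarefreeMonomialIdeal (I : Ideal (MvPowerSeries (Fin n) k)) : Prop :=
  ∃ G : Set (Finset (Fin n)),
    I = Ideal.span ((fun s : Finset (Fin n) => ∏ i ∈ s, (X i : MvPowerSeries (Fin n) k)) '' G)

/-- The Frobenius power `I^[p^e]`. -/
def frobeniusPower {R : Type*} [CommRing R] (p : ℕ) (I : Ideal R) (e : ℕ) : Ideal R :=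
  Ideal.span ((fun a => a ^ p ^ e) '' (I : Set R))

open Classical in
/-- `x^β`, the product of the variables that lie in the sum of the minimal primes of `I`. For a
square-free monomial ideal these primes are the components of its minimal primary
decomposition. -/
noncomputable def xBeta (I : Ideal (MvPowerSeries (Fin n) k)) : MvPowerSeries (Fin n) k :=
  ∏ i with (X i : MvPowerSeries (Fin n) k) ∈ sSup I.minimalPrimes, X i

/-- The exponents of the minimal monomial generators of a monomial ideal `L`. -/
noncomputable def minimalExponents (L : Ideal (MvPowerSeries (Fin n) k)) : Set (Fin n →₀ ℕ) :=
  {c | Minimal (fun d => (monomial d (1 : k) : MvPowerSeries (Fin n) k) ∈ L) c}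

/-- `J_p`: the ideal generated by the minimal monomial generators of `(I^[p] : I)` other than
`(x^β)^(p-1)` and those in `I^[p]`. -/
noncomputable def idealJ (p : ℕ) (I : Ideal (MvPowerSeries (Fin n) k)) : Ideal (MvPowerSeries (Fin n) k) :=
  Ideal.span ((fun c => (monomial c (1 : k) : MvPowerSeries (Fin n) k)) ''
    {c | c ∈ minimalExponents ((frobeniusPower p I 1).colon (I : Set (MvPowerSeries (Fin n) k))) ∧
      (monomial c (1 : k) : MvPowerSeries (Fin n) k) ∉ frobeniusPower p I 1 ∧
      (monomial c (1 : k) : MvPowerSeries (Fin n) k) ≠ xBeta I ^ (p - 1)})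

/-- The module `M = (I^[p] + J_p) / I^[p]`. -/
noncomputable def ModuleM (p : ℕ) (I : Ideal (MvPowerSeries (Fin n) k)) : Type u :=
  ↥(frobeniusPower p I 1 ⊔ idealJ p I) ⧸
    (frobeniusPower p I 1).submoduleOf (frobeniusPower p I 1 ⊔ idealJ p I)

variable (p : ℕ) (I : Ideal (MvPowerSeries (Fin n) k))

noncomputable instance : AddCommGroup (ModuleM p I) :=
  inferInstanceAs (AddCommGroup (_ ⧸ (frobeniusPower p I 1).submoduleOf _))

noncomputable instance : Module (MvPowerSeries (Fin n) k) (ModuleM p I) :=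
  inferInstanceAs (Module _ (_ ⧸ (frobeniusPower p I 1).submoduleOf _))

theorem ModuleM.isTorsionBySet :
    Module.IsTorsionBySet (MvPowerSeries (Fin n) k) (ModuleM p I) (I : Set _) := by
  have hJ : idealJ p I ≤ (frobeniusPower p I 1).colon (I : Set (MvPowerSeries (Fin n) k)) := by
    refine Ideal.span_le.2 ?_
    rintro _ ⟨c, hc, rfl⟩
    exact Minimal.prop (P := fun d => (monomial d (1 : k) : MvPowerSeries (Fin n) k) ∈
      (frobeniusPower p I 1).colon (I : Set (MvPowerSeries (Fin n) k))) hc.1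
  have hL : frobeniusPower p I 1 ⊔ idealJ p I ≤
      (frobeniusPower p I 1).colon (I : Set (MvPowerSeries (Fin n) k)) :=
    sup_le Ideal.le_colon hJ
  intro x a
  obtain ⟨y, rfl⟩ := Submodule.Quotient.mk_surjective _ x
  refine (Submodule.Quotient.mk_eq_zero _).2 ?_
  have := Submodule.mem_colon.1 (hL y.2) a a.2
  rw [smul_eq_mul, mul_comm] at this
  exact this

/-- `M` is annihilated by `I`, hence is a module over `S = R / I`. -/
noncomputable instance : Module (MvPowerSeries (Fin n) k ⧸ I) (ModuleM p I) :=
  (ModuleM.isTorsionBySet p I).module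

/-- `U' = Spec S \ V(Ann_S M)`. -/
def openLocus : Set (PrimeSpectrum (MvPowerSeries (Fin n) k ⧸ I)) :=
  (PrimeSpectrum.zeroLocus
    (Module.annihilator (MvPowerSeries (Fin n) k ⧸ I) (ModuleM p I) : Set _))ᶜ

end MonomialIdeals

section Stalks

/-- The completion of a local ring with respect to its maximal ideal. -/
abbrev LocalCompletion (A : Type*) [CommRing A] [IsLocalRing A] : Type _ :=
  AdicCompletion (IsLocalRing.maximalIdeal A) A

instance (A : Type*) [CommRing A] [IsLocalRing A] : Nontrivial (LocalCompletion A) := by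
  have : Nontrivial (A ⧸ IsLocalRing.maximalIdeal A) :=
    Ideal.Quotient.nontrivial_iff.2 (Ideal.IsPrime.ne_top inferInstance)
  exact (AdicCompletion.evalOneₐ (IsLocalRing.maximalIdeal A)).toRingHom.domain_nontrivial

instance (p : ℕ) [Fact p.Prime] (A : Type*) [CommRing A] [IsLocalRing A] [CharP A p] :
    CharP (LocalCompletion A) p := by
  refine (CharP.charP_iff_prime_eq_zero Fact.out).2 ?_
  rw [← map_natCast (algebraMap A (LocalCompletion A)), CharP.cast_eq_zero, map_zero]

instance {k : Type u} [Field k] {n : ℕ} (p : ℕ) [CharP k p]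
    (I : Ideal (MvPowerSeries (Fin n) k)) (Q : PrimeSpectrum (MvPowerSeries (Fin n) k ⧸ I)) :
    CharP (Localization.AtPrime Q.asIdeal) p :=
  charP_of_injective_ringHom (R := k)
    ((algebraMap (MvPowerSeries (Fin n) k ⧸ I) (Localization.AtPrime Q.asIdeal)).comp
      ((Ideal.Quotient.mk I).comp MvPowerSeries.C)).injective p

/-- Let `π : A → B` be a surjection of local rings, let `E_A`, `E_B` be the injective hulls of the
residue fields, and let `u ∈ A`. This says that `F(E_B)` is the skew polynomial ring
`B^[u θ, f]` over the completion `B^` of `B`, where `θ` generates `F(E_A)`. Precisely: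

* `θ ∈ F^1(E_A)` generates `F(E_A)` as an algebra over `F^0(E_A)`;
* `j` identifies `E_B` with the submodule `Ann(ker π)` of `E_A`;
* `Φ` is a graded ring isomorphism from the skew polynomial ring over `B^` onto `F(E_B)`, which
  sends `b ∈ B` to multiplication by `b` and the variable to the restriction of `u θ` to `E_B`. -/
def IsPrincipalSkewPolynomial (p : ℕ) [Fact p.Prime] (A B : Type u) [CommRing A] [IsLocalRing A]
    [CommRing B] [IsLocalRing B] [CharP B p] (π : A →+* B) (u : A) : Prop :=
  ∃ (θ : frobeniusMaps p A (ResidueHull A) 1) (j : ResidueHull B →+ ResidueHull A)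
    (ξ : frobeniusMaps p B (ResidueHull B) 1)
    (Φ : FrobeniusSkewPolynomial p (LocalCompletion B) ≃+* FrobeniusAlgebra p B (ResidueHull B)),
    GeneratesFrobeniusAlgebra p A (ResidueHull A)
      {DirectSum.of (fun e => frobeniusMaps p A (ResidueHull A) e) 1 θ} ∧
    (∀ (a : A) (x : ResidueHull B), j (π a • x) = a • j x) ∧
    Function.Injective j ∧
    (Set.range j = {z | ∀ a ∈ RingHom.ker π, a • z = 0}) ∧
    (∀ x : ResidueHull B, j (ξ.1 x) = u • θ.1 (j x)) ∧
    (∀ b : LocalCompletion B, ∃ φ : frobeniusMaps p B (ResidueHull B) 0,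
      Φ (FrobeniusSkewPolynomial.C p b) =
        DirectSum.of (fun e => frobeniusMaps p B (ResidueHull B) e) 0 φ) ∧
    (∀ b : B, Φ (FrobeniusSkewPolynomial.C p (algebraMap B (LocalCompletion B) b)) =
      DirectSum.of (fun e => frobeniusMaps p B (ResidueHull B) e) 0
        (scalarMap p (ResidueHull B) b)) ∧
    Φ (FrobeniusSkewPolynomial.var p (LocalCompletion B)) =
      DirectSum.of (fun e => frobeniusMaps p B (ResidueHull B) e) 1 ξ

/-- The surjection `R_P → S_Q` induced by `R → S = R / I`, where `P` is the preimage of `Q`. -/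
noncomputable def stalkMap {R : Type u} [CommRing R] (I : Ideal R) (Q : PrimeSpectrum (R ⧸ I)) :
    Localization.AtPrime (Q.asIdeal.comap (Ideal.Quotient.mk I)) →+*
      Localization.AtPrime Q.asIdeal :=
  Localization.localRingHom _ Q.asIdeal (Ideal.Quotient.mk I) rfl

end Stalks

end FrobeniusLocus

/-! The mechanism is Fedder's. Let `A` be a Noetherian local ring with flat Frobenius (here `A =
R_P`), let `E` be the injective hull of its residue field, and let `B = A / I`, whose hull is `Ann_E
I`. There is a `p`-linear map `θ` on `E` such that every `p^e`-linear map on `E` is a multiple of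
`θ^e`. Those of `Ann_E I` come from `r θ^e` with `r ∈ (I^[p^e] : I)`, and `r` acts as zero exactly
when it lies in `I^[p^e]`, up to completion. If `(I^[p] : I) = I^[p] + (u)` and `(I^[p] : u) = I`,
then flatness of Frobenius propagates both equalities to all `e`, with `u^(1 + p + ⋯ + p^(e-1))` in
place of `u`. Hence `ξ = uθ` generates freely, and the Frobenius algebra is the skew polynomial ring
in `ξ` (`isPrincipalSkewPolynomial_and_fg`).

No local cohomology or theory of regular rings enters; `θ` is built from flat Frobenius alone.
Relations among minimal generators `y_i` of the maximal ideal have coefficients in that ideal.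
Flatness carries this to the `y_i^(p^N)`, and Lech's argument carries it down to all powers
`y_i^(a_i)`. This yields the colons and socles of the ideals `Y_t = (y_i^t)`, a tower `e_t ∈ E` with
annihilators `Y_t` and `E = ⋃ A e_t`, and the map `θ(a e_t) = a^p e_{pt}`
(`exists_frobeniusSystem`). Since `A` is not complete, coefficients are found only on the elements
killed by a given power of the maximal ideal. The theorem of Artin and Rees controls the error, and
the approximations converge in the completion of `B`.

For square-free monomial ideals the colon conditions are statements about exponents. Always `(I^[p]
: x^(β(p-1))) = I` and `(I^[p] : I) = I^[p] + J_p + (x^(β(p-1)))`. At a point of `U'` some element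
outside the prime multiplies `J_p` into `I^[p]`, so after localization only `x^(β(p-1))` is left.
The interior of `U` is treated without `U'`: if `V` is a minimal set of variables meeting every
generator, then inverting the other variables turns `I` into `(x_i : i ∈ V)`, where `∏_{i ∈ V}
x_i^(p-1)` plays the role of `u`. -/

namespace FrobeniusLocus

/-! ### Flat base change: semilinear extension and colon ideals -/

section Flat

open TensorProduct

/-- A semilinear map out of `N` is an `A'`-linear map out of `A' ⊗ N`, which embeds in `A' ⊗ M` by
flatness, so injectivity of `E` over `A'` extends it. Applied to iterates of Frobenius, it extends
`p^e`-linear maps from submodules of a hull. -/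
theorem exists_semilinear_extension {A A' M E : Type u} [CommRing A] [CommRing A']
    [AddCommGroup M] [Module A M] [AddCommGroup E] [Module A' E] (hE : Module.Injective A' E)
    {f : A →+* A'} (hf : f.Flat) (N : Submodule A M) (φ : N →+ E)
    (hφ : ∀ (a : A) (x : N), φ (a • x) = f a • φ x) :
    ∃ ψ : M →+ E, (∀ (a : A) (x : M), ψ (a • x) = f a • ψ x) ∧ ∀ x : N, ψ x = φ x := by
  let _ : Algebra A A' := f.toAlgebra
  have : Module.Flat A A' := hf
  let _ : Module A E := Module.compHom E f
  have hsmul : ∀ (a : A) (z : E), a • z = f a • z := fun _ _ => rfl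
  have : IsScalarTower A A' E := ⟨fun a b z => by
    rw [Algebra.smul_def, mul_smul]; rfl⟩
  let φ' : N →ₗ[A] E := { φ with map_smul' := hφ }
  let g : A' ⊗[A] N →ₗ[A'] E := φ'.liftBaseChange A'
  have hinj : Function.Injective (N.subtype.baseChange A') :=
    Module.Flat.lTensor_preserves_injective_linearMap N.subtype N.injective_subtype
  obtain ⟨h, hh⟩ := hE.out (N.subtype.baseChange A') hinj g
  refine ⟨h.toAddMonoidHom.comp (TensorProduct.mk A A' M 1).toAddMonoidHom, fun a x => ?_,
    fun x => ?_⟩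
  · change h (1 ⊗ₜ (a • x)) = f a • h (1 ⊗ₜ x)
    rw [← map_smul, TensorProduct.tmul_smul, TensorProduct.smul_tmul', TensorProduct.smul_tmul',
      smul_eq_mul, mul_one, Algebra.smul_def, mul_one]
    rfl
  · have := hh (1 ⊗ₜ x)
    change h (1 ⊗ₜ (x : M)) = φ x
    simpa [g, φ'] using this

/-- Membership of `s` in the left-hand colon says that `s`, together with certain coefficients,
solves a finite linear system over `A`. By the equational criterion this solution is a combination
of solutions over `A`, whose first coordinates lie in the original colon. -/
theorem map_colon_of_flat {A A' : Type*} [CommRing A] [CommRing A'] {f : A →+* A'} (hf : f.Flat)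
    {L N : Ideal A} (hL : L.FG) (hN : N.FG) :
    (L.map f).colon (N.map f : Set A') = (L.colon (N : Set A)).map f := by
  apply le_antisymm
  · obtain ⟨a, l, rfl⟩ := Submodule.fg_iff_exists_fin_generating_family.1 hL
    obtain ⟨b, m, rfl⟩ := Submodule.fg_iff_exists_fin_generating_family.1 hN
    intro s hs
    let _ : Algebra A A' := f.toAlgebra
    have : Module.Flat A A' := hf
    have hsmul : ∀ (c : A) (z : A'), c • z = f c * z := fun _ _ => rfl
    have h1 : ∀ i, ∃ c : Fin a → A', ∑ k, c k * f (l k) = s * f (m i) := by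
      intro i
      have h2 : s * f (m i) ∈ Ideal.span (Set.range fun k => f (l k)) := by
        have h3 : Ideal.map f (Submodule.span A (Set.range l)) =
            Ideal.span (Set.range fun k => f (l k)) := by
          change Ideal.map f (Ideal.span _) = _
          rw [Ideal.map_span, ← Set.range_comp]; rfl
        rw [← h3]
        exact Submodule.mem_colon.1 hs _
          (Ideal.mem_map_of_mem f (Submodule.subset_span ⟨i, rfl⟩))
      exact (Ideal.mem_span_range_iff_exists_fun).1 h2
    choose c hc using h1
    -- The equations `s f(m_i) = ∑ k, c i k f(l_k)` say that the functional `x`, with values `s` and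
    -- `-c`, vanishes on the vectors `(m_i, l)` spanning the range of `g`.
    let g : (Fin b → A) →ₗ[A] A × (Fin b → Fin a → A) :=
      LinearMap.prod (∑ i, (LinearMap.proj i : (Fin b → A) →ₗ[A] A).smulRight (m i))
        (LinearMap.pi fun i => LinearMap.pi fun k =>
          (LinearMap.proj i : (Fin b → A) →ₗ[A] A).smulRight (l k))
    let x : A × (Fin b → Fin a → A) →ₗ[A] A' :=
      LinearMap.coprod (LinearMap.toSpanSingleton A A' s)
        (-∑ i, ∑ k, (LinearMap.toSpanSingleton A A' (c i k)) ∘ₗ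
          (LinearMap.proj k : (Fin a → A) →ₗ[A] A) ∘ₗ LinearMap.proj i)
    have hg : ∀ v, g v = (∑ i, v i * m i, fun i k => v i * l k) := fun v => by
      ext <;> simp [g]
    have hx : ∀ w, x w = f w.1 * s + -∑ i, ∑ k, f (w.2 i k) * c i k := fun w => by
      simp [x, hsmul]
    have hxg : x ∘ₗ g = 0 := by
      refine LinearMap.ext fun v => ?_
      rw [LinearMap.comp_apply, hg, hx, LinearMap.zero_apply, ← sub_eq_add_neg, sub_eq_zero]
      simp only [map_sum, map_mul, Finset.sum_mul]
      refine Finset.sum_congr rfl fun i _ => ?_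
      rw [mul_assoc, mul_comm (f (m i)), ← hc i, Finset.mul_sum]
      exact Finset.sum_congr rfl fun k _ => by ring
    obtain ⟨k, α, y, hy, hα⟩ := Module.Flat.exists_factorization_of_comp_eq_zero_of_free hxg
    have hs' : s = y (α (1, 0)) := by
      have := LinearMap.congr_fun hy (1, 0)
      simpa [x, hsmul] using this
    have hmem : ∀ j, α (1, 0) j ∈ (Submodule.span A (Set.range l)).colon
        (Submodule.span A (Set.range m) : Set A) := by
      intro j
      rw [Submodule.colon_span, Submodule.mem_colon]
      rintro _ ⟨i, rfl⟩
      have h2 := LinearMap.congr_fun hα (Pi.single i 1)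
      have h3 : g (Pi.single i 1) = m i • (1, 0) + ∑ k, l k • (0, Pi.single i (Pi.single k 1)) := by
        ext i' k'
        · simp [g, Pi.single_apply, Prod.fst_sum]
        · simp [g, Pi.single_apply, Prod.snd_sum, Finset.sum_apply, apply_ite, ite_apply]
          split_ifs with h <;> simp [h]
      rw [LinearMap.comp_apply, h3, map_add, map_sum] at h2
      have h4 := DFunLike.congr_fun h2 j
      simp only [map_smul, Finsupp.add_apply, Finsupp.smul_apply, Finsupp.finsetSum_apply,
        LinearMap.zero_apply, Finsupp.zero_apply, smul_eq_mul] at h4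
      rw [smul_eq_mul, mul_comm, eq_neg_of_add_eq_zero_left h4]
      exact neg_mem (sum_mem fun k _ => Ideal.mul_mem_right _ _ (Submodule.subset_span ⟨k, rfl⟩))
    rw [hs', ← Finsupp.univ_sum_single (α (1, 0)), map_sum]
    refine sum_mem fun j _ => ?_
    rw [← mul_one (α (1,0) j), ← smul_eq_mul, ← Finsupp.smul_single, map_smul, hsmul]
    exact Ideal.mul_mem_right _ _ (Ideal.mem_map_of_mem f (hmem j))
  · rw [Ideal.map_le_iff_le_comap]
    intro c hc
    rw [Ideal.mem_comap]
    change f c ∈ (L.map f).colon (Ideal.span (f '' N) : Set A')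
    rw [Ideal.colon_span, Submodule.mem_colon]
    rintro _ ⟨z, hz, rfl⟩
    rw [smul_eq_mul, ← map_mul]
    exact Ideal.mem_map_of_mem f (Submodule.mem_colon.1 hc z hz)
end Flat
-- Flatness of Frobenius on power series rings over arbitrary fields
section PowerSeries

open MvPowerSeries

/-- The terms divisible by one chosen monomial sum to a multiple of it, and what remains involves
one generator fewer; finiteness of `G` lets this splitting stop. -/
theorem mem_span_monomial_of_finite {σ k : Type*} [CommRing k] {G : Set (σ →₀ ℕ)}
    (hG : G.Finite) (f : MvPowerSeries σ k) (hf : ∀ d, coeff d f ≠ 0 → ∃ g ∈ G, g ≤ d) :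
    f ∈ Ideal.span ((fun g => (monomial g (1 : k) : MvPowerSeries σ k)) '' G) := by
  classical
  induction G, hG using Set.Finite.induction_on generalizing f with
  | empty =>
    have : f = 0 := by
      ext d
      by_contra h
      obtain ⟨g, hg, -⟩ := hf d h
      exact hg
    rw [this]
    exact zero_mem _
  | @insert g G _ _ ih =>
    let h : MvPowerSeries σ k := fun d => coeff (g + d) f
    have h1 : f = monomial g 1 * h + (f - monomial g 1 * h) := by ring
    rw [h1, Set.image_insert_eq, Ideal.span_insert]
    refine Ideal.add_mem _ (Ideal.mem_sup_left (Ideal.mul_mem_right _ _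
      (Ideal.mem_span_singleton_self _))) (Ideal.mem_sup_right (ih _ fun d hd => ?_))
    rw [map_sub, coeff_monomial_mul] at hd
    by_cases hgd : g ≤ d
    · have h2 : coeff (d - g) h = coeff (g + (d - g)) f := rfl
      rw [if_pos hgd, h2, add_tsub_cancel_of_le hgd, one_mul, sub_self] at hd
      exact absurd rfl hd
    · rw [if_neg hgd, sub_zero] at hd
      obtain ⟨g', hg', hle⟩ := hf d hd
      rcases hg' with rfl | hg'
      · exact absurd hle hgd
      · exact ⟨g', hg', hle⟩

variable {n : ℕ} {k K : Type*} [Field k] [Field K] [Algebra k K]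

/-- The exponent vector with entries `α i < q`. -/
noncomputable def boxExponent {q : ℕ} (α : Fin n → Fin q) : Fin n →₀ ℕ :=
  Finsupp.equivFunOnFinite.symm fun i => (α i : ℕ)

/-- The component of `a` at the basis element `b l` of `K` over `k` and the residue `α` of the
exponents modulo `q`. -/
noncomputable def cartierComponent {Λ : Type*} (b : Module.Basis Λ k K) {q : ℕ} (l : Λ)
    (α : Fin n → Fin q) : MvPowerSeries (Fin n) K →+ MvPowerSeries (Fin n) k where
  toFun a := fun δ => b.repr (coeff (q • δ + boxExponent α) a) l
  map_zero' := by
    ext δ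
    change b.repr (coeff _ 0) l = 0
    simp
  map_add' a c := by
    ext δ
    change b.repr (coeff _ (a + c)) l = b.repr (coeff _ a) l + b.repr (coeff _ c) l
    simp

theorem coeff_cartierComponent {Λ : Type*} (b : Module.Basis Λ k K) {q : ℕ} (l : Λ)
    (α : Fin n → Fin q) (a : MvPowerSeries (Fin n) K) (δ : Fin n →₀ ℕ) :
    coeff δ (cartierComponent b l α a) = b.repr (coeff (q • δ + boxExponent α) a) l := rfl

variable {q : ℕ} (F : MvPowerSeries (Fin n) k →+* MvPowerSeries (Fin n) K)

/-- The series `F c` lives on exponents divisible by `q`, so multiplying by it preserves residue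
classes of exponents, and its coefficients come from `k`, over which the coordinates of `b` are
linear. Thus components of an `F`-linear relation are relations over `k`. -/
theorem cartierComponent_mul
    (hF : ∀ c δ, coeff (q • δ) (F c) = algebraMap k K (coeff δ c))
    (hF0 : ∀ c d i, ¬ q ∣ d i → coeff d (F c) = 0)
    {Λ : Type*} (b : Module.Basis Λ k K) (l : Λ) (α : Fin n → Fin q)
    (c : MvPowerSeries (Fin n) k) (a : MvPowerSeries (Fin n) K) :
    cartierComponent b l α (F c * a) = c * cartierComponent b l α a := by
  classical
  ext δ
  rw [coeff_cartierComponent, coeff_mul, coeff_mul]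
  have key : ∑ w ∈ Finset.HasAntidiagonal.antidiagonal (q • δ + boxExponent α), coeff w.1 (F c) * coeff w.2 a =
      ∑ w ∈ Finset.HasAntidiagonal.antidiagonal δ,
        coeff w.1 c • coeff (q • w.2 + boxExponent α) a := by
    symm
    refine Finset.sum_of_injOn (fun w => (q • w.1, q • w.2 + boxExponent α)) ?_ ?_ ?_ ?_
    · rintro ⟨u, v⟩ hu ⟨u', v'⟩ hu' h
      simp only [Finset.mem_coe,
        Finset.HasAntidiagonal.mem_antidiagonal] at hu hu'
      simp only [Prod.mk.injEq, add_left_inj] at h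
      by_cases hn : n = 0
      · subst hn
        exact Subsingleton.elim _ _
      have hq : q ≠ 0 := (Fin.pos (α ⟨0, Nat.pos_of_ne_zero hn⟩)).ne'
      have h1 : u = u' := by
        ext i
        have := DFunLike.congr_fun h.1 i
        simpa [hq] using this
      have h2 : v = v' := by
        ext i
        have := DFunLike.congr_fun h.2 i
        simpa [hq] using this
      rw [h1, h2]
    · rintro ⟨u, v⟩ hu
      simp only [Finset.mem_coe, Finset.HasAntidiagonal.mem_antidiagonal] at hu ⊢
      rw [← hu, smul_add, add_assoc]
    · rintro ⟨w, w'⟩ hw hnot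
      simp only [Finset.HasAntidiagonal.mem_antidiagonal] at hw
      by_cases hdvd : ∀ i, q ∣ w i
      · refine absurd ?_ hnot
        choose u hu using hdvd
        have hi : ∀ i, q * u i + w' i = q * δ i + α i := by
          intro i
          have := DFunLike.congr_fun hw i
          simpa [hu, boxExponent] using this
        have hle : ∀ i, u i ≤ δ i := by
          intro i
          by_contra hlt
          have h3 : q * (δ i + 1) ≤ q * u i := Nat.mul_le_mul_left _ (by omega)
          have := hi i
          have := (α i).2
          rw [mul_add] at h3
          omega
        refine ⟨(Finsupp.equivFunOnFinite.symm u, δ - Finsupp.equivFunOnFinite.symm u), ?_, ?_⟩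
        · simp only [Finset.mem_coe, Finset.HasAntidiagonal.mem_antidiagonal]
          ext i
          simpa using Nat.add_sub_cancel' (hle i)
        · ext i
          · simp [hu]
          · have h4 := hi i
            have h5 : q * (δ i - u i) + q * u i = q * δ i := by
              rw [← mul_add, Nat.sub_add_cancel (hle i)]
            simp only [boxExponent, Finsupp.add_apply, Finsupp.smul_apply, Finsupp.tsub_apply,
              Finsupp.equivFunOnFinite_symm_apply_apply, smul_eq_mul]
            omega
      · push Not at hdvd
        obtain ⟨i, hi⟩ := hdvd
        rw [hF0 c w i hi, zero_mul]
    · rintro ⟨u, v⟩ _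
      simp only
      rw [hF, Algebra.smul_def]
  rw [key, map_sum, Finsupp.finsetSum_apply]
  refine Finset.sum_congr rfl fun w _ => ?_
  rw [map_smul, Finsupp.smul_apply, smul_eq_mul, coeff_cartierComponent]

/-- `K` may have infinite dimension over `k`, so a finite set `s` of basis vectors recovers only
those coefficients whose coordinates it supports. -/
theorem coeff_sum_cartierComponent (hq : 0 < q)
    (hF : ∀ c δ, coeff (q • δ) (F c) = algebraMap k K (coeff δ c))
    (hF0 : ∀ c d i, ¬ q ∣ d i → coeff d (F c) = 0)
    {Λ : Type*} (b : Module.Basis Λ k K) (s : Finset Λ) (a : MvPowerSeries (Fin n) K)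
    (d : Fin n →₀ ℕ) (hs : (b.repr (coeff d a)).support ⊆ s) :
    coeff d (∑ l ∈ s, ∑ α : Fin n → Fin q,
      monomial (boxExponent α) (b l) * F (cartierComponent b l α a)) = coeff d a := by
  classical
  let α₀ : Fin n → Fin q := fun i => ⟨d i % q, Nat.mod_lt _ hq⟩
  let δ₀ : Fin n →₀ ℕ := Finsupp.equivFunOnFinite.symm fun i => d i / q
  have hd : q • δ₀ + boxExponent α₀ = d := by
    ext i
    simp [δ₀, α₀, boxExponent, Nat.div_add_mod]
  rw [map_sum]
  conv_rhs => rw [← b.linearCombination_repr (coeff d a), Finsupp.linearCombination_apply,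
    Finsupp.sum_of_support_subset _ hs _ (fun i _ => zero_smul k (b i))]
  refine Finset.sum_congr rfl fun l _ => ?_
  rw [map_sum, Finset.sum_eq_single α₀]
  · conv_lhs => rw [← hd]
    rw [add_comm, coeff_add_monomial_mul, hF, coeff_cartierComponent, hd, Algebra.smul_def,
      mul_comm]
  · intro α _ hα
    rw [coeff_monomial_mul]
    split_ifs with hle
    · obtain ⟨i, hi⟩ : ∃ i, α i ≠ α₀ i := by
        by_contra h
        push Not at h
        exact hα (funext h)
      rw [hF0 _ _ i, mul_zero]
      rintro ⟨c, hc⟩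
      apply hi
      apply Fin.ext
      have h1 : (α i : ℕ) ≤ d i := by simpa [boxExponent] using hle i
      have h2 : d i - α i = q * c := by simpa [boxExponent] using hc
      change (α i : ℕ) = d i % q
      rw [show d i = α i + q * c by omega, Nat.add_mul_mod_self_left, Nat.mod_eq_of_lt (α i).2]
    · rfl
  · simp

theorem mem_pow_of_coeff_eq_zero (N : ℕ) (f : MvPowerSeries (Fin n) K)
    (hf : ∀ d : Fin n →₀ ℕ, (∀ i, d i < N) → coeff d f = 0) :
    f ∈ IsLocalRing.maximalIdeal (MvPowerSeries (Fin n) K) ^ N := by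
  classical
  have h := mem_span_monomial_of_finite (Set.finite_range fun i : Fin n => Finsupp.single i N) f
    (fun d hd => by
      by_contra hcon
      push Not at hcon
      refine hd (hf d fun i => ?_)
      by_contra hi
      refine hcon _ ⟨i, rfl⟩ ?_
      simpa using hi)
  refine Ideal.span_le.2 ?_ h
  rintro _ ⟨_, ⟨i, rfl⟩, rfl⟩
  change monomial (Finsupp.single i N) (1 : K) ∈ _
  rw [← X_pow_eq]
  refine Ideal.pow_mem_pow ?_ N
  rw [IsLocalRing.mem_maximalIdeal, mem_nonunits_iff, isUnit_iff_constantCoeff]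
  simp

/-- There need not be a finite basis, so the equational criterion is checked by approximation:
modulo any power of the maximal ideal, a solution of a linear equation is a finite combination of
the componentwise solutions over `k`. Krull's intersection theorem turns this into exact membership.
-/
theorem flat_of_coeff_smul (hq : 0 < q)
    (hF : ∀ c δ, coeff (q • δ) (F c) = algebraMap k K (coeff δ c))
    (hF0 : ∀ c d i, ¬ q ∣ d i → coeff d (F c) = 0) : F.Flat := by
  classical
  let _ : Algebra (MvPowerSeries (Fin n) k) (MvPowerSeries (Fin n) K) := F.toAlgebra
  have hsmul : ∀ (c : MvPowerSeries (Fin n) k) (z : MvPowerSeries (Fin n) K), c • z = F c * z :=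
    fun _ _ => rfl
  let b := Module.Basis.ofVectorSpace k K
  refine Module.Flat.of_forall_isTrivialRelation fun {r c a} hca => ?_
  -- `T` is spanned by the solutions coming from `k`; triviality of the relation amounts to `a ∈ T`.
  let T : Submodule (MvPowerSeries (Fin n) K) (Fin r → MvPowerSeries (Fin n) K) :=
    Submodule.span _ ((fun v : Fin r → MvPowerSeries (Fin n) k => fun i => F (v i)) ''
      {v | ∑ i, c i * v i = 0})
  have hN : ∀ N, ∃ t ∈ T, ∀ i, a i - t i ∈
      IsLocalRing.maximalIdeal (MvPowerSeries (Fin n) K) ^ N := by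
    intro N
    let s := Finset.univ.biUnion fun i : Fin r => Finset.univ.biUnion fun d : Fin n → Fin N =>
      (b.repr (coeff (boxExponent d) (a i))).support
    refine ⟨fun i => ∑ l ∈ s, ∑ α : Fin n → Fin q,
      monomial (boxExponent α) (b l) * F (cartierComponent b l α (a i)), ?_, fun i => ?_⟩
    · have h1 : (fun i => ∑ l ∈ s, ∑ α : Fin n → Fin q,
          monomial (boxExponent α) (b l) * F (cartierComponent b l α (a i))) =
          ∑ l ∈ s, ∑ α : Fin n → Fin q, (monomial (boxExponent α) (b l) :
            MvPowerSeries (Fin n) K) • fun i => F (cartierComponent b l α (a i)) := by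
        ext1 i
        simp [Finset.sum_apply]
      rw [h1]
      refine sum_mem fun l _ => sum_mem fun α _ => T.smul_mem _ (Submodule.subset_span
        ⟨fun i => cartierComponent b l α (a i), ?_, rfl⟩)
      simp only [Set.mem_ofPred_eq]
      rw [← map_zero (cartierComponent b l α), ← hca, map_sum]
      exact Finset.sum_congr rfl fun i _ => (cartierComponent_mul F hF hF0 b l α (c i) (a i)).symm
    · refine mem_pow_of_coeff_eq_zero N _ fun d hd => ?_
      rw [map_sub, coeff_sum_cartierComponent F hq hF hF0, sub_self]
      have h2 : d = boxExponent fun i => (⟨d i, hd i⟩ : Fin N) := by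
        ext i
        simp [boxExponent]
      intro l hl
      refine Finset.mem_biUnion.2 ⟨i, Finset.mem_univ _, Finset.mem_biUnion.2
        ⟨fun i => ⟨d i, hd i⟩, Finset.mem_univ _, ?_⟩⟩
      rwa [← h2]
  -- The class of `a` in the finitely generated quotient by `T` lies in every power of the maximal
  -- ideal times that quotient.
  have haT : a ∈ T := by
    rw [← Submodule.Quotient.mk_eq_zero, ← Submodule.mem_bot (MvPowerSeries (Fin n) K),
      ← Ideal.iInf_pow_smul_eq_bot_of_isLocalRing
        (IsLocalRing.maximalIdeal (MvPowerSeries (Fin n) K)) (Ideal.IsPrime.ne_top inferInstance),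
      Submodule.mem_iInf]
    intro N
    obtain ⟨t, ht, hat⟩ := hN N
    have h1 : (Submodule.Quotient.mk a : _ ⧸ T) = Submodule.Quotient.mk (a - t) := by
      rw [Submodule.Quotient.eq]
      simpa using ht
    rw [h1, ← T.mkQ_apply, pi_eq_sum_univ' (a - t), map_sum]
    refine sum_mem fun i _ => ?_
    rw [map_smul]
    exact Submodule.smul_mem_smul (hat i) trivial
  obtain ⟨m, y, v, hv⟩ := Submodule.mem_span_set'.1 haT
  choose w hw hw' using fun j => (v j).2
  refine ⟨m, fun i j => w j i, y, fun i => ?_, fun j => ?_⟩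
  · rw [← hv, Finset.sum_apply]
    refine Finset.sum_congr rfl fun j _ => ?_
    rw [Pi.smul_apply, ← hw' j, hsmul, smul_eq_mul, mul_comm]
  · exact hw j

theorem flat_frobenius (p : ℕ) [Fact p.Prime] (n : ℕ) (k : Type*) [Field k] [CharP k p]
    [ExpChar (MvPowerSeries (Fin n) k) p] : (frobenius (MvPowerSeries (Fin n) k) p).Flat := by
  have hp : p ≠ 0 := (Fact.out : p.Prime).ne_zero
  have h : ∀ c : MvPowerSeries (Fin n) k, frobenius _ p c =
      (c.expand p hp).map (frobenius k p) := fun c => (map_frobenius_expand p hp).symm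
  -- The target copy of `k` is an algebra over `k` through its Frobenius, with no assumption that it
  -- is finite over `k^p`.
  refine @flat_of_coeff_smul n k k _ _ (frobenius k p).toAlgebra p
    (frobenius (MvPowerSeries (Fin n) k) p) (Nat.pos_of_ne_zero hp) (fun c δ => ?_)
    (fun c d i hi => ?_)
  · rw [h, coeff_map, coeff_expand_smul]
    rfl
  · rw [h, coeff_map, coeff_expand_of_not_dvd p hp c hi, map_zero]

theorem flat_frobenius_localization (p : ℕ) {R : Type*} [CommRing R] [ExpChar R p]
    (hR : (frobenius R p).Flat) (P : Ideal R) [P.IsPrime] [ExpChar (Localization.AtPrime P) p] :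
    (frobenius (Localization.AtPrime P) p).Flat := by
  have hP : P = P.comap (frobenius R p) := by
    ext x
    rw [Ideal.mem_comap, frobenius_def]
    exact ⟨fun h => Ideal.pow_mem_of_mem _ h _ (expChar_pos R p), Ideal.IsPrime.mem_of_pow_mem ‹_› _⟩
  have h := RingHom.Flat.localRingHom hR P P hP
  rwa [Localization.localRingHom_unique P P (frobenius R p) hP
    (j := frobenius (Localization.AtPrime P) p) fun x => by simp [frobenius_def]] at h

end PowerSeries

/-! ### Lech independence and ideals generated by powers -/

section Lech

variable {A ι : Type*} [CommRing A]

/-- Independence in the sense of Lech: the coefficients of every relation between the `f i` lie in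
the ideal generated by the `f i`. -/
def LechIndependent [Fintype ι] (f : ι → A) : Prop :=
  ∀ a : ι → A, ∑ i, a i * f i = 0 → ∀ i, a i ∈ Ideal.span (Set.range f)

/-- The ideal generated by the powers `y i ^ a i`. -/
def powerIdeal (y : ι → A) (a : ι → ℕ) : Ideal A := Ideal.span (Set.range fun i => y i ^ a i)

theorem pow_mem_powerIdeal (y : ι → A) (a : ι → ℕ) (i : ι) : y i ^ a i ∈ powerIdeal y a :=
  Ideal.subset_span ⟨i, rfl⟩

theorem powerIdeal_anti (y : ι → A) {a b : ι → ℕ} (h : a ≤ b) :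
    powerIdeal y b ≤ powerIdeal y a := by
  refine Ideal.span_le.2 ?_
  rintro _ ⟨i, rfl⟩
  exact Ideal.mem_of_dvd _ (pow_dvd_pow _ (h i)) (pow_mem_powerIdeal y a i)

theorem sum_update_mul [Fintype ι] [DecidableEq ι] (f : ι → A) (i : ι) (c : A) (a : ι → A) :
    ∑ j, a j * Function.update f i c j = a i * c + ∑ j ∈ Finset.univ.erase i, a j * f j := by
  rw [← Finset.add_sum_erase _ _ (Finset.mem_univ i), Function.update_self]
  congr 1
  refine Finset.sum_congr rfl fun j hj => ?_
  rw [Function.update_of_ne (Finset.ne_of_mem_erase hj)]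

theorem span_update_mul_le [DecidableEq ι] (f : ι → A) (i : ι) (g h : A) :
    Ideal.span (Set.range (Function.update f i (g * h))) ≤
      Ideal.span (Set.range (Function.update f i g)) := by
  refine Ideal.span_le.2 ?_
  rintro _ ⟨j, rfl⟩
  by_cases hj : j = i
  · subst hj
    rw [Function.update_self]
    exact Ideal.mul_mem_right _ _ (Ideal.subset_span ⟨j, Function.update_self ..⟩)
  · rw [Function.update_of_ne hj]
    exact Ideal.subset_span ⟨j, Function.update_of_ne hj ..⟩

/-- Multiplying a relation by `h` turns it into one for `g * h`, which places the `i`-th coefficient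
in the ideal. Substituting that expression back gives a second relation for `g * h`, which controls
the other coefficients modulo `g`. -/
theorem LechIndependent.of_update_mul [Fintype ι] [DecidableEq ι] {f : ι → A} {i : ι} {g h : A}
    (H : LechIndependent (Function.update f i (g * h))) :
    LechIndependent (Function.update f i g) := by
  intro a ha
  have hle := span_update_mul_le f i g h
  have hg : g ∈ Ideal.span (Set.range (Function.update f i g)) :=
    Ideal.subset_span ⟨i, Function.update_self ..⟩
  have h1 := H (Function.update (fun j => h * a j) i (a i)) (by
    rw [sum_update_mul] at ha ⊢
    rw [Function.update_self]
    have h2 : ∑ j ∈ Finset.univ.erase i, Function.update (fun j => h * a j) i (a i) j * f j =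
        h * ∑ j ∈ Finset.univ.erase i, a j * f j := by
      rw [Finset.mul_sum]
      refine Finset.sum_congr rfl fun j hj => ?_
      rw [Function.update_of_ne (Finset.ne_of_mem_erase hj), mul_assoc]
    rw [h2]
    linear_combination h * ha)
  have hai := h1 i
  rw [Function.update_self] at hai
  obtain ⟨b, hb⟩ := Ideal.mem_span_range_iff_exists_fun.1 hai
  have h3 := H (Function.update (fun j => g * b j + a j) i (g * b i)) (by
    rw [sum_update_mul] at ha hb ⊢
    rw [Function.update_self]
    have h2 : ∑ j ∈ Finset.univ.erase i,
        Function.update (fun j => g * b j + a j) i (g * b i) j * f j =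
        g * ∑ j ∈ Finset.univ.erase i, b j * f j + ∑ j ∈ Finset.univ.erase i, a j * f j := by
      rw [Finset.mul_sum, ← Finset.sum_add_distrib]
      refine Finset.sum_congr rfl fun j hj => ?_
      rw [Function.update_of_ne (Finset.ne_of_mem_erase hj)]
      ring
    rw [h2]
    linear_combination ha + g * hb)
  intro j
  by_cases hj : j = i
  · rw [hj]
    exact hle hai
  · have h4 := h3 j
    rw [Function.update_of_ne hj] at h4
    have h5 : a j = g * b j + a j - b j * g := by ring
    rw [h5]
    exact sub_mem (hle h4) (Ideal.mul_mem_left _ _ hg)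

/-- If `a g = b_i g h + ∑ b_j f_j`, multiplying by `h` gives a relation in which `g h` has
coefficient `a - h b_i`. -/
theorem LechIndependent.mem_of_mul_mem [Fintype ι] [DecidableEq ι] {f : ι → A} {i : ι} {g h a : A}
    (H : LechIndependent (Function.update f i (g * h)))
    (ha : a * g ∈ Ideal.span (Set.range (Function.update f i (g * h)))) :
    a ∈ Ideal.span (Set.range (Function.update f i h)) := by
  have hle := span_update_mul_le f i h g
  rw [mul_comm h] at hle
  obtain ⟨b, hb⟩ := Ideal.mem_span_range_iff_exists_fun.1 ha
  have h1 := H (Function.update (fun j => -(h * b j)) i (a - h * b i)) (by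
    rw [sum_update_mul] at hb ⊢
    rw [Function.update_self]
    have h2 : ∑ j ∈ Finset.univ.erase i,
        Function.update (fun j => -(h * b j)) i (a - h * b i) j * f j =
        -h * ∑ j ∈ Finset.univ.erase i, b j * f j := by
      rw [Finset.mul_sum]
      refine Finset.sum_congr rfl fun j hj => ?_
      rw [Function.update_of_ne (Finset.ne_of_mem_erase hj)]
      ring
    rw [h2]
    linear_combination -h * hb) i
  rw [Function.update_self] at h1
  rw [show a = a - h * b i + b i * h by ring]
  exact add_mem (hle h1) (Ideal.mul_mem_left _ _ (Ideal.subset_span ⟨i, Function.update_self ..⟩))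

theorem pow_update [DecidableEq ι] (y : ι → A) (a : ι → ℕ) (i : ι) (m : ℕ) :
    (fun j => y j ^ Function.update a i m j) = Function.update (fun j => y j ^ a j) i (y i ^ m) := by
  ext j
  by_cases hj : j = i
  · subst hj; simp
  · simp [Function.update_of_ne hj]

theorem LechIndependent.pow_of_le [Fintype ι] {y : ι → A} {a b : ι → ℕ}
    (H : LechIndependent fun i => y i ^ b i) (hab : a ≤ b) :
    LechIndependent fun i => y i ^ a i := by
  classical
  suffices h : ∀ s : Finset ι, LechIndependent fun i => y i ^ (if i ∈ s then a i else b i) by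
    simpa using h Finset.univ
  intro s
  induction s using Finset.induction_on with
  | empty => simpa using H
  | insert i s hi ih =>
    have h1 : (fun j => if j ∈ insert i s then a j else b j) =
        Function.update (fun j => if j ∈ s then a j else b j) i (a i) := by
      ext j
      by_cases hj : j = i
      · subst hj; simp
      · simp [hj]
    have h2 : (fun j => if j ∈ s then a j else b j) =
        Function.update (fun j => if j ∈ s then a j else b j) i (b i) := by
      ext j
      by_cases hj : j = i
      · subst hj; simp [hi]
      · simp [Function.update_of_ne hj]
    have h3 : LechIndependent (fun j => y j ^ (fun j => if j ∈ insert i s then a j else b j) j) := by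
      rw [h1, pow_update]
      refine LechIndependent.of_update_mul (h := y i ^ (b i - a i)) ?_
      rw [← pow_add, Nat.add_sub_cancel' (hab i), ← pow_update, ← h2]
      exact ih
    exact h3

theorem mem_powerIdeal_of_mul_pow_mem [Fintype ι] [DecidableEq ι] {y : ι → A} {a : ι → ℕ}
    (H : LechIndependent fun i => y i ^ a i) {i : ι} {c : ℕ} (hc : c ≤ a i) {x : A}
    (hx : x * y i ^ c ∈ powerIdeal y a) : x ∈ powerIdeal y (Function.update a i (a i - c)) := by
  have h1 : (fun j => y j ^ a j) =
      Function.update (fun j => y j ^ a j) i (y i ^ c * y i ^ (a i - c)) := by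
    rw [← pow_add, Nat.add_sub_cancel' hc, Function.update_eq_self_iff.2 rfl]
  rw [powerIdeal, pow_update]
  refine LechIndependent.mem_of_mul_mem (g := y i ^ c) ?_ ?_
  · rwa [← h1]
  · rwa [← h1]

theorem mem_powerIdeal_of_mul_prod_mem [Fintype ι] [DecidableEq ι] {y : ι → A}
    (H : ∀ a : ι → ℕ, (∀ i, 1 ≤ a i) → LechIndependent fun i => y i ^ a i) {a c : ι → ℕ}
    (hc : ∀ i, c i < a i) (s : Finset ι) {x : A}
    (hx : x * ∏ i ∈ s, y i ^ c i ∈ powerIdeal y a) :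
    x ∈ powerIdeal y fun i => if i ∈ s then a i - c i else a i := by
  induction s using Finset.induction_on generalizing x with
  | empty => simpa using hx
  | insert i s hi ih =>
    rw [Finset.prod_insert hi, ← mul_assoc] at hx
    have h1 := mem_powerIdeal_of_mul_pow_mem (H _ fun j => by
      have := hc j
      split_ifs <;> omega) (by simpa [hi] using (hc i).le) (ih hx)
    convert h1 using 2
    ext j
    by_cases hj : j = i
    · subst hj
      simp [hi]
    · simp [hj]

/-- The socle of `A / (y_i^(a_i))` is generated by the top monomial. Variables are treated one at a
time: the cofactor of the product found so far lies in an ideal all of whose generators are killed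
by that product, except `y_i^(a_i - 1)`. -/
theorem exists_sub_mul_prod_mem_powerIdeal [Fintype ι] {y : ι → A}
    (H : ∀ a : ι → ℕ, (∀ i, 1 ≤ a i) → LechIndependent fun i => y i ^ a i) {a : ι → ℕ}
    (ha : ∀ i, 1 ≤ a i) {x : A} (hx : ∀ i, x * y i ∈ powerIdeal y a) :
    ∃ c, x - c * ∏ i, y i ^ (a i - 1) ∈ powerIdeal y a := by
  classical
  suffices h : ∀ s : Finset ι, ∃ c, x - c * ∏ i ∈ s, y i ^ (a i - 1) ∈ powerIdeal y a from h _
  intro s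
  induction s using Finset.induction_on with
  | empty => exact ⟨x, by simp⟩
  | insert i s hi ih =>
    obtain ⟨c, hc⟩ := ih
    have h1 : c * y i ^ 1 * ∏ i ∈ s, y i ^ (a i - 1) ∈ powerIdeal y a := by
      have h2 := sub_mem (hx i) (Ideal.mul_mem_right (y i) _ hc)
      convert h2 using 1
      ring
    have h0 := mem_powerIdeal_of_mul_prod_mem H (c := fun i => a i - 1)
      (fun i => Nat.sub_lt (ha i) one_pos) s h1
    simp only [Nat.sub_sub_self (ha _)] at h0
    have h2 := mem_powerIdeal_of_mul_pow_mem (H _ fun j => by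
      split_ifs
      exacts [le_rfl, ha j]) (by simp [hi, ha i]) h0
    have h3 : powerIdeal y (Function.update (fun i => if i ∈ s then 1 else a i) i
        ((if i ∈ s then 1 else a i) - 1)) ≤
        (powerIdeal y a ⊔ Ideal.span {y i ^ (a i - 1) * ∏ i ∈ s, y i ^ (a i - 1)}).colon
          {∏ i ∈ s, y i ^ (a i - 1)} := by
      refine Ideal.span_le.2 ?_
      rintro _ ⟨j, rfl⟩
      rw [SetLike.mem_coe, Submodule.mem_colon_singleton, smul_eq_mul]
      beta_reduce
      by_cases hj : j = i
      · subst hj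
        rw [Function.update_self, if_neg hi]
        exact Ideal.mem_sup_right (Ideal.mem_span_singleton_self _)
      · rw [Function.update_of_ne hj]
        refine Ideal.mem_sup_left ?_
        by_cases hjs : j ∈ s
        · simp only [if_pos hjs]
          rw [← Finset.mul_prod_erase _ _ hjs, ← mul_assoc, ← pow_add, Nat.add_sub_cancel' (ha j)]
          exact Ideal.mul_mem_right _ _ (pow_mem_powerIdeal y a j)
        · simp only [if_neg hjs]
          exact Ideal.mul_mem_right _ _ (pow_mem_powerIdeal y a j)
    have h4 := Submodule.mem_colon_singleton.1 (h3 h2)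
    obtain ⟨u, hu, v, hv, huv⟩ := Submodule.mem_sup.1 h4
    obtain ⟨c', rfl⟩ := Ideal.mem_span_singleton'.1 hv
    refine ⟨c', ?_⟩
    rw [Finset.prod_insert hi]
    have h5 := add_mem hc hu
    rw [smul_eq_mul] at huv
    convert h5 using 1
    linear_combination -huv

end Lech

/-! ### Independent powers of the generators of the maximal ideal -/

section Frobenius

theorem flat_iterateFrobenius {A : Type*} [CommRing A] (p : ℕ) [ExpChar A p]
    (hA : (frobenius A p).Flat) (e : ℕ) : (iterateFrobenius A p e).Flat := by
  induction e with
  | zero =>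
    rw [iterateFrobenius_zero]
    exact RingHom.Flat.id A
  | succ e ih =>
    have h : iterateFrobenius A p (e + 1) = (frobenius A p).comp (iterateFrobenius A p e) := by
      ext x
      simp [iterateFrobenius_def, frobenius_def, pow_succ, pow_mul]
    rw [h]
    exact RingHom.Flat.comp ih hA

theorem LechIndependent.map_of_flat {A A' ι : Type*} [CommRing A] [CommRing A'] [Fintype ι]
    {f : A →+* A'} (hf : f.Flat) {y : ι → A} (hy : LechIndependent y) :
    LechIndependent fun i => f (y i) := by
  intro a ha i
  let _ : Algebra A A' := f.toAlgebra
  have : Module.Flat A A' := hf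
  have hsmul : ∀ (c : A) (z : A'), c • z = f c * z := fun _ _ => rfl
  obtain ⟨m, b, z, hz, hb⟩ := Module.Flat.isTrivialRelation_of_sum_smul_eq_zero (f := y) (x := a)
    (by simpa only [hsmul, mul_comm] using ha)
  rw [hz i]
  refine sum_mem fun j _ => ?_
  rw [hsmul]
  have h1 := hy (fun i => b i j) (by simpa only [mul_comm] using hb j) i
  have h2 := Ideal.mem_map_of_mem f h1
  rw [Ideal.map_span, ← Set.range_comp] at h2
  exact Ideal.mul_mem_right _ _ h2

/-- A minimal generating family of the maximal ideal is independent in the sense of Lech. -/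
theorem exists_lechIndependent_generators (A : Type*) [CommRing A] [IsLocalRing A]
    [IsNoetherianRing A] : ∃ (d : ℕ) (y : Fin d → A),
      Ideal.span (Set.range y) = IsLocalRing.maximalIdeal A ∧ LechIndependent y := by
  classical
  have hex : ∃ d, ∃ y : Fin d → A, Ideal.span (Set.range y) = IsLocalRing.maximalIdeal A := by
    obtain ⟨d, y, hy⟩ := Submodule.fg_iff_exists_fin_generating_family.1
      (IsNoetherian.noetherian (IsLocalRing.maximalIdeal A))
    exact ⟨d, y, hy⟩
  obtain ⟨d, ⟨y, hy⟩, hmin⟩ : ∃ d, (∃ y : Fin d → A,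
      Ideal.span (Set.range y) = IsLocalRing.maximalIdeal A) ∧ ∀ d' < d, ¬ ∃ y : Fin d' → A,
      Ideal.span (Set.range y) = IsLocalRing.maximalIdeal A :=
    ⟨Nat.find hex, Nat.find_spec hex, fun d' hd' => Nat.find_min hex hd'⟩
  refine ⟨d, y, hy, fun a ha i => ?_⟩
  rw [hy, IsLocalRing.mem_maximalIdeal, mem_nonunits_iff]
  intro hv
  obtain _ | d := d
  · exact i.elim0
  refine hmin d (Nat.lt_succ_self d) ⟨fun j => y (i.succAbove j), le_antisymm ?_ ?_⟩
  · rw [← hy]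
    refine Ideal.span_mono ?_
    rintro _ ⟨j, rfl⟩
    exact ⟨_, rfl⟩
  · rw [← hy, Ideal.span_le]
    rintro _ ⟨j, rfl⟩
    rcases Fin.eq_self_or_eq_succAbove i j with h | ⟨j, rfl⟩
    · rw [h, SetLike.mem_coe, ← Ideal.unit_mul_mem_iff_mem _ hv]
      rw [Fin.sum_univ_succAbove _ i] at ha
      rw [eq_neg_of_add_eq_zero_left ha]
      exact neg_mem (sum_mem fun j _ => Ideal.mul_mem_left _ _ (Ideal.subset_span ⟨j, rfl⟩))
    · exact Ideal.subset_span ⟨j, rfl⟩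

/-- Here flat Frobenius replaces regularity: independence passes to arbitrarily high Frobenius
powers of the generators, and from there down to all smaller exponents. -/
theorem exists_pow_lechIndependent_generators (p : ℕ) [Fact p.Prime] (A : Type*) [CommRing A]
    [IsLocalRing A] [IsNoetherianRing A] [ExpChar A p] (hA : (frobenius A p).Flat) :
    ∃ (d : ℕ) (y : Fin d → A), Ideal.span (Set.range y) = IsLocalRing.maximalIdeal A ∧
      ∀ a : Fin d → ℕ, (∀ i, 1 ≤ a i) → LechIndependent fun i => y i ^ a i := by
  obtain ⟨d, y, hy, hind⟩ := exists_lechIndependent_generators A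
  refine ⟨d, y, hy, fun a _ => ?_⟩
  -- The exponent `∑ i, a i` only serves to make `p ^ ∑ i, a i` at least every `a i`.
  refine LechIndependent.pow_of_le (b := fun _ => p ^ ∑ i, a i)
    (hind.map_of_flat (flat_iterateFrobenius p hA (∑ i, a i))) fun i => ?_
  exact (Finset.single_le_sum (fun _ _ => Nat.zero_le _) (Finset.mem_univ i)).trans
    (Nat.lt_pow_self (Fact.out : p.Prime).one_lt).le

end Frobenius

/-! ### Elements of the injective hull of the residue field -/

section Hull

open IsLocalRing

variable {A E : Type u} [CommRing A] [AddCommGroup E] [Module A E]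

/-- Division by `f` in an injective module. -/
theorem exists_smul_eq_of_injective (hE : Module.Injective A E) (c : Ideal A) (f : A) (w : E)
    (h : ∀ a, a * f ∈ c → a • w = 0) : ∃ z : E, (∀ a ∈ c, a • z = 0) ∧ f • z = w := by
  let g : A →ₗ[A] A ⧸ c := LinearMap.toSpanSingleton A (A ⧸ c) (Ideal.Quotient.mk c f)
  have hg : ∀ a, g a = Ideal.Quotient.mk c (a * f) := fun a => by
    rw [map_mul]
    rfl
  let i : A ⧸ LinearMap.ker g →ₗ[A] A ⧸ c := (LinearMap.ker g).liftQ g le_rfl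
  have hi : Function.Injective i := LinearMap.ker_eq_bot.1 (Submodule.ker_liftQ_eq_bot _ _ _ le_rfl)
  let j : A ⧸ LinearMap.ker g →ₗ[A] E := (LinearMap.ker g).liftQ (LinearMap.toSpanSingleton A E w)
    fun a ha => by
      rw [LinearMap.mem_ker, LinearMap.toSpanSingleton_apply]
      refine h a ?_
      rwa [LinearMap.mem_ker, hg, Ideal.Quotient.eq_zero_iff_mem] at ha
  obtain ⟨l, hl⟩ := hE.out i hi j
  have hsmul : ∀ a, a • l (Ideal.Quotient.mk c 1) = l (Ideal.Quotient.mk c a) := fun a => by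
    rw [← map_smul]
    congr 1
    change Ideal.Quotient.mk c (a * 1) = _
    rw [mul_one]
  refine ⟨l (Ideal.Quotient.mk c 1), fun a ha => ?_, ?_⟩
  · rw [hsmul, Ideal.Quotient.eq_zero_iff_mem.2 ha, map_zero]
  · have h1 := hl ((LinearMap.ker g).mkQ 1)
    have h2 : i ((LinearMap.ker g).mkQ 1) = Ideal.Quotient.mk c f := by
      change g 1 = _
      rw [hg, one_mul]
    have h3 : j ((LinearMap.ker g).mkQ 1) = w := by
      change (1 : A) • w = w
      rw [one_smul]
    rw [hsmul, ← h2, h1, h3]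

variable [IsLocalRing A] {ι : ResidueField A →ₗ[A] E} (hι : IsInjectiveHull ι)
include hι

theorem IsInjectiveHull.apply_one_ne_zero : ι 1 ≠ 0 := fun h =>
  one_ne_zero (hι.injective (h.trans (map_zero ι).symm))

omit hι in
theorem smul_hull_one_of_mem {a : A} (ha : a ∈ maximalIdeal A) : a • ι 1 = 0 := by
  rw [← map_smul, Algebra.smul_def, mul_one]
  have : algebraMap A (ResidueField A) a = 0 := (residue_eq_zero_iff a).2 ha
  rw [this, map_zero]

theorem IsInjectiveHull.exists_smul_eq_one {z : E} (hz : z ≠ 0) : ∃ a : A, a • z = ι 1 := by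
  by_contra h
  push Not at h
  apply hz
  have h1 := hι.essential (Submodule.span A {z}) (by
    refine (Submodule.eq_bot_iff _).2 ?_
    rintro _ ⟨hx, r, rfl⟩
    by_contra hne
    obtain ⟨a, ha⟩ := Submodule.mem_span_singleton.1 hx
    have hr : r ≠ 0 := fun h0 => hne (by rw [h0, map_zero])
    obtain ⟨b, hb⟩ := residue_surjective (R := A) r⁻¹
    apply h (b * a)
    rw [mul_smul, ha, ← map_smul, Algebra.smul_def]
    change ι (residue A b * r) = _
    rw [hb, inv_mul_cancel₀ hr])
  simpa using h1

theorem IsInjectiveHull.exists_eq_smul_one {z : E} (hz : ∀ a ∈ maximalIdeal A, a • z = 0) :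
    ∃ c : A, z = c • ι 1 := by
  by_cases h0 : z = 0
  · exact ⟨0, by rw [h0, zero_smul]⟩
  obtain ⟨a, ha⟩ := hι.exists_smul_eq_one h0
  have hu : IsUnit a := by
    by_contra h
    exact hι.apply_one_ne_zero (ha ▸ hz a h)
  obtain ⟨b, hb⟩ := hu.exists_left_inv
  exact ⟨b, by rw [← ha, ← mul_smul, hb, one_smul]⟩

/-- Elements of the hull separate elements of `A` from ideals. -/
theorem IsInjectiveHull.exists_smul_ne_zero {c : Ideal A} {f : A} (hf : f ∉ c) :
    ∃ z : E, (∀ a ∈ c, a • z = 0) ∧ f • z ≠ 0 := by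
  obtain ⟨z, hz, hfz⟩ := exists_smul_eq_of_injective hι.injective_module c f (ι 1) fun a ha => by
    refine smul_hull_one_of_mem ?_
    rw [mem_maximalIdeal, mem_nonunits_iff]
    intro hu
    exact hf ((Ideal.unit_mul_mem_iff_mem c hu).1 ha)
  exact ⟨z, hz, hfz ▸ hι.apply_one_ne_zero⟩

/-- By Artin–Rees in the cyclic module `A z`, a high power of the maximal ideal times `A z` meets
the image of the residue field in zero, and essentiality makes that submodule vanish. -/
theorem IsInjectiveHull.exists_pow_smul_eq_zero [IsNoetherianRing A] (z : E) :
    ∃ s, ∀ a ∈ maximalIdeal A ^ s, a • z = 0 := by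
  let W : Submodule A E := Submodule.span A {z}
  let N : Submodule A W := (LinearMap.range ι).submoduleOf W
  obtain ⟨c, hc⟩ := (maximalIdeal A).exists_pow_inf_eq_pow_smul N
  have h1 : maximalIdeal A • N = ⊥ := by
    refine le_bot_iff.1 (Submodule.smul_le.2 ?_)
    rintro a ha ⟨w, hw⟩ ⟨r, hr⟩
    have hr' : ι r = w := hr
    rw [Submodule.mem_bot]
    apply Subtype.ext
    change a • w = 0
    obtain ⟨b, rfl⟩ := residue_surjective (R := A) r
    have h2 : (residue A b : ResidueField A) = b • 1 := by
      rw [Algebra.smul_def, mul_one]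
      rfl
    rw [← hr', h2, map_smul, smul_comm, smul_hull_one_of_mem ha, smul_zero]
  have h2 : maximalIdeal A ^ (c + 1) • ⊤ ⊓ N = ⊥ := by
    rw [hc (c + 1) (Nat.le_succ c), Nat.add_sub_cancel_left, pow_one]
    exact le_bot_iff.1 ((Submodule.smul_mono le_rfl inf_le_right).trans h1.le)
  have h3 : (maximalIdeal A ^ (c + 1) • (⊤ : Submodule A W)).map W.subtype = ⊥ := by
    refine hι.essential _ ((Submodule.eq_bot_iff _).2 ?_)
    rintro _ ⟨⟨w, hw, rfl⟩, hr⟩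
    have : w ∈ maximalIdeal A ^ (c + 1) • ⊤ ⊓ N := ⟨hw, hr⟩
    rw [h2, Submodule.mem_bot] at this
    rw [this, map_zero]
  refine ⟨c + 1, fun a ha => ?_⟩
  have h4 : a • z ∈ (maximalIdeal A ^ (c + 1) • (⊤ : Submodule A W)).map W.subtype :=
    ⟨a • ⟨z, Submodule.mem_span_singleton_self z⟩, Submodule.smul_mem_smul ha trivial, rfl⟩
  rwa [h3, Submodule.mem_bot] at h4

end Hull

/-! ### Socle elements modulo a primary ideal -/

section Socle

open IsLocalRing

variable {A : Type*} [CommRing A] [IsLocalRing A]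

theorem exists_mul_notMem_forall_mul_mem {J : Ideal A} {N : ℕ} (hN : maximalIdeal A ^ N ≤ J)
    {a : A} (ha : a ∉ J) : ∃ b, b * a ∉ J ∧ ∀ c ∈ maximalIdeal A, b * a * c ∈ J := by
  classical
  have hex : ∃ s, ∀ b ∈ maximalIdeal A ^ s, b * a ∈ J :=
    ⟨N, fun b hb => Ideal.mul_mem_right _ _ (hN hb)⟩
  obtain ⟨s, hs, hmin⟩ : ∃ s, (∀ b ∈ maximalIdeal A ^ s, b * a ∈ J) ∧
      ∀ s' < s, ¬ ∀ b ∈ maximalIdeal A ^ s', b * a ∈ J :=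
    ⟨Nat.find hex, Nat.find_spec hex, fun s' hs' => Nat.find_min hex hs'⟩
  obtain _ | s := s
  · exact absurd (by simpa using hs 1 (by simp)) ha
  · have := hmin s (Nat.lt_succ_self s)
    push Not at this
    obtain ⟨b, hb, hba⟩ := this
    refine ⟨b, hba, fun c hc => ?_⟩
    rw [mul_right_comm]
    exact hs _ (by rw [pow_succ]; exact Ideal.mul_mem_mul hb hc)

end Socle

/-! ### Cyclic submodules of the hull cut out by powers of generators -/

section System

open IsLocalRing

/-- A coherent system of cyclic submodules `A e_t = Ann_E (Y_t)` exhausting `E`, compatible with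
the `p`-linear map `θ`. -/
structure IsFrobeniusSystem (p : ℕ) {A E : Type*} [CommRing A] [IsLocalRing A] [AddCommGroup E]
    [Module A E] (Y : ℕ → Ideal A) (e : ℕ → E) (θ : frobeniusMaps p A E 1) : Prop where
  le_pow : ∀ t, Y t ≤ maximalIdeal A ^ t
  pow_le : ∀ t, ∃ N, maximalIdeal A ^ N ≤ Y t
  anti : Antitone Y
  frobeniusPower_eq : ∀ t, frobeniusPower p (Y t) 1 = Y (p * t)
  smul_eq_zero_iff : ∀ t, 1 ≤ t → ∀ a : A, a • e t = 0 ↔ a ∈ Y t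
  exists_eq_smul : ∀ t, 1 ≤ t → ∀ z : E, (∀ a ∈ Y t, a • z = 0) → ∃ a : A, z = a • e t
  apply_eq : ∀ t, 1 ≤ t → θ.1 (e t) = e (p * t)

variable {A ι : Type*} [CommRing A] [Fintype ι]

omit [Fintype ι] in
theorem mul_mem_powerIdeal_of_mem {y : ι → A} {a b : ι → ℕ} {x c : A}
    (h : ∀ i, y i ^ a i * c ∈ powerIdeal y b) (hx : x ∈ powerIdeal y a) :
    x * c ∈ powerIdeal y b := by
  have h1 : powerIdeal y a ≤ (powerIdeal y b).colon {c} := by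
    refine Ideal.span_le.2 ?_
    rintro _ ⟨i, rfl⟩
    exact Submodule.mem_colon_singleton.2 (h i)
  exact Submodule.mem_colon_singleton.1 (h1 hx)

theorem pow_mul_prod_mem_powerIdeal (y : ι → A) {a b c : ι → ℕ} (h : ∀ i, b i ≤ a i + c i)
    (i : ι) : y i ^ a i * ∏ j, y j ^ c j ∈ powerIdeal y b := by
  classical
  rw [← Finset.mul_prod_erase _ _ (Finset.mem_univ i), ← mul_assoc, ← pow_add]
  exact Ideal.mul_mem_right _ _ (Ideal.mem_of_dvd _ (pow_dvd_pow _ (h i))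
    (pow_mem_powerIdeal y b i))

variable [IsLocalRing A]

omit [Fintype ι] in
theorem exists_pow_le_powerIdeal [IsNoetherianRing A] {y : ι → A}
    (hy : Ideal.span (Set.range y) = maximalIdeal A) (a : ι → ℕ) :
    ∃ N, maximalIdeal A ^ N ≤ powerIdeal y a := by
  refine Ideal.exists_pow_le_of_le_radical_of_fg ?_ (IsNoetherian.noetherian _)
  rw [← hy, Ideal.span_le]
  rintro _ ⟨i, rfl⟩
  exact ⟨a i, pow_mem_powerIdeal y a i⟩

omit [Fintype ι] in
theorem mem_maximalIdeal_of_span_eq {y : ι → A}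
    (hy : Ideal.span (Set.range y) = maximalIdeal A) (i : ι) : y i ∈ maximalIdeal A :=
  hy ▸ Ideal.subset_span ⟨i, rfl⟩

omit [Fintype ι] in
theorem powerIdeal_const_le_pow {y : ι → A}
    (hy : Ideal.span (Set.range y) = maximalIdeal A) (t : ℕ) :
    powerIdeal y (fun _ => t) ≤ maximalIdeal A ^ t := by
  refine Ideal.span_le.2 ?_
  rintro _ ⟨i, rfl⟩
  exact Ideal.pow_mem_pow (mem_maximalIdeal_of_span_eq hy i) t

omit [Fintype ι] [IsLocalRing A] in
theorem frobeniusPower_powerIdeal (p : ℕ) [ExpChar A p] (y : ι → A) (t : ℕ) :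
    frobeniusPower p (powerIdeal y fun _ => t) 1 = powerIdeal y fun _ => p * t := by
  change Ideal.map (iterateFrobenius A p 1) (Ideal.span _) = Ideal.span _
  rw [Ideal.map_span, ← Set.range_comp]
  congr 2
  ext i
  simp [frobenius_def, ← pow_mul, mul_comm]

variable {E : Type*} [AddCommGroup E] [Module A E] {y : ι → A} {w : E}

/-- The annihilator of `e` determines the socle pairing on `A / (y i ^ a i)`. -/
theorem mem_powerIdeal_of_smul_eq_zero [IsNoetherianRing A]
    (hy : Ideal.span (Set.range y) = maximalIdeal A)
    (H : ∀ a : ι → ℕ, (∀ i, 1 ≤ a i) → LechIndependent fun i => y i ^ a i)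
    (hw : w ≠ 0) {a : ι → ℕ} (ha : ∀ i, 1 ≤ a i) {e : E}
    (he : ∀ x ∈ powerIdeal y a, x • e = 0) (hew : (∏ i, y i ^ (a i - 1)) • e = w) {x : A}
    (hx : x • e = 0) : x ∈ powerIdeal y a := by
  -- Otherwise a multiple of `x` is a nonzero socle element, hence a unit times the top monomial
  -- modulo the ideal. Applied to `e` it gives a unit times `w`, although `x` kills `e`.
  by_contra hxa
  obtain ⟨N, hN⟩ := exists_pow_le_powerIdeal hy a
  obtain ⟨b, hb, hb'⟩ := exists_mul_notMem_forall_mul_mem hN hxa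
  obtain ⟨c, hc⟩ := exists_sub_mul_prod_mem_powerIdeal H ha
    fun i => hb' (y i) (mem_maximalIdeal_of_span_eq hy i)
  have hu : IsUnit c := by
    by_contra hcu
    apply hb
    have h1 : c ∈ powerIdeal y (fun _ => 1) := by
      have : c ∈ maximalIdeal A := hcu
      simpa [powerIdeal, hy] using this
    have h2 := mul_mem_powerIdeal_of_mem (a := fun _ => 1) (b := a)
      (c := ∏ i, y i ^ (a i - 1)) (pow_mul_prod_mem_powerIdeal y fun i => by
        have := ha i
        omega) h1
    have h3 := add_mem hc h2
    rwa [sub_add_cancel] at h3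
  have h3 := he _ hc
  rw [sub_smul, mul_smul, mul_smul, hx, smul_zero, hew, zero_sub, neg_eq_zero] at h3
  exact hw ((hu.smul_eq_zero).1 h3)

/-- Induction on `∑ a i`. If `a i ≥ 2`, the hypothesis for `y i • z` shows that `z` differs from a
multiple of the expected generator by an element killed by `y i`, so the exponent at `i` may be
taken to be `1`. When all exponents are `1`, the element lies in the socle. -/
theorem exists_eq_smul_of_powerIdeal_smul_eq_zero
    (hy : Ideal.span (Set.range y) = maximalIdeal A)
    (hsoc : ∀ z : E, (∀ a ∈ maximalIdeal A, a • z = 0) → ∃ c : A, z = c • w) {t : ℕ}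
    {e : E} (hew : (∏ i, y i ^ (t - 1)) • e = w) (he : ∀ x ∈ powerIdeal y fun _ => t, x • e = 0)
    (a : ι → ℕ) (ha : ∀ i, 1 ≤ a i ∧ a i ≤ t) (z : E) (hz : ∀ i, y i ^ a i • z = 0) :
    ∃ c : A, z = c • (∏ i, y i ^ (t - a i)) • e := by
  classical
  induction hm : ∑ i, a i using Nat.strong_induction_on generalizing a z with
  | _ m ih =>
  subst hm
  by_cases h1 : ∀ i, a i = 1
  · simp only [h1] at hz ⊢
    rw [hew]
    refine hsoc z fun b hb => ?_
    rw [← hy] at hb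
    obtain ⟨c, rfl⟩ := Ideal.mem_span_range_iff_exists_fun.1 hb
    rw [Finset.sum_smul]
    refine Finset.sum_eq_zero fun i _ => ?_
    rw [mul_smul]
    have := hz i
    rw [pow_one] at this
    rw [this, smul_zero]
  · push Not at h1
    obtain ⟨i, hi⟩ := h1
    have hai : 2 ≤ a i := by have := (ha i).1; omega
    have hsum : ∀ m < a i, ∑ j, Function.update a i m j < ∑ j, a j := by
      intro m hm
      refine Finset.sum_lt_sum (fun j _ => ?_) ⟨i, Finset.mem_univ i, by simpa using hm⟩
      by_cases hj : j = i
      · subst hj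
        simpa using hm.le
      · simp [Function.update_of_ne hj]
    have hupd : ∀ m, 1 ≤ m → m < a i → ∀ j, 1 ≤ Function.update a i m j ∧
        Function.update a i m j ≤ t := by
      intro m h1 h2 j
      by_cases hj : j = i
      · subst hj
        rw [Function.update_self]
        exact ⟨h1, h2.le.trans (ha j).2⟩
      · rw [Function.update_of_ne hj]
        exact ha j
    have hprod : ∀ m, ∏ j, y j ^ (t - Function.update a i m j) =
        y i ^ (t - m) * ∏ j ∈ Finset.univ.erase i, y j ^ (t - a j) := by
      intro m
      rw [← Finset.mul_prod_erase _ _ (Finset.mem_univ i), Function.update_self]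
      congr 1
      refine Finset.prod_congr rfl fun j hj => ?_
      rw [Function.update_of_ne (Finset.ne_of_mem_erase hj)]
    obtain ⟨c, hc⟩ := ih _ (hsum (a i - 1) (by omega)) (Function.update a i (a i - 1))
      (hupd _ (by omega) (by omega)) (y i • z) (fun j => by
        by_cases hj : j = i
        · subst hj
          rw [Function.update_self, ← mul_smul, ← pow_succ, Nat.sub_add_cancel (ha j).1, hz]
        · rw [Function.update_of_ne hj, smul_comm, hz, smul_zero]) rfl
    rw [hprod] at hc
    have hprod' := hprod (a i)
    rw [Function.update_eq_self] at hprod'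
    obtain ⟨c', hc'⟩ := ih _ (hsum 1 (by omega)) (Function.update a i 1)
      (hupd _ le_rfl (by omega)) (z - c • (∏ i, y i ^ (t - a i)) • e) (fun j => by
        by_cases hj : j = i
        · subst hj
          have h2 : t - (a j - 1) = t - a j + 1 := by have := (ha j).2; omega
          rw [Function.update_self, pow_one, smul_sub, hc, hprod', h2, sub_eq_zero]
          simp only [smul_smul]
          congr 1
          ring
        · rw [Function.update_of_ne hj, smul_sub, hz, zero_sub, neg_eq_zero, smul_comm,
            ← mul_smul (y j ^ a j), he _ (pow_mul_prod_mem_powerIdeal y (fun j => by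
              have := (ha j).2; omega) j), smul_zero]) rfl
    rw [hprod] at hc'
    refine ⟨c + c' * y i ^ (a i - 1), ?_⟩
    have h2 : t - 1 = (a i - 1) + (t - a i) := by have := ha i; omega
    rw [sub_eq_iff_eq_add] at hc'
    rw [hc', h2, pow_add, hprod', add_comm]
    simp only [smul_smul, ← add_smul]
    congr 1
    ring

end System

/-! ### Construction of the Frobenius map on the hull -/

section Existence

open IsLocalRing

/-- Each stage divides the previous element by `∏ y_i` inside the injective module. The obstruction
vanishes because `(Y_{t+1} : ∏ y_i) ⊆ Y_t` for `Y_t = (y_i^t)`. -/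
theorem exists_socle_tower {A E : Type u} [CommRing A] [IsLocalRing A] [AddCommGroup E]
    [Module A E] {ι : ResidueField A →ₗ[A] E} (hι : IsInjectiveHull ι) {d : ℕ} {y : Fin d → A}
    (hy : Ideal.span (Set.range y) = maximalIdeal A)
    (H : ∀ a : Fin d → ℕ, (∀ i, 1 ≤ a i) → LechIndependent fun i => y i ^ a i) :
    ∃ e : ℕ → E, e 1 = ι 1 ∧ (∀ t, (∏ i, y i) • e (t + 1) = e t) ∧
      ∀ t, ∀ x ∈ powerIdeal y fun _ => t, x • e t = 0 := by
  have hprod : ∀ t, ∀ x ∈ powerIdeal y (fun _ => t), x * ∏ i, y i ∈ powerIdeal y fun _ => t + 1 := by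
    intro t x hx
    have := mul_mem_powerIdeal_of_mem (c := ∏ i, y i ^ 1) (b := fun _ => t + 1)
      (pow_mul_prod_mem_powerIdeal y fun i => le_rfl) hx
    simpa using this
  have step : ∀ (t : ℕ) (w : E), (∀ x ∈ powerIdeal y fun _ => t + 1, x • w = 0) →
      ∃ w' : E, (∀ x ∈ powerIdeal y fun _ => t + 1 + 1, x • w' = 0) ∧ (∏ i, y i) • w' = w := by
    intro t w hw
    refine exists_smul_eq_of_injective hι.injective_module _ _ w fun a ha => hw a ?_
    have := mem_powerIdeal_of_mul_prod_mem H (a := fun _ => t + 1 + 1) (c := fun _ => 1)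
      (fun _ => by omega) Finset.univ (x := a) (by simpa using ha)
    simpa using this
  -- The index is shifted: `ε t` becomes `e (t + 1)`, and multiplying once more by `∏ y_i` supplies
  -- `e 0`.
  let ε : (t : ℕ) → {w : E // ∀ x ∈ powerIdeal y fun _ => t + 1, x • w = 0} := fun t =>
    Nat.rec ⟨ι 1, fun x hx => smul_hull_one_of_mem (by
      have := powerIdeal_const_le_pow hy _ hx
      simpa using this)⟩
      (fun t w => ⟨(step t w.1 w.2).choose, (step t w.1 w.2).choose_spec.1⟩) t
  have hε : ∀ t, (∏ i, y i) • (ε (t + 1)).1 = (ε t).1 := fun t =>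
    (step t (ε t).1 (ε t).2).choose_spec.2
  refine ⟨fun t => (∏ i, y i) • (ε t).1, hε 0, fun t => congrArg _ (hε t), fun t x hx => ?_⟩
  rw [← mul_smul]
  exact (ε t).2 _ (hprod t x hx)

/-- `E` is the direct limit of the quotients `A / Y_t` under multiplication by `∏ y_i`, and `θ` is
induced by the Frobenius maps `A / Y_t → A / Y_{pt}`. -/
theorem exists_frobeniusSystem (p : ℕ) [Fact p.Prime] {A E : Type u} [CommRing A] [IsLocalRing A]
    [IsNoetherianRing A] [ExpChar A p] (hA : (frobenius A p).Flat) [AddCommGroup E] [Module A E]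
    {ι : ResidueField A →ₗ[A] E} (hι : IsInjectiveHull ι) :
    ∃ (Y : ℕ → Ideal A) (e : ℕ → E) (θ : frobeniusMaps p A E 1), IsFrobeniusSystem p Y e θ := by
  obtain ⟨d, y, hy, H⟩ := exists_pow_lechIndependent_generators p A hA
  obtain ⟨e, he1, hey, hYe⟩ := exists_socle_tower hι hy H
  let Y : ℕ → Ideal A := fun t => powerIdeal y fun _ => t
  have hanti : Antitone Y := fun s t h => powerIdeal_anti y fun _ => h
  have hpow : ∀ s t, (∏ i, y i) ^ s • e (t + s) = e t := by
    intro s t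
    induction s with
    | zero => simp
    | succ s ih => rw [pow_succ, mul_smul, ← add_assoc, hey, ih]
  have hetop : ∀ t, 1 ≤ t → (∏ i, y i ^ (t - 1)) • e t = ι 1 := by
    intro t ht
    rw [Finset.prod_pow, ← he1]
    have := hpow (t - 1) 1
    rwa [Nat.add_sub_cancel' ht] at this
  have hann : ∀ t, 1 ≤ t → ∀ a : A, a • e t = 0 ↔ a ∈ Y t := fun t ht a =>
    ⟨mem_powerIdeal_of_smul_eq_zero hy H hι.apply_one_ne_zero (fun _ => ht) (hYe t) (hetop t ht),
      hYe t a⟩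
  have hcyc : ∀ t, 1 ≤ t → ∀ z : E, (∀ a ∈ Y t, a • z = 0) → ∃ a : A, z = a • e t := by
    intro t ht z hz
    obtain ⟨c, hc⟩ := exists_eq_smul_of_powerIdeal_smul_eq_zero hy
      (fun z => hι.exists_eq_smul_one) (hetop t ht) (hYe t) (fun _ => t) (fun _ => ⟨ht, le_rfl⟩) z
      fun i => hz _ (pow_mem_powerIdeal y (fun _ => t) i)
    exact ⟨c, by simpa using hc⟩
  have hfrob : ∀ t, frobeniusPower p (Y t) 1 = Y (p * t) := fun t => frobeniusPower_powerIdeal p y t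
  have hpos : 0 < p := (Fact.out : p.Prime).pos
  have hexists : ∀ z : E, ∃ t, 1 ≤ t ∧ ∃ a : A, z = a • e t := by
    intro z
    obtain ⟨s, hs⟩ := hι.exists_pow_smul_eq_zero z
    refine ⟨s + 1, by omega, hcyc _ (by omega) z fun a ha => hs a ?_⟩
    exact Ideal.pow_le_pow_right (Nat.le_succ s) (powerIdeal_const_le_pow hy _ ha)
  -- Both elements are rewritten as multiples of `e (s + t)`; the difference of the coefficients
  -- lies in `Y (s + t)`, and its `p`-th power in `Y (p * (s + t))`.
  have hwd : ∀ s t, 1 ≤ s → 1 ≤ t → ∀ a b : A, a • e s = b • e t →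
      a ^ p • e (p * s) = b ^ p • e (p * t) := by
    intro s t hs ht a b hab
    rw [← hpow t s, ← hpow s t, add_comm t s, ← mul_smul, ← mul_smul, ← sub_eq_zero,
      ← sub_smul, hann _ (by omega)] at hab
    have h1 : (a * (∏ i, y i) ^ t - b * (∏ i, y i) ^ s) ^ p ∈ Y (p * (s + t)) := by
      rw [← hfrob]
      exact Ideal.subset_span ⟨_, hab, by simp⟩
    rw [sub_pow_expChar, mul_pow, mul_pow] at h1
    have h2 := hYe _ _ h1
    rw [sub_smul, sub_eq_zero, mul_smul, mul_smul, ← pow_mul, ← pow_mul, mul_add,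
      mul_comm t p, mul_comm s p, hpow] at h2
    rw [h2, add_comm (p * s), hpow]
  choose T hT c hc using hexists
  have hθ : ∀ t, 1 ≤ t → ∀ a : A, c (a • e t) ^ p • e (p * T (a • e t)) = a ^ p • e (p * t) :=
    fun t ht a => hwd _ _ (hT _) ht _ _ (hc _).symm
  have hcommon : ∀ z w : E, ∃ t, 1 ≤ t ∧ ∃ a b : A, z = a • e t ∧ w = b • e t := by
    intro z w
    refine ⟨T z + T w, by have := hT z; omega, c z * (∏ i, y i) ^ T w, c w * (∏ i, y i) ^ T z,
      ?_, ?_⟩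
    · rw [mul_smul, hpow, ← hc]
    · rw [mul_smul, add_comm, hpow, ← hc]
  let θ : E →+ E := AddMonoidHom.mk' (fun z => c z ^ p • e (p * T z)) fun z w => by
    obtain ⟨t, ht, a, b, rfl, rfl⟩ := hcommon z w
    rw [← add_smul, hθ t ht, hθ t ht, hθ t ht, add_pow_expChar, add_smul]
  have hθe : ∀ t, 1 ≤ t → ∀ a : A, θ (a • e t) = a ^ p • e (p * t) := hθ
  refine ⟨Y, e, ⟨θ, fun r z => ?_⟩, powerIdeal_const_le_pow hy,
    fun t => exists_pow_le_powerIdeal hy _, hanti, hfrob, hann, hcyc, fun t ht => ?_⟩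
  · obtain ⟨t, ht, a, rfl⟩ : ∃ t, 1 ≤ t ∧ ∃ a : A, z = a • e t := ⟨T z, hT z, c z, hc z⟩
    have h1 : r ^ p ^ 1 • θ (a • e t) = (r * a) ^ p • e (p * t) := by
      rw [hθe t ht, mul_pow, mul_smul, pow_one]
    rw [← mul_smul]
    exact (hθe t ht (r * a)).trans h1.symm
  · have := hθe t ht 1
    rw [one_smul, one_pow, one_smul] at this
    exact this

end Existence

/-! ### Frobenius powers and propagation of the colon conditions -/

section FrobeniusPower

variable {A : Type*} [CommRing A] (p : ℕ)

theorem frobeniusPower_eq_map [ExpChar A p] (I : Ideal A) (e : ℕ) :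
    frobeniusPower p I e = I.map (iterateFrobenius A p e) := rfl

theorem pow_mem_frobeniusPower {I : Ideal A} {a : A} (ha : a ∈ I) (e : ℕ) :
    a ^ p ^ e ∈ frobeniusPower p I e := Ideal.subset_span ⟨a, ha, rfl⟩

theorem frobeniusPower_le_self (I : Ideal A) [Fact p.Prime] (e : ℕ) :
    frobeniusPower p I e ≤ I := by
  refine Ideal.span_le.2 ?_
  rintro _ ⟨a, ha, rfl⟩
  exact Ideal.pow_mem_of_mem _ ha _ (pow_pos (Fact.out : p.Prime).pos _)

theorem frobeniusPower_mono {I J : Ideal A} (h : I ≤ J) (e : ℕ) :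
    frobeniusPower p I e ≤ frobeniusPower p J e := Ideal.span_mono (Set.image_mono h)

theorem frobeniusPower_zero (I : Ideal A) : frobeniusPower p I 0 = I := by
  simp [frobeniusPower]

theorem frobeniusPower_succ [ExpChar A p] (I : Ideal A) (e : ℕ) :
    frobeniusPower p (frobeniusPower p I e) 1 = frobeniusPower p I (e + 1) := by
  rw [frobeniusPower_eq_map, frobeniusPower_eq_map, frobeniusPower_eq_map, Ideal.map_map]
  congr 1
  ext x
  simp [iterateFrobenius_def, frobenius_def, pow_succ, pow_mul]

theorem frobeniusPower_sup [ExpChar A p] (I J : Ideal A) (e : ℕ) :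
    frobeniusPower p (I ⊔ J) e = frobeniusPower p I e ⊔ frobeniusPower p J e := by
  rw [frobeniusPower_eq_map, Ideal.map_sup]
  rfl

theorem frobeniusPower_span [ExpChar A p] (s : Set A) (e : ℕ) :
    frobeniusPower p (Ideal.span s) e = Ideal.span ((fun a => a ^ p ^ e) '' s) := by
  rw [frobeniusPower_eq_map, Ideal.map_span]
  rfl

theorem frobeniusPower_span_singleton [ExpChar A p] (a : A) (e : ℕ) :
    frobeniusPower p (Ideal.span {a}) e = Ideal.span {a ^ p ^ e} := by
  rw [frobeniusPower_span, Set.image_singleton]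

theorem frobeniusPower_colon [ExpChar A p] [IsNoetherianRing A] (hA : (frobenius A p).Flat)
    (L N : Ideal A) (e : ℕ) :
    (frobeniusPower p L e).colon (frobeniusPower p N e : Set A) =
      frobeniusPower p (L.colon (N : Set A)) e :=
  map_colon_of_flat (flat_iterateFrobenius p hA e) (IsNoetherian.noetherian L)
    (IsNoetherian.noetherian N)

/-- The element `u ^ (1 + p + ⋯ + p ^ (e - 1))`. -/
def frobeniusNorm (u : A) : ℕ → A
  | 0 => 1
  | e + 1 => u * frobeniusNorm u e ^ p

/-- The colon conditions under which the Frobenius algebra of `A / I` is generated by `u`. -/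
structure IsFedderGenerator (I : Ideal A) (u : A) (e : ℕ) : Prop where
  colon_le : (frobeniusPower p I e).colon (I : Set A) ≤ frobeniusPower p I e ⊔ Ideal.span {u}
  mem_of_mul_mem : ∀ a, a * u ∈ frobeniusPower p I e → a ∈ I
  mul_mem : ∀ a ∈ I, a * u ∈ frobeniusPower p I e

variable {p}

/-- Write `q = p^e` and let `v` be the element for `e`. Flatness gives `(I^[pq] : I) ⊆ (I^[pq] :
I^[p]) = (I^[q] : I)^[p] ⊆ I^[pq] + (v^p)`. It also gives `(I^[pq] : v^p) ⊆ I^[p]`, so the cofactor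
of `v^p` lies in `(I^[p] : I)`, where the case of exponent one applies. -/
theorem IsFedderGenerator.frobeniusNorm [ExpChar A p] [Fact p.Prime] [IsNoetherianRing A]
    (hA : (frobenius A p).Flat) {I : Ideal A} {u : A} (h : IsFedderGenerator p I u 1) (e : ℕ) :
    IsFedderGenerator p I (frobeniusNorm p u e) e := by
  induction e with
  | zero =>
    constructor
    · refine le_top.trans (le_sup_of_le_right ?_)
      simp [FrobeniusLocus.frobeniusNorm]
    · intro a ha
      simpa [FrobeniusLocus.frobeniusNorm, frobeniusPower_zero] using ha
    · intro a ha
      simpa [FrobeniusLocus.frobeniusNorm, frobeniusPower_zero] using ha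
  | succ e ih =>
    set v := FrobeniusLocus.frobeniusNorm p u e with hv
    have hv' : FrobeniusLocus.frobeniusNorm p u (e + 1) = u * v ^ p := rfl
    have up : ∀ x ∈ frobeniusPower p I 1, x * v ^ p ∈ frobeniusPower p I (e + 1) := by
      have h1 : frobeniusPower p I 1 ≤ (frobeniusPower p I (e + 1)).colon {v ^ p} := by
        refine Ideal.span_le.2 ?_
        rintro _ ⟨b, hb, rfl⟩
        refine Submodule.mem_colon_singleton.2 ?_
        simp only [smul_eq_mul, pow_one]
        rw [← mul_pow, ← frobeniusPower_succ]
        simpa using pow_mem_frobeniusPower p (ih.mul_mem b hb) 1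
      intro x hx
      exact Submodule.mem_colon_singleton.1 (h1 hx)
    have down : ∀ x, x * v ^ p ∈ frobeniusPower p I (e + 1) → x ∈ frobeniusPower p I 1 := by
      intro x hx
      have h1 : x ∈ (frobeniusPower p (frobeniusPower p I e) 1).colon
          (frobeniusPower p (Ideal.span {v}) 1 : Set A) := by
        rw [frobeniusPower_span_singleton, frobeniusPower_succ, Ideal.mem_colon_span_singleton,
          pow_one]
        exact hx
      rw [frobeniusPower_colon p hA] at h1
      refine frobeniusPower_mono p (fun a ha => ih.mem_of_mul_mem a ?_) 1 h1
      exact Ideal.mem_colon_span_singleton.1 ha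
    rw [hv']
    constructor
    · intro c hc
      have h1 : c ∈ (frobeniusPower p (frobeniusPower p I e) 1).colon
          (frobeniusPower p I 1 : Set A) := by
        rw [frobeniusPower_succ]
        exact Submodule.colon_mono le_rfl (frobeniusPower_le_self p I 1) hc
      rw [frobeniusPower_colon p hA] at h1
      have h2 := frobeniusPower_mono p ih.colon_le 1 h1
      rw [frobeniusPower_sup, frobeniusPower_span_singleton, frobeniusPower_succ, pow_one] at h2
      obtain ⟨x, hx, w, hw, rfl⟩ := Submodule.mem_sup.1 h2
      obtain ⟨a, rfl⟩ := Ideal.mem_span_singleton'.1 hw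
      have h3 : a ∈ (frobeniusPower p I 1).colon (I : Set A) := by
        refine Submodule.mem_colon.2 fun b hb => down _ ?_
        have h4 := Submodule.mem_colon.1 hc b hb
        have h5 := sub_mem h4 (Ideal.mul_mem_right b _ hx)
        convert h5 using 1
        simp only [smul_eq_mul]
        ring
      obtain ⟨w', hw', r', hr', rfl⟩ := Submodule.mem_sup.1 (h.colon_le h3)
      obtain ⟨r, rfl⟩ := Ideal.mem_span_singleton'.1 hr'
      refine Submodule.mem_sup.2 ⟨x + w' * v ^ p, add_mem hx (up _ hw'), r * (u * v ^ p),
        Ideal.mul_mem_left _ _ (Ideal.mem_span_singleton_self _), by ring⟩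
    · intro a ha
      refine h.mem_of_mul_mem a (down _ ?_)
      rwa [mul_assoc]
    · intro a ha
      rw [← mul_assoc]
      exact up _ (h.mul_mem a ha)

end FrobeniusPower

/-! ### Colon ideals modulo high powers -/

section ArtinRees

/-- Let `w` be the vector of generators of `N` in a power of `A / L`. If `a` is in the left side, `a
w` lies in a high power of `m` times the ambient module, so Artin–Rees gives `a w = b w` with `b ∈
m^n`, and `a - b` is in the colon. -/
theorem exists_colon_sup_pow_le {A : Type*} [CommRing A] [IsNoetherianRing A] (m L N : Ideal A)
    (n : ℕ) : ∃ s, (L ⊔ m ^ s).colon (N : Set A) ≤ L.colon (N : Set A) ⊔ m ^ n := by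
  classical
  obtain ⟨g, v, rfl⟩ := Submodule.fg_iff_exists_fin_generating_family.1 (IsNoetherian.noetherian N)
  let w : Fin g → A ⧸ L := fun i => Ideal.Quotient.mk L (v i)
  obtain ⟨k, hk⟩ := m.exists_pow_inf_eq_pow_smul (Submodule.span A {w})
  refine ⟨n + k, fun a ha => ?_⟩
  rw [Submodule.colon_span, Submodule.mem_colon] at ha
  have h1 : a • w ∈ m ^ (n + k) • (⊤ : Submodule A (Fin g → A ⧸ L)) := by
    rw [pi_eq_sum_univ' w, Finset.smul_sum]
    refine sum_mem fun i _ => ?_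
    obtain ⟨x, hx, y, hy, hxy⟩ := Submodule.mem_sup.1 (ha (v i) ⟨i, rfl⟩)
    have h2 : a • w i • (Pi.single i 1 : Fin g → A ⧸ L) = y • Pi.single i 1 := by
      rw [← smul_assoc]
      have h3 : a • w i = Ideal.Quotient.mk L y := by
        have h4 : a • w i = Ideal.Quotient.mk L (a • v i) := rfl
        rw [h4, ← hxy, map_add, Ideal.Quotient.eq_zero_iff_mem.2 hx, zero_add]
      rw [h3]
      rfl
    rw [h2]
    exact Submodule.smul_mem_smul hy trivial
  have h2 : a • w ∈ m ^ n • Submodule.span A {w} := by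
    have h3 : a • w ∈ m ^ (n + k) • ⊤ ⊓ Submodule.span A {w} :=
      ⟨h1, Submodule.smul_mem _ _ (Submodule.mem_span_singleton_self w)⟩
    rw [hk _ (Nat.le_add_left k n), Nat.add_sub_cancel] at h3
    exact Submodule.smul_mono le_rfl inf_le_right h3
  obtain ⟨b, hb, hbw⟩ := Submodule.mem_smul_span_singleton.1 h2
  refine Submodule.mem_sup.2 ⟨a - b, ?_, b, hb, sub_add_cancel a b⟩
  rw [Submodule.colon_span, Submodule.mem_colon]
  rintro _ ⟨i, rfl⟩
  rw [← Ideal.Quotient.eq_zero_iff_mem]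
  have h3 : (a - b) • w = 0 := by rw [sub_smul, hbw, sub_self]
  exact congrFun h3 i

end ArtinRees

/-! ### Frobenius maps on annihilators in the hull -/

section Classification

open IsLocalRing

theorem pow_frobeniusMap_smul {p : ℕ} {A E : Type*} [CommRing A] [AddCommGroup E] [Module A E]
    (θ : frobeniusMaps p A E 1) (e : ℕ) (a : A) (z : E) :
    (θ.1 ^ e) (a • z) = a ^ p ^ e • (θ.1 ^ e) z := by
  induction e with
  | zero => simp
  | succ e ih =>
    rw [pow_succ' θ.1]
    change θ.1 ((θ.1 ^ e) (a • z)) = _ • θ.1 ((θ.1 ^ e) z)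
    rw [ih, θ.2, ← pow_mul, pow_one, pow_succ]

variable {p : ℕ} {A E : Type u} [CommRing A] [IsLocalRing A] [AddCommGroup E] [Module A E]
  {Y : ℕ → Ideal A} {e : ℕ → E} {θ : frobeniusMaps p A E 1}

theorem IsFrobeniusSystem.frobeniusPower_eq_pow [ExpChar A p] (h : IsFrobeniusSystem p Y e θ)
    (t m : ℕ) : frobeniusPower p (Y t) m = Y (p ^ m * t) := by
  induction m with
  | zero => rw [frobeniusPower_zero, pow_zero, one_mul]
  | succ m ih => rw [← frobeniusPower_succ, ih, h.frobeniusPower_eq, pow_succ', mul_assoc]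

theorem IsFrobeniusSystem.pow_apply_eq [Fact p.Prime] (h : IsFrobeniusSystem p Y e θ)
    (m : ℕ) {t : ℕ} (ht : 1 ≤ t) : (θ.1 ^ m) (e t) = e (p ^ m * t) := by
  induction m with
  | zero => simp
  | succ m ih =>
    rw [pow_succ' θ.1]
    change θ.1 ((θ.1 ^ m) (e t)) = _
    rw [ih, h.apply_eq _ (Nat.mul_pos (pow_pos (Fact.out : p.Prime).pos _) ht), pow_succ',
      mul_assoc]

omit [IsLocalRing A] in
theorem frobeniusPower_smul_pow_eq_zero (θ : frobeniusMaps p A E 1) (m : ℕ)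
    {I : Ideal A} {z : E} (hz : ∀ a ∈ I, a • z = 0) :
    ∀ a ∈ frobeniusPower p I m, a • (θ.1 ^ m) z = 0 := by
  intro a ha
  have h1 : frobeniusPower p I m ≤ LinearMap.ker (LinearMap.toSpanSingleton A E ((θ.1 ^ m) z)) := by
    refine Ideal.span_le.2 ?_
    rintro _ ⟨b, hb, rfl⟩
    change b ^ p ^ m • (θ.1 ^ m) z = 0
    rw [← pow_frobeniusMap_smul, hz b hb, map_zero]
  exact h1 ha

variable [ExpChar A p] [Fact p.Prime] [IsNoetherianRing A] {ι : ResidueField A →ₗ[A] E}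

/-- The annihilator of the image under `θ ^ m` of the elements killed by `I` and `Y t`. -/
theorem IsFrobeniusSystem.mem_sup_of_smul_pow_eq_zero (h : IsFrobeniusSystem p Y e θ)
    (hA : (frobenius A p).Flat) (hι : IsInjectiveHull ι) (I : Ideal A) (m : ℕ) {t : ℕ} (ht : 1 ≤ t)
    {x : A} (hx : ∀ z : E, (∀ a ∈ I, a • z = 0) → (∀ a ∈ Y t, a • z = 0) →
      x • (θ.1 ^ m) z = 0) : x ∈ frobeniusPower p I m ⊔ Y (p ^ m * t) := by
  by_contra hcon
  obtain ⟨w, hw, hxw⟩ := hι.exists_smul_ne_zero hcon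
  have hqt : 1 ≤ p ^ m * t := Nat.mul_pos (pow_pos (Fact.out : p.Prime).pos _) ht
  obtain ⟨b, rfl⟩ := h.exists_eq_smul _ hqt w fun a ha => hw a (Ideal.mem_sup_right ha)
  -- Since `w` is killed by `(I + Y t)^[p^m]`, flatness makes `b` a combination of `k^(p^m)` with `k
  -- • e t` killed by `I` and `Y t`. Thus `w` is a combination of the images `θ^m (k • e t)`, all of
  -- which `x` kills.
  have hb : b ∈ frobeniusPower p ((Y t).colon ((I ⊔ Y t : Ideal A) : Set A)) m := by
    rw [← frobeniusPower_colon p hA, frobeniusPower_sup, h.frobeniusPower_eq_pow]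
    refine Submodule.mem_colon.2 fun a ha => ?_
    rw [← h.smul_eq_zero_iff _ hqt, smul_eq_mul, mul_comm, mul_smul]
    exact hw a ha
  have hle : frobeniusPower p ((Y t).colon ((I ⊔ Y t : Ideal A) : Set A)) m ≤
      LinearMap.ker (LinearMap.toSpanSingleton A E (x • e (p ^ m * t))) := by
    refine Ideal.span_le.2 ?_
    rintro _ ⟨k, hk, rfl⟩
    change k ^ p ^ m • x • e (p ^ m * t) = 0
    rw [smul_comm, ← h.pow_apply_eq m ht, ← pow_frobeniusMap_smul]
    have hk' : ∀ a ∈ I ⊔ Y t, a • k • e t = 0 := fun a ha => by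
      rw [← mul_smul, h.smul_eq_zero_iff t ht, mul_comm]
      exact Submodule.mem_colon.1 hk a ha
    exact hx _ (fun a ha => hk' a (Ideal.mem_sup_left ha)) fun a ha =>
      hk' a (Ideal.mem_sup_right ha)
  have hzero : b • x • e (p ^ m * t) = 0 := hle hb
  rw [smul_comm] at hzero
  exact hxw hzero

/-- Approximate uniqueness of the coefficient of `v θ^m`: the annihilator computation places `b v`
in `I^[p^m]` plus a high power of the maximal ideal, and Artin–Rees together with `(I^[p^m] : v) ⊆
I` cancels `v`. -/
theorem IsFrobeniusSystem.exists_mem_sup_of_smul_pow_eq_zero (h : IsFrobeniusSystem p Y e θ)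
    (hA : (frobenius A p).Flat) (hι : IsInjectiveHull ι) {I : Ideal A} {v : A} {m : ℕ}
    (hv : IsFedderGenerator p I v m) (n : ℕ) : ∃ s, ∀ b : A,
      (∀ z : E, (∀ a ∈ I, a • z = 0) → (∀ a ∈ maximalIdeal A ^ s, a • z = 0) →
        b • v • (θ.1 ^ m) z = 0) → b ∈ I ⊔ maximalIdeal A ^ n := by
  obtain ⟨s₀, hs₀⟩ := exists_colon_sup_pow_le (maximalIdeal A) (frobeniusPower p I m)
    (Ideal.span {v}) n
  obtain ⟨s, hs⟩ := h.pow_le (s₀ + 1)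
  refine ⟨s, fun b hb => ?_⟩
  have h1 := h.mem_sup_of_smul_pow_eq_zero hA hι I m (t := s₀ + 1) (by omega) (x := b * v)
    fun z hz hz' => by
      rw [mul_smul]
      exact hb z hz fun a ha => hz' a (hs ha)
  have hle : s₀ ≤ p ^ m * (s₀ + 1) := (Nat.le_succ s₀).trans
    (Nat.le_mul_of_pos_left _ (pow_pos (Fact.out : p.Prime).pos _))
  have h2 : b * v ∈ frobeniusPower p I m ⊔ maximalIdeal A ^ s₀ :=
    sup_le_sup_left ((h.le_pow _).trans (Ideal.pow_le_pow_right hle)) _ h1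
  have hle' : (frobeniusPower p I m).colon (Ideal.span {v} : Set A) ≤ I := fun a ha =>
    hv.mem_of_mul_mem a (Ideal.mem_colon_span_singleton.1 ha)
  exact sup_le_sup_right hle' _ (hs₀ (Ideal.mem_colon_span_singleton.2 h2))

/-- Extended to `E`, the map sends `e t` to a multiple `r e_{p^m t}`, so it is `r θ^m` on the
elements killed by `Y t`. As it preserves `Ann I`, the coefficient `r` multiplies `I` into `I^[p^m]`
up to a high power, and Artin–Rees replaces it by an element of `(I^[p^m] : I)`, that is by a
multiple of `v`. -/
theorem IsFrobeniusSystem.exists_eq_smul_pow (h : IsFrobeniusSystem p Y e θ)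
    (hA : (frobenius A p).Flat) (hι : IsInjectiveHull ι) {I : Ideal A} {v : A} {m : ℕ}
    (hv : IsFedderGenerator p I v m) (N : Submodule A E)
    (hN : ∀ z, z ∈ N ↔ ∀ a ∈ I, a • z = 0) (φ : N →+ E)
    (hφ : ∀ (a : A) (z : N), φ (a • z) = a ^ p ^ m • φ z) (hφN : ∀ z, φ z ∈ N) (n : ℕ) :
    ∃ b : A, ∀ z : N, (∀ a ∈ maximalIdeal A ^ n, a • (z : E) = 0) →
      φ z = b • v • (θ.1 ^ m) z := by
  obtain ⟨ψ, hψ, hψφ⟩ := exists_semilinear_extension hι.injective_module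
    (flat_iterateFrobenius p hA m) N φ hφ
  replace hψ : ∀ (a : A) (z : E), ψ (a • z) = a ^ p ^ m • ψ z := hψ
  have hq : 0 < p ^ m := pow_pos (Fact.out : p.Prime).pos _
  -- Chosen so that an Artin–Rees error in the `n'`-th power kills `θ^m z` whenever `Y n` kills `z`.
  obtain ⟨n', hn'⟩ := h.pow_le (p ^ m * n)
  obtain ⟨s, hs⟩ := exists_colon_sup_pow_le (maximalIdeal A) (frobeniusPower p I m) I n'
  -- `t ≥ n` covers the elements under consideration, `t ≥ s` gives the precision needed for
  -- Artin–Rees, and the extra `1` keeps `t` positive.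
  let t := n + s + 1
  have ht : 1 ≤ t := by omega
  have hψe : ∀ a ∈ Y (p ^ m * t), a • ψ (e t) = 0 := by
    have h1 : Y (p ^ m * t) ≤ LinearMap.ker (LinearMap.toSpanSingleton A E (ψ (e t))) := by
      rw [← h.frobeniusPower_eq_pow]
      refine Ideal.span_le.2 ?_
      rintro _ ⟨b, hb, rfl⟩
      change b ^ p ^ m • ψ (e t) = 0
      rw [← hψ, (h.smul_eq_zero_iff t ht b).2 hb, map_zero]
    intro a ha
    exact h1 ha
  obtain ⟨r, hr⟩ := h.exists_eq_smul _ (Nat.mul_pos hq ht) _ hψe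
  have hφr : ∀ z : N, (∀ a ∈ Y t, a • (z : E) = 0) → φ z = r • (θ.1 ^ m) z := by
    intro z hz
    obtain ⟨c, hc⟩ := h.exists_eq_smul t ht z hz
    rw [← hψφ, hc, hψ, hr, pow_frobeniusMap_smul, h.pow_apply_eq m ht, smul_comm]
  have hrI : r ∈ (frobeniusPower p I m ⊔ maximalIdeal A ^ s).colon (I : Set A) := by
    refine Submodule.mem_colon.2 fun a ha => ?_
    have h1 := h.mem_sup_of_smul_pow_eq_zero hA hι I m ht (x := r * a) fun z hz hz' => by
      have h2 := hφr ⟨z, (hN z).2 hz⟩ hz'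
      have h3 := (hN _).1 (hφN ⟨z, (hN z).2 hz⟩) a ha
      rw [h2] at h3
      rwa [mul_comm, mul_smul]
    refine sup_le_sup_left ((h.le_pow _).trans (Ideal.pow_le_pow_right ?_)) _ h1
    exact le_trans (by omega : s ≤ t) (Nat.le_mul_of_pos_left _ hq)
  obtain ⟨x, hx, c, hc, hxc⟩ := Submodule.mem_sup.1 (hs hrI)
  obtain ⟨x', hx', w, hw, rfl⟩ := Submodule.mem_sup.1 (hv.colon_le hx)
  obtain ⟨b, rfl⟩ := Ideal.mem_span_singleton'.1 hw
  refine ⟨b, fun z hz => ?_⟩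
  have hzY : ∀ a ∈ Y n, a • (z : E) = 0 := fun a ha => hz a (h.le_pow n ha)
  rw [hφr z fun a ha => hzY a (h.anti (by omega) ha), ← hxc, add_smul, add_smul,
    frobeniusPower_smul_pow_eq_zero θ m ((hN z).1 z.2) x' hx', zero_add, mul_smul,
    frobeniusPower_smul_pow_eq_zero θ m hzY c (by rw [h.frobeniusPower_eq_pow]; exact hn' hc), add_zero]

end Classification

/-! ### Passage to a quotient ring -/

section Transport

open IsLocalRing

theorem map_maximalIdeal_of_surjective {A B : Type*} [CommRing A] [CommRing B] [IsLocalRing A]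
    [IsLocalRing B] {π : A →+* B} (hπ : Function.Surjective π) :
    (maximalIdeal A).map π = maximalIdeal B := by
  have : IsLocalHom π := hπ.isLocalHom
  refine le_antisymm (((local_hom_TFAE π).out 0 2).1 this) fun b hb => ?_
  obtain ⟨a, rfl⟩ := hπ b
  refine Ideal.mem_map_of_mem π ?_
  rw [mem_maximalIdeal, mem_nonunits_iff] at hb ⊢
  exact fun h => hb (h.map π)

/-- For a surjection `π : A → B` of local rings, the injective hull of the residue field of `B` is
the annihilator of `ker π` in that of `A`. -/
theorem exists_hull_embedding {A B E F : Type u} [CommRing A] [CommRing B] [IsLocalRing A]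
    [IsLocalRing B] {π : A →+* B} (hπ : Function.Surjective π) [AddCommGroup E] [Module A E]
    [AddCommGroup F] [Module B F] {ι : ResidueField A →ₗ[A] E} (hι : IsInjectiveHull ι)
    {κ : ResidueField B →ₗ[B] F} (hκ : IsInjectiveHull κ) :
    ∃ j : F →+ E, (∀ (a : A) (x : F), j (π a • x) = a • j x) ∧ Function.Injective j ∧
      Set.range j = {z | ∀ a ∈ RingHom.ker π, a • z = 0} := by
  have hmax := map_maximalIdeal_of_surjective hπ
  let _ : Module A F := Module.compHom F π
  have hF : ∀ (a : A) (x : F), a • x = π a • x := fun _ _ => rfl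
  obtain ⟨j, hj⟩ : ∃ j : F →ₗ[A] E, j (κ 1) = ι 1 := by
    let g : A →ₗ[A] F := LinearMap.toSpanSingleton A F (κ 1)
    let i : A ⧸ LinearMap.ker g →ₗ[A] F := (LinearMap.ker g).liftQ g le_rfl
    have hi : Function.Injective i :=
      LinearMap.ker_eq_bot.1 (Submodule.ker_liftQ_eq_bot _ _ _ le_rfl)
    let l : A ⧸ LinearMap.ker g →ₗ[A] E :=
      (LinearMap.ker g).liftQ (LinearMap.toSpanSingleton A E (ι 1)) fun a ha => by
        refine smul_hull_one_of_mem ?_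
        rw [mem_maximalIdeal, mem_nonunits_iff]
        intro hu
        have h1 : π a • κ 1 = 0 := ha
        exact hκ.apply_one_ne_zero (((hu.map π).smul_eq_zero).1 h1)
    obtain ⟨j, hj⟩ := hι.injective_module.out i hi l
    refine ⟨j, ?_⟩
    have h1 := hj ((LinearMap.ker g).mkQ 1)
    have h2 : i ((LinearMap.ker g).mkQ 1) = κ 1 := one_smul A (κ 1)
    have h3 : l ((LinearMap.ker g).mkQ 1) = ι 1 := one_smul A (ι 1)
    rw [← h2, h1, h3]
  have hinj : Function.Injective j := by
    refine (injective_iff_map_eq_zero j).2 fun x hx => ?_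
    by_contra hne
    obtain ⟨b, hb⟩ := hκ.exists_smul_eq_one hne
    obtain ⟨a, rfl⟩ := hπ b
    apply hι.apply_one_ne_zero
    rw [← hj, ← hb, ← hF, map_smul, hx, smul_zero]
  refine ⟨j.toAddMonoidHom, fun a x => j.map_smul a x, hinj, ?_⟩
  let W : Submodule A E := Submodule.torsionBySet A E (RingHom.ker π : Set A)
  have hW : ∀ z, z ∈ W ↔ ∀ a ∈ RingHom.ker π, a • z = 0 := fun z => by
    simp [W, Submodule.mem_torsionBySet_iff]
  have htor : Module.IsTorsionBySet A W (RingHom.ker π : Set A) :=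
    Submodule.torsionBySet_isTorsionBySet _
  have hjW : ∀ x, j x ∈ W := fun x => (hW _).2 fun a ha => by
    rw [← map_smul, hF, (RingHom.mem_ker).1 ha, zero_smul, map_zero]
  let _ : Module (A ⧸ RingHom.ker π) W := htor.module
  let σ : B →+* A ⧸ RingHom.ker π := (RingHom.quotientKerEquivOfSurjective hπ).symm.toRingHom
  have hσ : ∀ a, σ (π a) = Ideal.Quotient.mk _ a := fun a =>
    (RingHom.quotientKerEquivOfSurjective hπ).symm_apply_apply (Ideal.Quotient.mk _ a)
  let _ : Module B W := Module.compHom W σ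
  have hBW : ∀ (a : A) (w : W), π a • w = a • w := fun a w => by
    change σ (π a) • w = a • w
    rw [hσ]
    rfl
  let j' : F →ₗ[B] W :=
    { toFun := fun x => ⟨j x, hjW x⟩
      map_add' := fun x y => Subtype.ext (j.map_add x y)
      map_smul' := fun b x => by
        obtain ⟨a, rfl⟩ := hπ b
        rw [RingHom.id_apply, hBW]
        exact Subtype.ext (j.map_smul a x) }
  -- Injectivity of `F` over `B` splits `F → Ann (ker π)`. A nonzero element of the kernel of the
  -- splitting would have `ι 1 = j (κ 1)` as a multiple, but the splitting sends that to `κ 1 ≠ 0`.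
  obtain ⟨ρ, hρ⟩ := hκ.injective_module.out j' (fun x y h => hinj (congrArg Subtype.val h))
    LinearMap.id
  apply Set.Subset.antisymm
  · rintro _ ⟨x, rfl⟩
    exact (hW _).1 (hjW x)
  · intro z hz
    refine ⟨ρ ⟨z, (hW z).2 hz⟩, ?_⟩
    by_contra hne
    have hz' : z - j (ρ ⟨z, (hW z).2 hz⟩) ≠ 0 := fun h => hne (sub_eq_zero.1 h).symm
    obtain ⟨a, ha⟩ := hι.exists_smul_eq_one hz'
    let w : W := ⟨z, (hW z).2 hz⟩
    have h1 : a • (w - j' (ρ w)) = j' (κ 1) := Subtype.ext (ha.trans hj.symm)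
    have h2 := congrArg ρ h1
    rw [hρ, ← hBW, map_smul, map_sub, hρ, LinearMap.id_apply, sub_self, smul_zero] at h2
    exact hκ.apply_one_ne_zero h2.symm

/-- Every Frobenius map on `E` is approximated by multiples of the powers of `ξ`, in a unique
way. -/
structure IsPrincipalFrobeniusMap (p : ℕ) {B E : Type*} [CommRing B] [IsLocalRing B]
    [AddCommGroup E] [Module B E] (ξ : frobeniusMaps p B E 1) : Prop where
  torsion : ∀ z : E, ∃ s, ∀ c ∈ maximalIdeal B ^ s, c • z = 0
  exists_eq : ∀ (e : ℕ) (φ : frobeniusMaps p B E e) (n : ℕ), ∃ b : B, ∀ z : E,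
    (∀ c ∈ maximalIdeal B ^ n, c • z = 0) → φ.1 z = b • (ξ.1 ^ e) z
  mem_of_eq_zero : ∀ e n : ℕ, ∃ s, ∀ b : B,
    (∀ z : E, (∀ c ∈ maximalIdeal B ^ s, c • z = 0) → b • (ξ.1 ^ e) z = 0) → b ∈ maximalIdeal B ^ n

/-- Because `u` multiplies `ker π` into its Frobenius power, `u θ` preserves `Ann (ker π)` and
descends to `F`. Existence and uniqueness of approximate coefficients then follow from the
classification over `A`, the indeterminacy by `ker π` disappearing in `B`. -/
theorem exists_isPrincipalFrobeniusMap {p : ℕ} [Fact p.Prime] {A B E F : Type u} [CommRing A]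
    [CommRing B] [IsLocalRing A] [IsLocalRing B] [IsNoetherianRing A] [ExpChar A p]
    (hA : (frobenius A p).Flat) {π : A →+* B} (hπ : Function.Surjective π)
    [AddCommGroup E] [Module A E] [AddCommGroup F] [Module B F] {ι : ResidueField A →ₗ[A] E}
    (hι : IsInjectiveHull ι) {Y : ℕ → Ideal A} {e : ℕ → E}
    {θ : frobeniusMaps p A E 1} (h : IsFrobeniusSystem p Y e θ) {u : A}
    (hu : IsFedderGenerator p (RingHom.ker π) u 1) {j : F →+ E}
    (hj : ∀ (a : A) (x : F), j (π a • x) = a • j x) (hinj : Function.Injective j)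
    (hrange : Set.range j = {z | ∀ a ∈ RingHom.ker π, a • z = 0}) :
    ∃ ξ : frobeniusMaps p B F 1, (∀ x, j (ξ.1 x) = u • θ.1 (j x)) ∧
      IsPrincipalFrobeniusMap p ξ := by
  have hmax : ∀ n, (maximalIdeal A ^ n).map π = maximalIdeal B ^ n := fun n => by
    rw [Ideal.map_pow, map_maximalIdeal_of_surjective hπ]
  have hker : ∀ x : F, ∀ a ∈ RingHom.ker π, a • j x = 0 := fun x a ha => by
    rw [← hj, (RingHom.mem_ker).1 ha, zero_smul, map_zero]
  have hmem : ∀ z : E, (∀ a ∈ RingHom.ker π, a • z = 0) → ∃ x, j x = z := fun z hz => by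
    have h1 : z ∈ Set.range j := hrange ▸ hz
    exact h1
  have htors : ∀ (n : ℕ) (x : F), (∀ c ∈ maximalIdeal B ^ n, c • x = 0) ↔
      ∀ a ∈ maximalIdeal A ^ n, a • j x = 0 := by
    intro n x
    constructor
    · intro hx a ha
      rw [← hj, hx _ (hmax n ▸ Ideal.mem_map_of_mem π ha), map_zero]
    · intro hx c hc
      rw [← hmax n, Ideal.mem_map_iff_of_surjective π hπ] at hc
      obtain ⟨a, ha, rfl⟩ := hc
      apply hinj
      rw [hj, hx a ha, map_zero]
  have hex : ∀ x : F, ∃ x', j x' = u • θ.1 (j x) := fun x => hmem _ fun a ha => by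
    have h1 := frobeniusPower_smul_pow_eq_zero θ 1 (hker x) _ (hu.mul_mem a ha)
    rwa [mul_smul, pow_one] at h1
  choose ξ₀ hξ₀ using hex
  let ξ : F →+ F := AddMonoidHom.mk' ξ₀ fun x y => hinj (by
    rw [map_add, hξ₀, hξ₀, hξ₀, map_add, map_add, smul_add])
  let ξ' : frobeniusMaps p B F 1 := ⟨ξ, fun b x => by
    obtain ⟨a, rfl⟩ := hπ b
    apply hinj
    change j (ξ₀ (π a • x)) = j (π a ^ p ^ 1 • ξ₀ x)
    rw [hξ₀, hj, θ.2, ← map_pow, hj, hξ₀, smul_comm]⟩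
  have hξ : ∀ x, j (ξ'.1 x) = u • θ.1 (j x) := hξ₀
  -- Moving `u` past successive copies of `θ` raises it to `p`-th powers, which is how the norm
  -- arises.
  have hξpow : ∀ (m : ℕ) (x : F), j ((ξ'.1 ^ m) x) = frobeniusNorm p u m • (θ.1 ^ m) (j x) := by
    intro m x
    induction m with
    | zero => simp [frobeniusNorm]
    | succ m ih =>
      rw [pow_succ' ξ'.1, pow_succ' θ.1]
      change j (ξ'.1 ((ξ'.1 ^ m) x)) = _ • θ.1 ((θ.1 ^ m) (j x))
      rw [hξ, ih, θ.2, ← mul_smul, pow_one]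
      rfl
  refine ⟨ξ', hξ, fun x => ?_, fun m φ n => ?_, fun m n => ?_⟩
  · obtain ⟨s, hs⟩ := hι.exists_pow_smul_eq_zero (j x)
    exact ⟨s, (htors s x).2 hs⟩
  · let N : Submodule A E := Submodule.torsionBySet A E (RingHom.ker π : Set A)
    have hN : ∀ z, z ∈ N ↔ ∀ a ∈ RingHom.ker π, a • z = 0 := fun z => by
      simp [N, Submodule.mem_torsionBySet_iff]
    choose i hi using fun z : N => hmem z ((hN z).1 z.2)
    have hij : ∀ x, i ⟨j x, (hN _).2 (hker x)⟩ = x := fun x => hinj (hi _)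
    have hiadd : ∀ z w, i (z + w) = i z + i w := fun z w => hinj (by
      rw [map_add, hi, hi, hi]
      rfl)
    have hismul : ∀ (a : A) z, i (a • z) = π a • i z := fun a z => hinj (by
      rw [hj, hi, hi]
      rfl)
    let φ' : N →+ E := AddMonoidHom.mk' (fun z => j (φ.1 (i z))) fun z w => by
      rw [hiadd, map_add, map_add]
    obtain ⟨b, hb⟩ := h.exists_eq_smul_pow hA hι (hu.frobeniusNorm hA m) N hN φ'
      (fun a z => by
        change j (φ.1 (i (a • z))) = a ^ p ^ m • j (φ.1 (i z))
        rw [hismul, φ.2, ← map_pow, hj]) (fun z => (hN _).2 (hker _)) n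
    refine ⟨π b, fun x hx => hinj ?_⟩
    have h1 := hb ⟨j x, (hN _).2 (hker x)⟩ ((htors n x).1 hx)
    have h2 : φ' ⟨j x, (hN _).2 (hker x)⟩ = j (φ.1 x) := by
      change j (φ.1 (i _)) = _
      rw [hij]
    rw [hj, hξpow, ← h2, h1]
  · obtain ⟨s, hs⟩ := h.exists_mem_sup_of_smul_pow_eq_zero hA hι (hu.frobeniusNorm hA m) n
    refine ⟨s, fun b hb => ?_⟩
    obtain ⟨a, rfl⟩ := hπ b
    have h1 := hs a fun z hz hzs => by
      obtain ⟨x, rfl⟩ := hmem z hz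
      rw [← hξpow, ← hj, hb x ((htors s x).2 hzs), map_zero]
    obtain ⟨c, hc, d, hd, rfl⟩ := Submodule.mem_sup.1 h1
    rw [map_add, (RingHom.mem_ker).1 hc, zero_add, ← hmax]
    exact Ideal.mem_map_of_mem π hd

end Transport

/-! ### Convergence of approximate coefficients in the completion -/

section Completion

open IsLocalRing AdicCompletion

variable {B E : Type u} [CommRing B] [IsLocalRing B] [AddCommGroup E] [Module B E]

theorem evalₐ_eq_mk_of_le {A : Type*} [CommRing A] (I : Ideal A) {l n : ℕ} (hln : l ≤ n)
    {b : AdicCompletion I A} {c : A} (h : evalₐ I n b = Ideal.Quotient.mk _ c) :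
    evalₐ I l b = Ideal.Quotient.mk _ c := by
  obtain ⟨r, rfl⟩ := AdicCompletion.mk_surjective I A b
  rw [evalₐ_mk] at h ⊢
  rw [← AdicCompletion.Ideal.mk_eq_mk I hln, Ideal.Quotient.eq]
  exact Ideal.pow_le_pow_right hln (Ideal.Quotient.eq.1 h)

/-- The completion of a local ring acts on every module whose elements are killed by powers of the
maximal ideal. -/
theorem exists_completion_action
    (hE : ∀ z : E, ∃ s, ∀ c ∈ maximalIdeal B ^ s, c • z = 0) :
    ∃ ρ : LocalCompletion B →+* AddMonoid.End E, ∀ (b : LocalCompletion B) (n : ℕ) (c : B) (z : E),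
      evalₐ (maximalIdeal B) n b = Ideal.Quotient.mk _ c →
      (∀ a ∈ maximalIdeal B ^ n, a • z = 0) → ρ b z = c • z := by
  choose s hs using hE
  have hrep : ∀ (b : LocalCompletion B) (n : ℕ), ∃ c : B,
      evalₐ (maximalIdeal B) n b = Ideal.Quotient.mk _ c := fun b n =>
    (Ideal.Quotient.mk_surjective _).imp fun _ h => h.symm
  choose r hr using hrep
  have key : ∀ (b : LocalCompletion B) (n : ℕ) (c : B) (z : E),
      evalₐ (maximalIdeal B) n b = Ideal.Quotient.mk _ c →
      (∀ a ∈ maximalIdeal B ^ n, a • z = 0) → r b (s z) • z = c • z := by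
    intro b n c z hc hz
    rw [← sub_eq_zero, ← sub_smul]
    rcases le_total (s z) n with h | h
    · exact hs z _ (Ideal.Quotient.eq.1 ((hr b _).symm.trans (evalₐ_eq_mk_of_le _ h hc)))
    · exact hz _ (Ideal.Quotient.eq.1 ((evalₐ_eq_mk_of_le _ h (hr b _)).symm.trans hc))
  let g : LocalCompletion B → AddMonoid.End E := fun b =>
    (AddMonoidHom.mk' (fun z => r b (s z) • z) fun z w => by
      obtain ⟨c, hc⟩ : ∃ c, evalₐ (maximalIdeal B) (max (s z) (s w)) b = Ideal.Quotient.mk _ c :=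
        ⟨_, hr _ _⟩
      have hz : ∀ a ∈ maximalIdeal B ^ max (s z) (s w), a • z = 0 := fun a ha =>
        hs z a (Ideal.pow_le_pow_right (le_max_left _ _) ha)
      have hw : ∀ a ∈ maximalIdeal B ^ max (s z) (s w), a • w = 0 := fun a ha =>
        hs w a (Ideal.pow_le_pow_right (le_max_right _ _) ha)
      rw [key b _ c z hc hz, key b _ c w hc hw, key b _ c (z + w) hc fun a ha => by
        rw [smul_add, hz a ha, hw a ha, add_zero], smul_add] : E →+ E)
  have hg : ∀ (b : LocalCompletion B) (n : ℕ) (c : B) (z : E),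
      evalₐ (maximalIdeal B) n b = Ideal.Quotient.mk _ c →
      (∀ a ∈ maximalIdeal B ^ n, a • z = 0) → g b z = c • z := key
  refine ⟨{ toFun := g, map_one' := ?_, map_mul' := ?_, map_zero' := ?_, map_add' := ?_ }, hg⟩
  · refine AddMonoidHom.ext fun z => ?_
    refine (hg 1 _ 1 z ?_ (hs z)).trans (one_smul B z)
    rw [map_one, map_one]
  · refine fun b b' => AddMonoidHom.ext fun z => ?_
    change g (b * b') z = g b (g b' z)
    rw [hg b' _ _ z (hr b' _) (hs z), hg b _ _ _ (hr b (s z)) fun a ha => by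
      rw [smul_comm, hs z a ha, smul_zero], ← mul_smul]
    refine hg _ _ _ _ ?_ (hs z)
    rw [map_mul, map_mul, hr, hr]
  · refine AddMonoidHom.ext fun z => ?_
    refine (hg 0 _ 0 z ?_ (hs z)).trans (zero_smul B z)
    rw [_root_.map_zero, _root_.map_zero]
  · refine fun b b' => AddMonoidHom.ext fun z => ?_
    change g (b + b') z = g b z + g b' z
    rw [hg b _ _ z (hr b _) (hs z), hg b' _ _ z (hr b' _) (hs z), ← add_smul]
    refine hg _ _ _ _ ?_ (hs z)
    rw [map_add, map_add, hr, hr]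

variable {p : ℕ} [IsNoetherianRing B] {ξ : frobeniusMaps p B E 1}

theorem exists_pow_smul_pow_frobeniusMap_eq_zero (ξ : frobeniusMaps p B E 1) (e n : ℕ) :
    ∃ N, ∀ z : E, (∀ c ∈ maximalIdeal B ^ n, c • z = 0) →
      ∀ c ∈ maximalIdeal B ^ N, c • (ξ.1 ^ e) z = 0 := by
  have h1 : maximalIdeal B ≤ (frobeniusPower p (maximalIdeal B ^ n) e).radical := fun c hc => by
    refine ⟨n * p ^ e, ?_⟩
    rw [pow_mul]
    exact pow_mem_frobeniusPower p (Ideal.pow_mem_pow hc n) e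
  obtain ⟨N, hN⟩ := Ideal.exists_pow_le_of_le_radical_of_fg h1 (IsNoetherian.noetherian _)
  exact ⟨N, fun z hz c hc => frobeniusPower_smul_pow_eq_zero ξ e hz c (hN hc)⟩

theorem IsPrincipalFrobeniusMap.eq_zero_of_smul_pow_eq_zero (hξ : IsPrincipalFrobeniusMap p ξ)
    {ρ : LocalCompletion B →+* AddMonoid.End E}
    (hρ : ∀ (b : LocalCompletion B) (n : ℕ) (c : B) (z : E),
      evalₐ (maximalIdeal B) n b = Ideal.Quotient.mk _ c →
      (∀ a ∈ maximalIdeal B ^ n, a • z = 0) → ρ b z = c • z) (e : ℕ) {b : LocalCompletion B}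
    (hb : ∀ z, ρ b ((ξ.1 ^ e) z) = 0) : b = 0 := by
  refine ext_evalₐ fun n => ?_
  obtain ⟨s, hs⟩ := hξ.mem_of_eq_zero e n
  obtain ⟨N, hN⟩ := exists_pow_smul_pow_frobeniusMap_eq_zero ξ e s
  obtain ⟨c, hc⟩ := Ideal.Quotient.mk_surjective (evalₐ (maximalIdeal B) (max n N) b)
  rw [evalₐ_eq_mk_of_le _ (le_max_left n N) hc.symm, _root_.map_zero, Ideal.Quotient.eq_zero_iff_mem]
  refine hs c fun z hz => ?_
  rw [← hρ b _ c _ hc.symm fun a ha => hN z hz a (Ideal.pow_le_pow_right (le_max_right _ _) ha)]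
  exact hb z

/-- The coefficients valid on successive torsion submodules agree modulo prescribed powers by
approximate uniqueness, hence form a Cauchy sequence. Its limit works everywhere because each
element is torsion. -/
theorem IsPrincipalFrobeniusMap.exists_eq_completion_smul_pow (hξ : IsPrincipalFrobeniusMap p ξ)
    {ρ : LocalCompletion B →+* AddMonoid.End E}
    (hρ : ∀ (b : LocalCompletion B) (n : ℕ) (c : B) (z : E),
      evalₐ (maximalIdeal B) n b = Ideal.Quotient.mk _ c →
      (∀ a ∈ maximalIdeal B ^ n, a • z = 0) → ρ b z = c • z) (e : ℕ)
    (φ : frobeniusMaps p B E e) : ∃ b : LocalCompletion B, ∀ z, φ.1 z = ρ b ((ξ.1 ^ e) z) := by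
  choose s hs using hξ.mem_of_eq_zero e
  choose b hb using hξ.exists_eq e φ
  -- The sum makes the indices increasing while dominating both `n` and `s n`.
  let S : ℕ → ℕ := fun n => n + ∑ i ∈ Finset.range (n + 1), s i
  have hS : ∀ n, n ≤ S n := fun n => Nat.le_add_right _ _
  have hsS : ∀ n, s n ≤ S n := fun n =>
    (Finset.single_le_sum (fun i _ => Nat.zero_le (s i)) (Finset.self_mem_range_succ n)).trans
      (Nat.le_add_left _ _)
  have hSmono : ∀ n, S n ≤ S (n + 1) := fun n => by
    change _ ≤ n + 1 + ∑ i ∈ Finset.range (n + 1 + 1), s i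
    rw [Finset.sum_range_succ _ (n + 1)]
    change n + _ ≤ _
    omega
  have hkill : ∀ {m n : ℕ} {z : E}, m ≤ n → (∀ c ∈ maximalIdeal B ^ m, c • z = 0) →
      ∀ c ∈ maximalIdeal B ^ n, c • z = 0 := fun h hz c hc =>
    hz c (Ideal.pow_le_pow_right h hc)
  let f : AdicCauchySequence (maximalIdeal B) B :=
    AdicCauchySequence.mk (maximalIdeal B) B (fun n => b (S n)) fun n => by
      rw [smul_eq_mul, Ideal.mul_top, SModEq.sub_mem]
      refine hs n _ fun z hz => ?_
      rw [sub_smul, sub_eq_zero, ← hb (S n) z (hkill (hsS n) hz),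
        ← hb (S (n + 1)) z (hkill ((hsS n).trans (hSmono n)) hz)]
  refine ⟨AdicCompletion.mk (maximalIdeal B) B f, fun z => ?_⟩
  obtain ⟨n, hn⟩ := hξ.torsion z
  obtain ⟨N, hN⟩ := exists_pow_smul_pow_frobeniusMap_eq_zero ξ e n
  rw [hρ _ (max n N) (b (S (max n N))) _ (evalₐ_mk _ _ _) (hkill (le_max_right _ _) (hN z hn))]
  exact hb _ z (hkill ((le_max_left _ _).trans (hS _)) hn)

end Completion

/-! ### The Frobenius algebra as a skew polynomial ring -/

section SkewIsomorphism

open IsLocalRing AdicCompletion DirectSum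

variable {p : ℕ} {B E : Type u} [CommRing B] [AddCommGroup E] [Module B E]
  {ξ : frobeniusMaps p B E 1}

theorem of_frobeniusMaps_congr {i j : ℕ} {a : frobeniusMaps p B E i} {b : frobeniusMaps p B E j}
    (hij : i = j) (hab : a.1 = b.1) :
    DirectSum.of (fun e => frobeniusMaps p B E e) i a = DirectSum.of _ j b := by
  subst hij
  rw [Subtype.ext hab]

theorem of_frobeniusMaps_pow (ξ : frobeniusMaps p B E 1) (i : ℕ)
    (h : ξ.1 ^ i ∈ frobeniusMaps p B E i) :
    DirectSum.of (fun e => frobeniusMaps p B E e) 1 ξ ^ i = DirectSum.of _ i ⟨ξ.1 ^ i, h⟩ := by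
  rw [DirectSum.ofPow]
  refine of_frobeniusMaps_congr (by simp) ?_
  simp

theorem pow_mem_frobeniusMaps (ξ : frobeniusMaps p B E 1) (i : ℕ) :
    ξ.1 ^ i ∈ frobeniusMaps p B E i := by
  have h := SetLike.pow_mem_graded (A := frobeniusMaps p B E) i ξ.2
  rwa [smul_eq_mul, mul_one] at h

variable [IsLocalRing B] [IsNoetherianRing B]

/-- The Frobenius algebra is the skew polynomial ring in a principal Frobenius map. -/
theorem IsPrincipalFrobeniusMap.exists_ringEquiv [Fact p.Prime] [CharP B p]
    (hξ : IsPrincipalFrobeniusMap p ξ) :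
    ∃ Φ : FrobeniusSkewPolynomial p (LocalCompletion B) ≃+* FrobeniusAlgebra p B E,
      (∀ b : LocalCompletion B, ∃ φ : frobeniusMaps p B E 0,
        Φ (FrobeniusSkewPolynomial.C p b) = DirectSum.of _ 0 φ) ∧
      (∀ b : B, Φ (FrobeniusSkewPolynomial.C p (algebraMap B (LocalCompletion B) b)) =
        DirectSum.of _ 0 (scalarMap p E b)) ∧
      Φ (FrobeniusSkewPolynomial.var p (LocalCompletion B)) = DirectSum.of _ 1 ξ := by
  obtain ⟨ρ, hρ⟩ := exists_completion_action hξ.torsion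
  have hρlin : ∀ (b : LocalCompletion B) (c : B) (z : E), ρ b (c • z) = c • ρ b z := by
    intro b c z
    obtain ⟨n, hn⟩ := hξ.torsion z
    obtain ⟨a, ha⟩ := Ideal.Quotient.mk_surjective (evalₐ (maximalIdeal B) n b)
    rw [hρ b n a z ha.symm hn, hρ b n a (c • z) ha.symm fun x hx => by
      rw [smul_comm, hn x hx, smul_zero], smul_comm]
  have hρalg : ∀ (b : B) (z : E), ρ (algebraMap B _ b) z = b • z := by
    intro b z
    obtain ⟨n, hn⟩ := hξ.torsion z
    exact hρ _ n b z (evalₐ_of _ n b) hn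
  -- This is the skew commutation rule with completed coefficients, which lets the lift respect
  -- multiplication.
  have hρpow : ∀ (b : LocalCompletion B) (i : ℕ) (z : E),
      ρ (b ^ p ^ i) ((ξ.1 ^ i) z) = (ξ.1 ^ i) (ρ b z) := by
    intro b i z
    obtain ⟨n, hn⟩ := hξ.torsion z
    obtain ⟨N, hN⟩ := exists_pow_smul_pow_frobeniusMap_eq_zero ξ i n
    obtain ⟨a, ha⟩ := Ideal.Quotient.mk_surjective (evalₐ (maximalIdeal B) (max n N) b)
    rw [hρ b (max n N) a z ha.symm fun c hc => hn c (Ideal.pow_le_pow_right (le_max_left _ _) hc),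
      pow_frobeniusMap_smul]
    refine hρ _ (max n N) _ _ ?_ fun c hc => hN z hn c (Ideal.pow_le_pow_right (le_max_right _ _) hc)
    rw [map_pow, ← ha, map_pow]
  let ρ₀ : LocalCompletion B → frobeniusMaps p B E 0 := fun b => ⟨ρ b, fun c z => by
    rw [hρlin, pow_zero, pow_one]⟩
  let f : LocalCompletion B →+* FrobeniusAlgebra p B E :=
    { toFun := fun b => DirectSum.of (fun e => frobeniusMaps p B E e) 0 (ρ₀ b)
      map_one' := of_frobeniusMaps_congr rfl (map_one ρ)
      map_mul' := fun b c => by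
        rw [DirectSum.of_mul_of]
        exact of_frobeniusMaps_congr rfl (map_mul ρ b c)
      map_zero' := by
        rw [← map_zero (DirectSum.of (fun e => frobeniusMaps p B E e) 0)]
        exact of_frobeniusMaps_congr rfl (_root_.map_zero ρ)
      map_add' := fun b c => by
        rw [← map_add]
        exact of_frobeniusMaps_congr rfl (map_add ρ b c) }
  let lev : ∀ i : ℕ, LocalCompletion B →+ frobeniusMaps p B E i := fun i =>
    AddMonoidHom.mk' (fun b => ⟨ρ b * ξ.1 ^ i, fun c z => by
      change ρ b ((ξ.1 ^ i) (c • z)) = c ^ p ^ i • ρ b ((ξ.1 ^ i) z)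
      rw [pow_frobeniusMap_smul, hρlin]⟩) fun b c => Subtype.ext (by
        change ρ (b + c) * ξ.1 ^ i = ρ b * ξ.1 ^ i + ρ c * ξ.1 ^ i
        rw [map_add, add_mul])
  have hlev : ∀ i b, f b * DirectSum.of (fun e => frobeniusMaps p B E e) 1 ξ ^ i =
      DirectSum.of (fun e => frobeniusMaps p B E e) i (lev i b) := fun i b => by
    rw [of_frobeniusMaps_pow ξ i (pow_mem_frobeniusMaps ξ i)]
    change DirectSum.of (fun e => frobeniusMaps p B E e) 0 (ρ₀ b) * _ = _
    rw [DirectSum.of_mul_of]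
    exact of_frobeniusMaps_congr (zero_add i) rfl
  have hlev_inj : ∀ i, Function.Injective (lev i) := fun i =>
    (injective_iff_map_eq_zero _).2 fun b hb => hξ.eq_zero_of_smul_pow_eq_zero hρ i fun z =>
      DFunLike.congr_fun (congrArg Subtype.val hb) z
  have hlev_surj : ∀ i, Function.Surjective (lev i) := fun i φ => by
    obtain ⟨b, hb⟩ := hξ.exists_eq_completion_smul_pow hρ i φ
    exact ⟨b, Subtype.ext (AddMonoidHom.ext fun z => (hb z).symm)⟩
  let _ := frobeniusAction p (LocalCompletion B)
  let Φ : SkewMonoidAlgebra (LocalCompletion B) (Multiplicative ℕ) →+* FrobeniusAlgebra p B E :=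
    SkewMonoidAlgebra.liftNCRingHom f
      (powersHom _ (DirectSum.of (fun e => frobeniusMaps p B E e) 1 ξ)) fun {b i} => by
        change f (b ^ p ^ i.toAdd) * DirectSum.of (fun e => frobeniusMaps p B E e) 1 ξ ^ i.toAdd =
          DirectSum.of (fun e => frobeniusMaps p B E e) 1 ξ ^ i.toAdd * f b
        rw [hlev, of_frobeniusMaps_pow ξ _ (pow_mem_frobeniusMaps ξ _)]
        change _ = _ * DirectSum.of (fun e => frobeniusMaps p B E e) 0 (ρ₀ b)
        rw [DirectSum.of_mul_of]
        refine of_frobeniusMaps_congr (add_zero _).symm (AddMonoidHom.ext fun z => ?_)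
        exact hρpow b i.toAdd z
  have hΦ : ∀ (i : Multiplicative ℕ) (b : LocalCompletion B), Φ (SkewMonoidAlgebra.single i b) =
      DirectSum.of (fun e => frobeniusMaps p B E e) i.toAdd (lev i.toAdd b) := fun i b =>
    (SkewMonoidAlgebra.liftNC_single (f : LocalCompletion B →+ FrobeniusAlgebra p B E) _ i b).trans
      (hlev i.toAdd b)
  -- `Φ` respects degrees, so its bijectivity reduces to that of each map `b ↦ b ξ^i`.
  have hcoeff : ∀ (i : ℕ) (P : SkewMonoidAlgebra (LocalCompletion B) (Multiplicative ℕ)),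
      Φ P i = lev i (P.coeff (Multiplicative.ofAdd i)) := by
    intro i P
    induction P using SkewMonoidAlgebra.induction_on with
    | zero => simp
    | single j b =>
      rw [hΦ, SkewMonoidAlgebra.coeff_single]
      by_cases hij : j.toAdd = i
      · subst hij
        have h1 : Finsupp.single j b (Multiplicative.ofAdd j.toAdd) = b := Finsupp.single_eq_same
        rw [h1]
        exact DirectSum.of_eq_same _ _
      · have h1 : Finsupp.single j b (Multiplicative.ofAdd i) = 0 :=
          Finsupp.single_eq_of_ne' fun h => hij (by rw [h]; rfl)
        rw [h1, _root_.map_zero]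
        exact DirectSum.of_eq_of_ne _ _ _ (Ne.symm hij)
    | add P Q hP hQ =>
      rw [map_add, DirectSum.add_apply, hP, hQ, SkewMonoidAlgebra.coeff_add, Finsupp.add_apply,
        map_add]
  have hbij : Function.Bijective Φ := by
    refine ⟨(injective_iff_map_eq_zero Φ).2 fun P hP => SkewMonoidAlgebra.ext fun i => ?_,
      fun x => ?_⟩
    · refine hlev_inj i.toAdd ?_
      have h1 := hcoeff i.toAdd P
      rw [hP] at h1
      exact h1.symm.trans (map_zero (lev i.toAdd)).symm
    · induction x using DirectSum.induction_on with
      | zero => exact ⟨0, map_zero Φ⟩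
      | of i φ =>
        obtain ⟨b, rfl⟩ := hlev_surj i φ
        exact ⟨SkewMonoidAlgebra.single (Multiplicative.ofAdd i) b, hΦ _ _⟩
      | add x y hx hy =>
        obtain ⟨P, rfl⟩ := hx
        obtain ⟨Q, rfl⟩ := hy
        exact ⟨P + Q, map_add Φ P Q⟩
  refine ⟨RingEquiv.ofBijective Φ hbij, fun b => ⟨lev 0 b, hΦ 1 b⟩, fun b => (hΦ 1 _).trans ?_,
    (hΦ (Multiplicative.ofAdd 1) 1).trans ?_⟩
  · refine of_frobeniusMaps_congr rfl (AddMonoidHom.ext fun z => ?_)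
    exact hρalg b z
  · refine of_frobeniusMaps_congr rfl (AddMonoidHom.ext fun z => ?_)
    change ρ 1 ((ξ.1 ^ 1) z) = ξ.1 z
    rw [map_one, pow_one]
    rfl

theorem IsPrincipalFrobeniusMap.generates (hξ : IsPrincipalFrobeniusMap p ξ) :
    GeneratesFrobeniusAlgebra p B E {DirectSum.of (fun e => frobeniusMaps p B E e) 1 ξ} := by
  obtain ⟨ρ, hρ⟩ := exists_completion_action hξ.torsion
  refine eq_top_iff.2 fun x _ => ?_
  induction x using DirectSum.induction_on with
  | zero => exact zero_mem _
  | of i φ =>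
    obtain ⟨b, hb⟩ := hξ.exists_eq_completion_smul_pow hρ i φ
    have hρlin : ρ b ∈ frobeniusMaps p B E 0 := fun c z => by
      obtain ⟨n, hn⟩ := hξ.torsion z
      obtain ⟨a, ha⟩ := Ideal.Quotient.mk_surjective (evalₐ (maximalIdeal B) n b)
      rw [hρ b n a z ha.symm hn, hρ b n a (c • z) ha.symm fun x hx => by
        rw [smul_comm, hn x hx, smul_zero], smul_comm, pow_zero, pow_one]
    have h1 : DirectSum.of (fun e => frobeniusMaps p B E e) i φ =
        DirectSum.of (fun e => frobeniusMaps p B E e) 0 ⟨ρ b, hρlin⟩ *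
          DirectSum.of (fun e => frobeniusMaps p B E e) 1 ξ ^ i := by
      rw [of_frobeniusMaps_pow ξ i (pow_mem_frobeniusMaps ξ i), DirectSum.of_mul_of]
      exact of_frobeniusMaps_congr (zero_add i).symm (AddMonoidHom.ext hb)
    rw [h1]
    refine mul_mem (Subring.subset_closure (Or.inl ⟨_, rfl⟩)) (pow_mem ?_ i)
    exact Subring.subset_closure (Or.inr rfl)
  | add x y hx hy => exact add_mem (hx trivial) (hy trivial)

end SkewIsomorphism

/-! ### The local form of Fedder's criterion -/

section LocalTheorem

open IsLocalRing

variable {p : ℕ} [Fact p.Prime] {A B : Type u} [CommRing A] [IsLocalRing A] [IsNoetherianRing A]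
  [CommRing B] [IsLocalRing B] [CharP A p]

theorem isFedderGenerator_bot_one {A : Type*} [CommRing A] [CharP A p] :
    IsFedderGenerator p (⊥ : Ideal A) 1 1 where
  colon_le := by simp
  mem_of_mul_mem a ha := frobeniusPower_le_self p ⊥ 1 (by simpa using ha)
  mul_mem a ha := by
    rw [Ideal.mem_bot.1 ha, zero_mul]
    exact zero_mem _

theorem isPrincipalSkewPolynomial_and_fg [CharP B p] (hA : (frobenius A p).Flat) {π : A →+* B}
    (hπ : Function.Surjective π) {u : A} (hu : IsFedderGenerator p (RingHom.ker π) u 1) :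
    IsPrincipalSkewPolynomial p A B π u ∧ FrobeniusAlgebraFG p B (ResidueHull B) := by
  have hι := InjectiveHull.isInjectiveHull A (ResidueField A)
  have hκ := InjectiveHull.isInjectiveHull B (ResidueField B)
  have : IsNoetherianRing B := isNoetherianRing_of_surjective A B π hπ
  obtain ⟨Y, e, θ, h⟩ := exists_frobeniusSystem p hA hι
  obtain ⟨j, hj, hinj, hrange⟩ := exists_hull_embedding hπ hι hκ
  obtain ⟨ξ, hξ, hξp⟩ := exists_isPrincipalFrobeniusMap hA hπ hι h hu hj hinj hrange
  obtain ⟨Φ, hC, hC', hX⟩ := hξp.exists_ringEquiv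
  have hθ : IsPrincipalFrobeniusMap p θ := by
    have hbot : RingHom.ker (RingHom.id A) = ⊥ :=
      (RingHom.injective_iff_ker_eq_bot _).1 Function.injective_id
    -- That `θ` itself generates is the case of the zero ideal with `u = 1`.
    obtain ⟨θ', hθ', h'⟩ := exists_isPrincipalFrobeniusMap hA (π := RingHom.id A)
      Function.surjective_id hι h (u := 1) (hbot ▸ isFedderGenerator_bot_one)
      (j := AddMonoidHom.id (ResidueHull A)) (fun _ _ => rfl) Function.injective_id (by
        rw [hbot]
        ext z
        simp)
    have h1 : θ' = θ := Subtype.ext (AddMonoidHom.ext fun z => (hθ' z).trans (one_smul A _))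
    exact h1 ▸ h'
  refine ⟨⟨θ, j, ξ, Φ, hθ.generates, hj, hinj, hrange, hξ, hC, hC', hX⟩, {DirectSum.of _ 1 ξ}, ?_⟩
  rw [Finset.coe_singleton]
  exact hξp.generates

end LocalTheorem

/-! ### Monomial ideals and colons in terms of exponents -/

section MonomialIdealMembership

open MvPowerSeries

variable {k : Type u} [Field k] {n : ℕ}

theorem exists_minimal_le_of_exponent {D : Set (Fin n →₀ ℕ)} {d : Fin n →₀ ℕ} (hd : d ∈ D) :
    ∃ c ≤ d, Minimal (fun x => x ∈ D) c :=
  exists_minimal_le_of_wellFoundedLT _ d hd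

/-- Dickson's lemma: the minimal exponents form an antichain in a well-quasi-order and so are finite
in number, which permits division of power series. -/
theorem mem_span_monomial_minimal {D : Set (Fin n →₀ ℕ)} {f : MvPowerSeries (Fin n) k}
    (hf : ∀ d, coeff d f ≠ 0 → ∃ g ∈ D, g ≤ d) :
    f ∈ Ideal.span ((fun g => (monomial g (1 : k) : MvPowerSeries (Fin n) k)) ''
      {c | Minimal (fun x => x ∈ D) c}) := by
  have hwqo : WellQuasiOrdered (fun a b : Fin n →₀ ℕ => a ≤ b) := wellQuasiOrdered_le
  refine mem_span_monomial_of_finite ((setOfPred_minimal_antichain _).finite_of_wellQuasiOrdered hwqo)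
    f fun d hd => ?_
  obtain ⟨g, hg, hgd⟩ := hf d hd
  obtain ⟨c, hcg, hc⟩ := exists_minimal_le_of_exponent hg
  exact ⟨c, hc, hcg.trans hgd⟩

theorem mem_span_monomial_iff {D : Set (Fin n →₀ ℕ)} {f : MvPowerSeries (Fin n) k} :
    f ∈ Ideal.span ((fun g => (monomial g (1 : k) : MvPowerSeries (Fin n) k)) '' D) ↔
      ∀ d, coeff d f ≠ 0 → ∃ g ∈ D, g ≤ d := by
  classical
  constructor
  · intro hf
    induction hf using Submodule.span_induction with
    | mem x hx =>
      obtain ⟨g, hg, rfl⟩ := hx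
      intro d hd
      rcases eq_or_ne d g with rfl | h
      · exact ⟨d, hg, le_rfl⟩
      · exact absurd (coeff_monomial_ne h 1) hd
    | zero => simp
    | add x y _ _ hx hy =>
      intro d hd
      by_cases h : coeff d x = 0
      · exact hy d fun h' => hd (by rw [map_add, h, h', add_zero])
      · exact hx d h
    | smul a x _ hx =>
      intro d hd
      rw [smul_eq_mul, coeff_mul] at hd
      obtain ⟨ij, hij, hne⟩ := Finset.exists_ne_zero_of_sum_ne_zero hd
      obtain ⟨g, hg, hle⟩ := hx ij.2 (right_ne_zero_of_mul hne)
      refine ⟨g, hg, hle.trans ?_⟩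
      rw [← Finset.HasAntidiagonal.mem_antidiagonal.1 hij]
      exact le_add_self
  · exact fun hf => Ideal.span_mono (Set.image_mono fun c hc => hc.prop)
      (mem_span_monomial_minimal hf)

theorem monomial_mem_span_monomial_iff {D : Set (Fin n →₀ ℕ)} {d : Fin n →₀ ℕ} :
    (monomial d (1 : k) : MvPowerSeries (Fin n) k) ∈
      Ideal.span ((fun g => (monomial g (1 : k) : MvPowerSeries (Fin n) k)) '' D) ↔
      ∃ g ∈ D, g ≤ d := by
  rw [mem_span_monomial_iff]
  refine ⟨fun h => h d (by rw [coeff_monomial_same]; exact one_ne_zero), fun h c hc => ?_⟩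
  rcases eq_or_ne c d with rfl | hcd
  · exact h
  · exact absurd (coeff_monomial_ne hcd 1) hc

theorem mul_monomial_mem_span_monomial_iff {D : Set (Fin n →₀ ℕ)} {f : MvPowerSeries (Fin n) k}
    {m : Fin n →₀ ℕ} :
    f * monomial m (1 : k) ∈
      Ideal.span ((fun g => (monomial g (1 : k) : MvPowerSeries (Fin n) k)) '' D) ↔
      ∀ d, coeff d f ≠ 0 → ∃ g ∈ D, g ≤ d + m := by
  rw [mem_span_monomial_iff]
  constructor
  · intro h d hd
    exact h _ (by rwa [coeff_add_mul_monomial, mul_one])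
  · intro h d hd
    rw [coeff_mul_monomial] at hd
    split_ifs at hd with hmd
    · obtain ⟨g, hg, hle⟩ := h (d - m) (by simpa using hd)
      exact ⟨g, hg, hle.trans (tsub_add_cancel_of_le hmd).le⟩
    · exact absurd rfl hd

/-- The exponent which is `c` on `s` and `0` elsewhere. -/
noncomputable def constExponent (s : Finset (Fin n)) (c : ℕ) : Fin n →₀ ℕ :=
  Finsupp.indicator s fun _ _ => c

theorem constExponent_apply_of_mem {s : Finset (Fin n)} {i : Fin n} (hi : i ∈ s) (c : ℕ) :
    constExponent s c i = c := Finsupp.indicator_of_mem hi _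

theorem constExponent_apply_of_notMem {s : Finset (Fin n)} {i : Fin n} (hi : i ∉ s) (c : ℕ) :
    constExponent s c i = 0 := Finsupp.indicator_of_notMem hi _

theorem constExponent_le_iff {s : Finset (Fin n)} {c : ℕ} {d : Fin n →₀ ℕ} :
    constExponent s c ≤ d ↔ ∀ i ∈ s, c ≤ d i := by
  constructor
  · intro h i hi
    exact (constExponent_apply_of_mem hi c).symm.le.trans (h i)
  · intro h i
    by_cases hi : i ∈ s
    · exact (constExponent_apply_of_mem hi c).le.trans (h i hi)
    · exact (constExponent_apply_of_notMem hi c).le.trans (Nat.zero_le _)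

theorem prod_X_pow_eq_monomial (s : Finset (Fin n)) (c : ℕ) :
    (∏ i ∈ s, (X i : MvPowerSeries (Fin n) k)) ^ c = monomial (constExponent s c) 1 := by
  classical
  rw [← Finset.prod_pow]
  simp_rw [X_pow_eq]
  induction s using Finset.induction_on with
  | empty =>
    rw [Finset.prod_empty, ← monomial_zero_one]
    congr 2
  | insert a s ha ih =>
    rw [Finset.prod_insert ha, ih, monomial_mul_monomial, one_mul]
    congr 2
    ext i
    rw [Finsupp.add_apply]
    by_cases hia : i = a
    · subst hia
      rw [Finsupp.single_eq_same, constExponent_apply_of_notMem ha,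
        constExponent_apply_of_mem (Finset.mem_insert_self _ _), add_zero]
    · rw [Finsupp.single_eq_of_ne hia, zero_add]
      by_cases his : i ∈ s
      · rw [constExponent_apply_of_mem his, constExponent_apply_of_mem (Finset.mem_insert_of_mem his)]
      · rw [constExponent_apply_of_notMem his, constExponent_apply_of_notMem (by simp [hia, his])]

/-- The ideal generated by the square-free monomials with supports in `G`. -/
noncomputable def squarefreeIdeal (k : Type u) [Field k] (G : Set (Finset (Fin n))) :
    Ideal (MvPowerSeries (Fin n) k) :=
  Ideal.span ((fun s : Finset (Fin n) => ∏ i ∈ s, (X i : MvPowerSeries (Fin n) k)) '' G)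

variable {G : Set (Finset (Fin n))}

theorem squarefreeIdeal_eq_span_monomial :
    squarefreeIdeal k G = Ideal.span ((fun g => (monomial g (1 : k) : MvPowerSeries (Fin n) k)) ''
      ((fun s => constExponent s 1) '' G)) := by
  rw [squarefreeIdeal, Set.image_image]
  simp_rw [← prod_X_pow_eq_monomial, pow_one]

theorem frobeniusPower_squarefreeIdeal (p : ℕ) [ExpChar (MvPowerSeries (Fin n) k) p] :
    frobeniusPower p (squarefreeIdeal k G) 1 =
      Ideal.span ((fun g => (monomial g (1 : k) : MvPowerSeries (Fin n) k)) ''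
        ((fun s => constExponent s p) '' G)) := by
  rw [squarefreeIdeal, frobeniusPower_span, Set.image_image, Set.image_image]
  simp_rw [← prod_X_pow_eq_monomial, pow_one]

variable {p : ℕ} [ExpChar (MvPowerSeries (Fin n) k) p]

theorem mem_colon_squarefreeIdeal_iff {f : MvPowerSeries (Fin n) k} :
    f ∈ (frobeniusPower p (squarefreeIdeal k G) 1).colon
        (squarefreeIdeal k G : Set (MvPowerSeries (Fin n) k)) ↔
      ∀ d, coeff d f ≠ 0 → ∀ s ∈ G, ∃ t ∈ G, constExponent t p ≤ d + constExponent s 1 := by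
  have h1 : f ∈ (frobeniusPower p (squarefreeIdeal k G) 1).colon
        (squarefreeIdeal k G : Set (MvPowerSeries (Fin n) k)) ↔
      ∀ s ∈ G, f * monomial (constExponent s 1) (1 : k) ∈
        frobeniusPower p (squarefreeIdeal k G) 1 := by
    rw [squarefreeIdeal_eq_span_monomial, Ideal.span, Submodule.colon_span, ← Ideal.span,
      Submodule.mem_colon]
    simp
  rw [h1, frobeniusPower_squarefreeIdeal]
  simp_rw [mul_monomial_mem_span_monomial_iff, Set.exists_mem_image]
  exact ⟨fun h d hd s hs => h s hs d hd, fun h s hs d hd => h d hd s hs⟩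

theorem colon_squarefreeIdeal_le_span_monomial :
    (frobeniusPower p (squarefreeIdeal k G) 1).colon
        (squarefreeIdeal k G : Set (MvPowerSeries (Fin n) k)) ≤
      Ideal.span ((fun g => (monomial g (1 : k) : MvPowerSeries (Fin n) k)) ''
        minimalExponents ((frobeniusPower p (squarefreeIdeal k G) 1).colon
          (squarefreeIdeal k G : Set (MvPowerSeries (Fin n) k)))) := by
  intro f hf
  rw [mem_colon_squarefreeIdeal_iff] at hf
  refine mem_span_monomial_minimal (D := {d | (monomial d (1 : k) : MvPowerSeries (Fin n) k) ∈
    (frobeniusPower p (squarefreeIdeal k G) 1).colon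
      (squarefreeIdeal k G : Set (MvPowerSeries (Fin n) k))}) fun d hd => ⟨d, ?_, le_rfl⟩
  refine mem_colon_squarefreeIdeal_iff.2 fun c hc => ?_
  rcases eq_or_ne c d with rfl | hcd
  · exact hf c hd
  · exact absurd (coeff_monomial_ne hcd 1) hc

/-- Multiplication by `x_b^(p-1)` raises each exponent by at most `p - 1`, so divisibility by the
`p`-th power of a variable afterwards forces divisibility by that variable before. This holds for
every `b`. -/
theorem mem_squarefreeIdeal_of_mul_mem (hp : 0 < p) {b : Finset (Fin n)}
    {f : MvPowerSeries (Fin n) k}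
    (hf : f * (∏ i ∈ b, X i) ^ (p - 1) ∈ frobeniusPower p (squarefreeIdeal k G) 1) :
    f ∈ squarefreeIdeal k G := by
  rw [frobeniusPower_squarefreeIdeal, prod_X_pow_eq_monomial,
    mul_monomial_mem_span_monomial_iff] at hf
  rw [squarefreeIdeal_eq_span_monomial, mem_span_monomial_iff]
  intro d hd
  obtain ⟨_, ⟨t, ht, rfl⟩, hle⟩ := hf d hd
  refine ⟨_, ⟨t, ht, rfl⟩, constExponent_le_iff.2 fun i hi => ?_⟩
  have h1 : p ≤ d i + constExponent b (p - 1) i := constExponent_le_iff.1 hle i hi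
  by_cases hib : i ∈ b
  · rw [constExponent_apply_of_mem hib] at h1
    omega
  · rw [constExponent_apply_of_notMem hib] at h1
    omega

/-- For `t ⊆ s ∩ b`, each variable of `t` has exponent `1 + (p - 1)` in `x_s x_b^(p-1)`, so `x_t^p`
divides this product. -/
theorem prod_X_pow_mul_mem {b : Finset (Fin n)} (hb : ∀ s ∈ G, ∃ t ∈ G, t ⊆ s ∧ t ⊆ b) :
    squarefreeIdeal k G ≤ (frobeniusPower p (squarefreeIdeal k G) 1).colon
      {((∏ i ∈ b, X i) ^ (p - 1) : MvPowerSeries (Fin n) k)} := by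
  refine Ideal.span_le.2 ?_
  rintro _ ⟨s, hs, rfl⟩
  obtain ⟨t, ht, hts, htb⟩ := hb s hs
  refine Submodule.mem_colon_singleton.2 ?_
  rw [smul_eq_mul, frobeniusPower_squarefreeIdeal, prod_X_pow_eq_monomial]
  change (∏ i ∈ s, X i) * _ ∈ _
  rw [← pow_one (∏ i ∈ s, X i), prod_X_pow_eq_monomial, monomial_mul_monomial, one_mul,
    monomial_mem_span_monomial_iff]
  refine ⟨_, ⟨t, ht, rfl⟩, constExponent_le_iff.2 fun i hi => ?_⟩
  rw [Finsupp.add_apply, constExponent_apply_of_mem (hts hi), constExponent_apply_of_mem (htb hi)]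
  omega

/-- If no exponent on `V` reaches `p`, multiplying by `x_i` can enter the Frobenius power only
through `x_i^p`, so the exponent of `x_i` is at least `p - 1`. -/
theorem colon_variables_le (hp : 0 < p) (V : Finset (Fin n)) :
    (frobeniusPower p (squarefreeIdeal k {s | ∃ i ∈ V, s = {i}}) 1).colon
        (squarefreeIdeal k {s | ∃ i ∈ V, s = {i}} : Set (MvPowerSeries (Fin n) k)) ≤
      frobeniusPower p (squarefreeIdeal k {s | ∃ i ∈ V, s = {i}}) 1 ⊔
        Ideal.span {(∏ i ∈ V, X i) ^ (p - 1)} := by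
  intro f hf
  rw [mem_colon_squarefreeIdeal_iff] at hf
  rw [frobeniusPower_squarefreeIdeal, prod_X_pow_eq_monomial, ← Ideal.span_union,
    ← Set.image_singleton (f := fun g => (monomial g (1 : k) : MvPowerSeries (Fin n) k)),
    ← Set.image_union, mem_span_monomial_iff]
  intro d hd
  by_cases h : ∃ i ∈ V, p ≤ d i
  · obtain ⟨i, hi, hle⟩ := h
    refine ⟨constExponent {i} p, Or.inl ⟨{i}, ⟨i, hi, rfl⟩, rfl⟩, constExponent_le_iff.2 ?_⟩
    simpa using hle
  · push Not at h
    refine ⟨_, Or.inr rfl, constExponent_le_iff.2 fun i hi => ?_⟩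
    obtain ⟨_, ⟨j, hj, rfl⟩, hle⟩ := hf d hd {i} ⟨i, hi, rfl⟩
    have h1 : p ≤ d j + constExponent {i} 1 j :=
      constExponent_le_iff.1 hle j (Finset.mem_singleton_self j)
    have h2 := h j hj
    by_cases hij : j = i
    · subst hij
      rw [constExponent_apply_of_mem (Finset.mem_singleton_self j)] at h1
      omega
    · rw [constExponent_apply_of_notMem (by simpa using hij)] at h1
      omega

end MonomialIdealMembership

/-! ### Primes generated by variables -/

section VariablePrimes

open MvPowerSeries

variable {k : Type u} [Field k] {n : ℕ}

open Classical in
/-- Setting the variables in `V` to zero. -/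
noncomputable def killVariables (k : Type u) [Field k] (V : Finset (Fin n)) :
    MvPowerSeries (Fin n) k →+* MvPowerSeries (Fin n) k where
  toFun f := fun d => if ∀ i ∈ V, d i = 0 then coeff d f else 0
  map_one' := by
    ext d
    change (if ∀ i ∈ V, d i = 0 then coeff d 1 else 0) = coeff d 1
    split_ifs with h
    · rfl
    · rw [coeff_one, if_neg]
      rintro rfl
      exact h fun _ _ => rfl
  map_mul' f g := by
    ext d
    refine Eq.trans ?_ (coeff_mul _ _ _).symm
    change (if ∀ i ∈ V, d i = 0 then coeff d (f * g) else 0) =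
      ∑ x ∈ Finset.HasAntidiagonal.antidiagonal d,
        (if ∀ i ∈ V, x.1 i = 0 then coeff x.1 f else 0) *
          (if ∀ i ∈ V, x.2 i = 0 then coeff x.2 g else 0)
    have hsum : ∀ x ∈ Finset.HasAntidiagonal.antidiagonal d, ∀ i, x.1 i + x.2 i = d i :=
      fun x hx i => DFunLike.congr_fun (Finset.HasAntidiagonal.mem_antidiagonal.1 hx) i
    split_ifs with h
    · rw [coeff_mul]
      refine Finset.sum_congr rfl fun x hx => ?_
      rw [if_pos fun i hi => ?_, if_pos fun i hi => ?_]
      · have := hsum x hx i; have := h i hi; omega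
      · have := hsum x hx i; have := h i hi; omega
    · refine (Finset.sum_eq_zero fun x hx => ?_).symm
      by_contra hne
      have h1 : ∀ i ∈ V, x.1 i = 0 := by
        by_contra hcon
        exact hne (by rw [if_neg hcon, zero_mul])
      have h2 : ∀ i ∈ V, x.2 i = 0 := by
        by_contra hcon
        exact hne (by rw [if_neg hcon, mul_zero])
      exact h fun i hi => by rw [← hsum x hx i, h1 i hi, h2 i hi]
  map_zero' := by
    ext d
    change (if ∀ i ∈ V, d i = 0 then coeff d 0 else 0) = coeff d 0
    simp
  map_add' f g := by
    ext d
    change (if ∀ i ∈ V, d i = 0 then coeff d (f + g) else 0) =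
      (if ∀ i ∈ V, d i = 0 then coeff d f else 0) + (if ∀ i ∈ V, d i = 0 then coeff d g else 0)
    split_ifs <;> simp

theorem killVariables_X_of_mem {V : Finset (Fin n)} {i : Fin n} (hi : i ∈ V) :
    killVariables k V (X i) = 0 := by
  classical
  ext d
  change (if ∀ i ∈ V, d i = 0 then coeff d (X i : MvPowerSeries (Fin n) k) else 0) = 0
  split_ifs with h
  · rw [coeff_X, if_neg]
    rintro rfl
    have := h i hi
    simp at this
  · rfl

theorem killVariables_X_of_notMem {V : Finset (Fin n)} {i : Fin n} (hi : i ∉ V) :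
    killVariables k V (X i) = X i := by
  classical
  ext d
  change (if ∀ i ∈ V, d i = 0 then coeff d (X i : MvPowerSeries (Fin n) k) else 0) = coeff d (X i)
  split_ifs with h
  · rfl
  · rw [coeff_X, if_neg]
    rintro rfl
    exact h fun j hj => Finsupp.single_eq_of_ne fun h => hi (h ▸ hj)

theorem killVariables_X_eq_zero_iff {V : Finset (Fin n)} {i : Fin n} :
    killVariables k V (X i) = 0 ↔ i ∈ V := by
  refine ⟨fun h => ?_, killVariables_X_of_mem⟩
  by_contra hi
  rw [killVariables_X_of_notMem hi] at h
  have h1 := congrArg (coeff (Finsupp.single i 1)) h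
  rw [coeff_index_single_self_X, map_zero] at h1
  exact one_ne_zero h1

theorem squarefreeIdeal_le_ker_killVariables {G : Set (Finset (Fin n))} {V : Finset (Fin n)}
    (hV : ∀ s ∈ G, ∃ i ∈ s, i ∈ V) :
    squarefreeIdeal k G ≤ RingHom.ker (killVariables k V) := by
  refine Ideal.span_le.2 ?_
  rintro _ ⟨s, hs, rfl⟩
  obtain ⟨i, his, hiV⟩ := hV s hs
  change killVariables k V (∏ i ∈ s, X i) = 0
  rw [map_prod]
  exact Finset.prod_eq_zero his (killVariables_X_of_mem hiV)

/-- This is the only property of `x^β` that is needed: it involves every variable of every minimal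
generator. A minimal prime below the prime killing `i` and all variables outside `s` must contain a
variable of `s`, and only `i` is available. -/
theorem X_mem_sSup_minimalPrimes {G : Set (Finset (Fin n))} {s : Finset (Fin n)}
    (hs : Minimal (fun t => t ∈ G) s) {i : Fin n} (hi : i ∈ s) :
    (X i : MvPowerSeries (Fin n) k) ∈ sSup (squarefreeIdeal k G).minimalPrimes := by
  classical
  -- A generator missing `i` and the complement of `s` would be properly contained in `s`, against
  -- minimality.
  have hle : squarefreeIdeal k G ≤ RingHom.ker (killVariables k (insert i sᶜ)) := by
    refine squarefreeIdeal_le_ker_killVariables fun t ht => ?_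
    by_contra! hcon
    have hts : t ⊆ s := fun j hj => by
      by_contra hjs
      exact hcon j hj (by simp [hjs])
    exact hcon i (hs.le_of_le ht hts hi) (Finset.mem_insert_self _ _)
  have hprime : (RingHom.ker (killVariables k (insert i sᶜ))).IsPrime :=
    have : IsDomain (MvPowerSeries (Fin n) k) := NoZeroDivisors.to_isDomain _
    RingHom.ker_isPrime _
  obtain ⟨P, hP, hPle⟩ := Ideal.exists_minimalPrimes_le hle
  have h1 : ∏ j ∈ s, (X j : MvPowerSeries (Fin n) k) ∈ P :=
    hP.1.2 (Ideal.subset_span ⟨s, hs.prop, rfl⟩)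
  have := hP.1.1
  obtain ⟨j, hj, hjP⟩ := (Ideal.IsPrime.prod_mem_iff (p := P)).1 h1
  have h2 := killVariables_X_eq_zero_iff.1 (hPle hjP)
  have h3 : j = i := by simpa [hj] using h2
  exact (le_sSup hP : P ≤ _) (h3 ▸ hjP)

end VariablePrimes

/-! ### Colon conditions after localization -/

section LocalizedGenerator

theorem map_frobeniusPower {R R' : Type*} [CommRing R] [CommRing R'] {p : ℕ} [ExpChar R p]
    [ExpChar R' p] (f : R →+* R') (I : Ideal R) (e : ℕ) :
    (frobeniusPower p I e).map f = frobeniusPower p (I.map f) e := by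
  rw [frobeniusPower, Ideal.map_span, Ideal.map, frobeniusPower_span, Set.image_image,
    Set.image_image]
  simp_rw [map_pow]

/-- A generator of `(I^[p] : I)` modulo `I^[p]` up to an ideal which vanishes modulo `I^[p]` after
a flat base change gives a generator after base change. -/
theorem isFedderGenerator_map_of_flat {R R' : Type*} [CommRing R] [IsNoetherianRing R] [CommRing R']
    {p : ℕ} [ExpChar R p] [ExpChar R' p] {f : R →+* R'} (hf : f.Flat) {I J : Ideal R} {u r : R}
    (hcolon : (frobeniusPower p I 1).colon (I : Set R) ≤ frobeniusPower p I 1 ⊔ J ⊔ Ideal.span {u})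
    (hr : IsUnit (f r)) (hJ : ∀ x ∈ J, r * x ∈ frobeniusPower p I 1)
    (hu : (frobeniusPower p I 1).colon {u} ≤ I) (hIu : I ≤ (frobeniusPower p I 1).colon {u}) :
    IsFedderGenerator p (I.map f) (f u) 1 := by
  have hfg : ∀ L : Ideal R, L.FG := IsNoetherian.noetherian
  have hcol : (frobeniusPower p (I.map f) 1).colon {f u} =
      ((frobeniusPower p I 1).colon {u}).map f := by
    have h1 := map_colon_of_flat hf (hfg (frobeniusPower p I 1)) (hfg (Ideal.span {u}))
    rw [Ideal.map_span, Set.image_singleton, map_frobeniusPower] at h1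
    rwa [Ideal.span, Ideal.span, Submodule.colon_span, Submodule.colon_span] at h1
  refine ⟨?_, fun a ha => ?_, fun a ha => ?_⟩
  · have hJ' : J.map f ≤ (frobeniusPower p I 1).map f := by
      refine Ideal.map_le_iff_le_comap.2 fun x hx => ?_
      have h1 := Ideal.mem_map_of_mem f (hJ x hx)
      rw [map_mul] at h1
      exact (Ideal.unit_mul_mem_iff_mem _ hr).1 h1
    rw [← map_frobeniusPower, map_colon_of_flat hf (hfg _) (hfg _)]
    refine (Ideal.map_mono hcolon).trans ?_
    rw [Ideal.map_sup, Ideal.map_sup, Ideal.map_span, Set.image_singleton, sup_eq_left.2 hJ']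
  · have h1 : a ∈ (frobeniusPower p (I.map f) 1).colon {f u} := Submodule.mem_colon_singleton.2 ha
    rw [hcol] at h1
    exact Ideal.map_mono hu h1
  · have h1 := Ideal.map_mono (f := f) hIu ha
    rw [← hcol] at h1
    exact Submodule.mem_colon_singleton.1 h1

variable {R : Type u} [CommRing R] (I : Ideal R) (Q : PrimeSpectrum (R ⧸ I))

theorem map_primeCompl_comap_mk :
    Submonoid.map (Ideal.Quotient.mk I) (Q.asIdeal.comap (Ideal.Quotient.mk I)).primeCompl =
      Q.asIdeal.primeCompl := by
  ext x
  constructor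
  · rintro ⟨y, hy, rfl⟩
    exact hy
  · intro hx
    obtain ⟨y, rfl⟩ := Ideal.Quotient.mk_surjective x
    exact ⟨y, hx, rfl⟩

theorem ker_stalkMap : RingHom.ker (stalkMap I Q) =
    I.map (algebraMap R (Localization.AtPrime (Q.asIdeal.comap (Ideal.Quotient.mk I)))) := by
  have h := IsLocalization.ker_map
    (S := Localization.AtPrime (Q.asIdeal.comap (Ideal.Quotient.mk I)))
    (Localization.AtPrime Q.asIdeal) (Ideal.Quotient.mk I) (map_primeCompl_comap_mk I Q)
  rw [Ideal.mk_ker] at h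
  exact h

theorem stalkMap_surjective : Function.Surjective (stalkMap I Q) := by
  intro x
  obtain ⟨a, s, rfl⟩ := IsLocalization.exists_mk'_eq Q.asIdeal.primeCompl x
  obtain ⟨b, rfl⟩ := Ideal.Quotient.mk_surjective a
  obtain ⟨s, hs⟩ := s
  obtain ⟨t, rfl⟩ := Ideal.Quotient.mk_surjective s
  exact ⟨IsLocalization.mk' _ b ⟨t, hs⟩, Localization.localRingHom_mk' _ _ _ _ _ _⟩

end LocalizedGenerator

/-! ### The open locus and the interior of the finitely generated locus -/

section Loci

open MvPowerSeries

variable {k : Type u} [Field k] {n : ℕ} (p : ℕ)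

instance charP_mvPowerSeries [CharP k p] : CharP (MvPowerSeries (Fin n) k) p :=
  charP_of_injective_ringHom (R := k) (MvPowerSeries.C).injective p

instance charP_localization_mvPowerSeries [CharP k p] (P : Ideal (MvPowerSeries (Fin n) k))
    [P.IsPrime] : CharP (Localization.AtPrime P) p :=
  charP_of_injective_ringHom (R := k)
    ((algebraMap (MvPowerSeries (Fin n) k) (Localization.AtPrime P)).comp
      MvPowerSeries.C).injective p

theorem colon_le_sup_idealJ [ExpChar (MvPowerSeries (Fin n) k) p] (G : Set (Finset (Fin n))) :
    (frobeniusPower p (squarefreeIdeal k G) 1).colon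
        (squarefreeIdeal k G : Set (MvPowerSeries (Fin n) k)) ≤
      frobeniusPower p (squarefreeIdeal k G) 1 ⊔ idealJ p (squarefreeIdeal k G) ⊔
        Ideal.span {xBeta (squarefreeIdeal k G) ^ (p - 1)} := by
  refine colon_squarefreeIdeal_le_span_monomial.trans (Ideal.span_le.2 ?_)
  rintro _ ⟨c, hc, rfl⟩
  by_cases h1 : (monomial c (1 : k) : MvPowerSeries (Fin n) k) ∈
      frobeniusPower p (squarefreeIdeal k G) 1
  · exact Ideal.mem_sup_left (Ideal.mem_sup_left h1)
  by_cases h2 : (monomial c (1 : k) : MvPowerSeries (Fin n) k) = xBeta (squarefreeIdeal k G) ^ (p - 1)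
  · exact Ideal.mem_sup_right (Ideal.subset_span h2)
  · exact Ideal.mem_sup_left (Ideal.mem_sup_right (Ideal.subset_span ⟨c, ⟨hc, h1, h2⟩, rfl⟩))

/-- Outside `V(Ann M)` some annihilator of `M` avoids the prime; a lift of it to the power series
ring becomes a unit in the localization. -/
theorem exists_mul_mem_of_mem_openLocus {I : Ideal (MvPowerSeries (Fin n) k)}
    {Q : PrimeSpectrum (MvPowerSeries (Fin n) k ⧸ I)} (hQ : Q ∈ openLocus p I) :
    ∃ r : MvPowerSeries (Fin n) k, Ideal.Quotient.mk I r ∉ Q.asIdeal ∧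
      ∀ x ∈ idealJ p I, r * x ∈ frobeniusPower p I 1 := by
  have h1 : ∃ a ∈ Module.annihilator (MvPowerSeries (Fin n) k ⧸ I) (ModuleM p I), a ∉ Q.asIdeal := by
    by_contra! hcon
    exact hQ hcon
  obtain ⟨a, ha, haQ⟩ := h1
  obtain ⟨r, rfl⟩ := Ideal.Quotient.mk_surjective a
  refine ⟨r, haQ, fun x hx => ?_⟩
  let y : ↥(frobeniusPower p I 1 ⊔ idealJ p I) := ⟨x, Ideal.mem_sup_right hx⟩
  let m : ModuleM p I := Submodule.Quotient.mk y
  have h2 : Ideal.Quotient.mk I r • m = 0 := Module.mem_annihilator.1 ha m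
  have h3 : r • m = 0 := (Module.IsTorsionBySet.mk_smul (ModuleM.isTorsionBySet p I) r m).symm.trans h2
  exact (Submodule.Quotient.mk_eq_zero ((frobeniusPower p I 1).submoduleOf
    (frobeniusPower p I 1 ⊔ idealJ p I)) (x := r • y)).1 h3

theorem isFedderGenerator_xBeta [ExpChar (MvPowerSeries (Fin n) k) p] {R' : Type*} [CommRing R']
    [ExpChar R' p] (hp : 0 < p) {f : MvPowerSeries (Fin n) k →+* R'} (hf : f.Flat)
    (G : Set (Finset (Fin n))) {r : MvPowerSeries (Fin n) k} (hr : IsUnit (f r))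
    (hJ : ∀ x ∈ idealJ p (squarefreeIdeal k G), r * x ∈ frobeniusPower p (squarefreeIdeal k G) 1) :
    IsFedderGenerator p ((squarefreeIdeal k G).map f)
      (f (xBeta (squarefreeIdeal k G) ^ (p - 1))) 1 := by
  refine isFedderGenerator_map_of_flat hf (colon_le_sup_idealJ p G) hr hJ (fun a ha => ?_) ?_
  · exact mem_squarefreeIdeal_of_mul_mem hp (Submodule.mem_colon_singleton.1 ha)
  · refine prod_X_pow_mul_mem fun s hs => ?_
    obtain ⟨t, hts, ht⟩ := exists_minimal_le_of_wellFoundedLT (fun t => t ∈ G) s hs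
    exact ⟨t, ht.prop, hts, fun i hi => by
      simpa using X_mem_sSup_minimalPrimes (k := k) ht hi⟩

theorem isFedderGenerator_variables [ExpChar (MvPowerSeries (Fin n) k) p] {R' : Type*} [CommRing R']
    [ExpChar R' p] (hp : 0 < p) {f : MvPowerSeries (Fin n) k →+* R'} (hf : f.Flat)
    (V : Finset (Fin n)) :
    IsFedderGenerator p ((squarefreeIdeal k {s | ∃ i ∈ V, s = {i}}).map f)
      (f ((∏ i ∈ V, X i) ^ (p - 1))) 1 := by
  refine isFedderGenerator_map_of_flat hf (J := ⊥) (r := 1) ?_ ?_ ?_ (fun a ha => ?_) ?_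
  · rw [sup_bot_eq]
    exact colon_variables_le hp V
  · rw [map_one]
    exact isUnit_one
  · intro x hx
    rw [Ideal.mem_bot.1 hx, mul_zero]
    exact zero_mem _
  · exact mem_squarefreeIdeal_of_mul_mem hp (Submodule.mem_colon_singleton.1 ha)
  · refine prod_X_pow_mul_mem ?_
    rintro _ ⟨i, hi, rfl⟩
    exact ⟨{i}, ⟨i, hi, rfl⟩, subset_rfl, by simpa using hi⟩

/-- After inverting the variables outside `V`, where `V` is a minimal set of variables meeting every
generator, a square-free monomial ideal is generated by the variables in `V`. -/
theorem map_squarefreeIdeal_eq_map_variables {G : Set (Finset (Fin n))} {V : Finset (Fin n)}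
    (hV : Minimal (fun V : Finset (Fin n) => ∀ s ∈ G, ∃ i ∈ s, i ∈ V) V) {R' : Type*} [CommRing R']
    {f : MvPowerSeries (Fin n) k →+* R'} (hf : ∀ i ∉ V, IsUnit (f (X i))) :
    (squarefreeIdeal k G).map f = (squarefreeIdeal k {s | ∃ i ∈ V, s = {i}}).map f := by
  classical
  apply le_antisymm
  · refine Ideal.map_mono (Ideal.span_le.2 ?_)
    rintro _ ⟨s, hs, rfl⟩
    obtain ⟨i, his, hiV⟩ := hV.prop s hs
    refine Ideal.mem_of_dvd _ (Finset.dvd_prod_of_mem _ his) (Ideal.subset_span ⟨{i}, ⟨i, hiV, rfl⟩, ?_⟩)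
    exact Finset.prod_singleton _ _
  · rw [squarefreeIdeal, Ideal.map_span]
    refine Ideal.span_le.2 ?_
    rintro _ ⟨_, ⟨_, ⟨i, hi, rfl⟩, rfl⟩, rfl⟩
    -- Minimality of `V` provides a generator meeting `V` only in `i`; its other variables are
    -- inverted, which leaves `X i` in the ideal.
    have h1 : ∃ s ∈ G, ∀ j ∈ s, j ∈ V → j = i := by
      by_contra! hcon
      have h2 : V ⊆ V.erase i := hV.le_of_le (fun s hs => by
        obtain ⟨j, hjs, hjV, hji⟩ := hcon s hs
        exact ⟨j, hjs, Finset.mem_erase.2 ⟨hji, hjV⟩⟩) (Finset.erase_subset _ _)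
      exact Finset.notMem_erase i V (h2 hi)
    obtain ⟨s, hs, hsV⟩ := h1
    obtain ⟨j, hjs, hjV⟩ := hV.prop s hs
    obtain rfl := hsV j hjs hjV
    have h2 : f (∏ l ∈ s, X l) ∈ (squarefreeIdeal k G).map f :=
      Ideal.mem_map_of_mem f (Ideal.subset_span ⟨s, hs, rfl⟩)
    rw [← Finset.mul_prod_erase s _ hjs, map_mul, map_prod] at h2
    have hunit : IsUnit (∏ l ∈ s.erase j, f (X l)) :=
      IsUnit.prod_iff.2 fun l hl => hf l fun hlV =>
        (Finset.mem_erase.1 hl).1 (hsV l (Finset.mem_erase.1 hl).2 hlV)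
    change f (∏ l ∈ {j}, X l) ∈ _
    rw [Finset.prod_singleton]
    exact (Ideal.mul_unit_mem_iff_mem _ hunit).1 h2

variable [Fact p.Prime] [CharP k p]

theorem stalk_isPrincipalSkewPolynomial_and_fg (I : Ideal (MvPowerSeries (Fin n) k))
    (Q : PrimeSpectrum (MvPowerSeries (Fin n) k ⧸ I))
    {u : Localization.AtPrime (Q.asIdeal.comap (Ideal.Quotient.mk I))}
    (hu : IsFedderGenerator p (I.map (algebraMap _ _)) u 1) :
    IsPrincipalSkewPolynomial p (Localization.AtPrime (Q.asIdeal.comap (Ideal.Quotient.mk I)))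
        (Localization.AtPrime Q.asIdeal) (stalkMap I Q) u ∧
      Q ∈ fgLocus p (MvPowerSeries (Fin n) k ⧸ I) := by
  have : IsNoetherianRing (Localization.AtPrime (Q.asIdeal.comap (Ideal.Quotient.mk I))) :=
    IsLocalization.isNoetherianRing (Q.asIdeal.comap (Ideal.Quotient.mk I)).primeCompl _ inferInstance
  refine isPrincipalSkewPolynomial_and_fg
    (flat_frobenius_localization p (flat_frobenius p n k) _) (stalkMap_surjective I Q) ?_
  rw [ker_stalkMap]
  exact hu

theorem stalk_of_mem_openLocus (G : Set (Finset (Fin n)))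
    {Q : PrimeSpectrum (MvPowerSeries (Fin n) k ⧸ squarefreeIdeal k G)}
    (hQ : Q ∈ openLocus p (squarefreeIdeal k G)) :
    IsPrincipalSkewPolynomial p
        (Localization.AtPrime (Q.asIdeal.comap (Ideal.Quotient.mk (squarefreeIdeal k G))))
        (Localization.AtPrime Q.asIdeal) (stalkMap (squarefreeIdeal k G) Q)
        (algebraMap (MvPowerSeries (Fin n) k) _ (xBeta (squarefreeIdeal k G) ^ (p - 1))) ∧
      Q ∈ fgLocus p (MvPowerSeries (Fin n) k ⧸ squarefreeIdeal k G) := by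
  obtain ⟨r, hr, hJ⟩ := exists_mul_mem_of_mem_openLocus p hQ
  refine stalk_isPrincipalSkewPolynomial_and_fg p _ Q (isFedderGenerator_xBeta p
    (Fact.out : p.Prime).pos ?_ G (r := r) ?_ hJ)
  · exact RingHom.flat_algebraMap_iff.2 (IsLocalization.flat _
      (Q.asIdeal.comap (Ideal.Quotient.mk (squarefreeIdeal k G))).primeCompl)
  · exact IsLocalization.map_units
      (Localization.AtPrime (Q.asIdeal.comap (Ideal.Quotient.mk (squarefreeIdeal k G))))
      (⟨r, hr⟩ : (Q.asIdeal.comap (Ideal.Quotient.mk (squarefreeIdeal k G))).primeCompl)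

/-- On the basic open set where the variables outside a minimal cover `V` are invertible, `I`
becomes the ideal of the variables in `V`, for which the colon conditions hold outright. -/
theorem interior_fgLocus_nonempty (G : Set (Finset (Fin n))) (hG : squarefreeIdeal k G ≠ ⊤) :
    (interior (fgLocus p (MvPowerSeries (Fin n) k ⧸ squarefreeIdeal k G))).Nonempty := by
  classical
  have h1 : ∀ s ∈ G, ∃ i ∈ s, i ∈ (Finset.univ : Finset (Fin n)) := by
    intro s hs
    rcases s.eq_empty_or_nonempty with rfl | ⟨i, hi⟩
    · refine absurd ((Ideal.eq_top_iff_one _).2 ?_) hG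
      exact Ideal.subset_span ⟨∅, hs, Finset.prod_empty⟩
    · exact ⟨i, hi, Finset.mem_univ i⟩
  obtain ⟨V, -, hV⟩ := exists_minimal_le_of_wellFoundedLT
    (fun V : Finset (Fin n) => ∀ s ∈ G, ∃ i ∈ s, i ∈ V) Finset.univ h1
  let I := squarefreeIdeal k G
  let x : MvPowerSeries (Fin n) k ⧸ I := Ideal.Quotient.mk I (∏ i ∈ Vᶜ, X i)
  have hsub : (PrimeSpectrum.basicOpen x : Set _) ⊆
      fgLocus p (MvPowerSeries (Fin n) k ⧸ I) := by
    intro Q hQ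
    have hx : ∏ i ∈ Vᶜ, X i ∉ Q.asIdeal.comap (Ideal.Quotient.mk I) := hQ
    refine (stalk_isPrincipalSkewPolynomial_and_fg p I Q
      (u := algebraMap (MvPowerSeries (Fin n) k) _ ((∏ i ∈ V, X i) ^ (p - 1))) ?_).2
    rw [map_squarefreeIdeal_eq_map_variables hV fun i hi => ?_]
    · refine isFedderGenerator_variables p (Fact.out : p.Prime).pos ?_ V
      exact RingHom.flat_algebraMap_iff.2 (IsLocalization.flat _
        (Q.asIdeal.comap (Ideal.Quotient.mk I)).primeCompl)
    · refine IsLocalization.map_units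
        (Localization.AtPrime (Q.asIdeal.comap (Ideal.Quotient.mk I)))
        (⟨X i, fun hmem => hx ?_⟩ : (Q.asIdeal.comap (Ideal.Quotient.mk I)).primeCompl)
      exact Ideal.mem_of_dvd _ (Finset.dvd_prod_of_mem _ (Finset.mem_compl.2 hi)) hmem
  have : IsDomain (MvPowerSeries (Fin n) k) := NoZeroDivisors.to_isDomain _
  -- The kernel of setting the variables in `V` to zero is a prime that contains no variable outside
  -- `V`, hence a point of the basic open set.
  let ψ : MvPowerSeries (Fin n) k ⧸ I →+* MvPowerSeries (Fin n) k :=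
    Ideal.Quotient.lift I (killVariables k V) (squarefreeIdeal_le_ker_killVariables hV.prop)
  refine ⟨⟨RingHom.ker ψ, RingHom.ker_isPrime ψ⟩,
    mem_interior.2 ⟨_, hsub, PrimeSpectrum.isOpen_basicOpen, fun hmem => ?_⟩⟩
  have h2 : killVariables k V (∏ i ∈ Vᶜ, X i) = 0 := hmem
  rw [map_prod, Finset.prod_eq_zero_iff] at h2
  obtain ⟨i, hi, h0⟩ := h2
  exact Finset.mem_compl.1 hi (killVariables_X_eq_zero_iff.1 h0)

end Loci

end FrobeniusLocus

theorem theorem2p4 {k : Type u} [Field k] (p : ℕ) [Fact p.Prime] [CharP k p] (n : ℕ)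
    (I : Ideal (MvPowerSeries (Fin n) k)) (hI : FrobeniusLocus.IsSquarefreeMonomialIdeal I)
    (hI_ne_top : I ≠ ⊤) :
    IsOpen (FrobeniusLocus.openLocus p I) ∧
    FrobeniusLocus.openLocus p I ⊆
      FrobeniusLocus.fgLocus p (MvPowerSeries (Fin n) k ⧸ I) ∧
    (interior (FrobeniusLocus.fgLocus p (MvPowerSeries (Fin n) k ⧸ I))).Nonempty ∧
    ∀ Q ∈ FrobeniusLocus.openLocus p I,
      FrobeniusLocus.IsPrincipalSkewPolynomial p
        (Localization.AtPrime (Q.asIdeal.comap (Ideal.Quotient.mk I)))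
        (Localization.AtPrime Q.asIdeal)
        (FrobeniusLocus.stalkMap I Q)
        (algebraMap (MvPowerSeries (Fin n) k) _ (FrobeniusLocus.xBeta I ^ (p - 1))) := by
  obtain ⟨G, rfl⟩ := hI
  exact ⟨(PrimeSpectrum.isClosed_zeroLocus _).isOpen_compl,
    fun Q hQ => (FrobeniusLocus.stalk_of_mem_openLocus p G hQ).2,
    FrobeniusLocus.interior_fgLocus_nonempty p G hI_ne_top,
    fun Q hQ => (FrobeniusLocus.stalk_of_mem_openLocus p G hQ).1⟩
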